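/- Let $F$ be a non-archimedean local field with residue field $\kappa$ of characteristic $p$, and let $C$ be an algebraically closed field of characteristic $p$. Let $\mathcal H$ be the pro-$p$-Iwahori Hecke algebra of $\mathrm{GL}_2(F)$ over $C$, that is, the $C$-algebra with basis $T_w$, where $w$ runs through $$W(1)=S_2\ltimes(F^\times/(1+\mathfrak m_F))^2\simeq S_2\ltimes(\mathbb Z\times\kappa^\times)^2,$$ with the braid relations $T_{vw}=T_vT_w$ if $\ell(vw)=\ell(v)+\ell(w)$ and the quadratic relations $T_{\tilde s}^2=q_sT_{\tilde s^2}+c_{\tilde s}T_{\tilde s}$ for all lifts $\tilde s\in W(1)$ of the simple affine reflections $s\in S_{\mathrm{aff}}=\{s_0,s_1\}$. Here $Z_\kappa=(\kappa^\times)^2\subset W(1)$, $\nu_1,\nu_2\colon\kappa^\times\to Z_\kappa$ are the two coordinate embeddings, $q_s=\#\kappa$ (which is $0$ in $C$), $s_1$ is the permutation matrix, $\omega=\begin{pmatrix}0&\varpi\\1&0\end{pmatrix}$ for a uniformizer $\varpi$ of $F$, $s_0=\omega s_1\omega^{-1}$, and $c_{ts_i}=t\,\nu_1(-1)\sum_{u\in\kappa^\times}T_{\nu_1(u)\nu_2(u)^{-1}}$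 for $t\in Z_\kappa$. The length $\ell$ is the Coxeter length of the affine Weyl group, inflated to $W(1)$; its zero set is $\Omega(1)=\langle\omega\rangle Z_\kappa$. Modules are right modules. Let $W^{\mathrm{aff}}(1)\subset W(1)$ be the subgroup of elements whose valuations sum to $0$, and $\mathcal H^{\mathrm{aff}}=\bigoplus_{w\in W^{\mathrm{aff}}(1)}CT_w$. For a character $\chi\colon Z_\kappa\to C^\times$, write $\chi(t_1,t_2)=\chi_1(t_1)\chi_2(t_2)$, extend $\chi$ linearly to $C[Z_\kappa]$, and put $S_{\mathrm{aff},\chi}=\{s\in S_{\mathrm{aff}}\mid\chi(c_{\tilde s})\neq0\}$. For $J\subset S_{\mathrm{aff},\chi}$ let $\Xi=\Xi_{J,\chi}$ be the character of $\mathcal H^{\mathrm{aff}}$ with $\Xi(T_t)=\chi(t)$ for $t\in Z_\kappa$, $\Xi(T_{\tilde s})=\chi(c_{\tilde s})$ for $s\notin J$ and $\Xi(T_{\tilde s})=0$ for $s\in J$. Let $\Omega(1)_\Xi$ be the stabilizer of $\Xi$ in $\Omega(1)$, let $V$ be a simple $C[\Omega(1)_\Xi]$-module on which $Z_\kappa$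 acts through $\chi$, and put $$\pi_{\chi,J,V}=(\Xi\otimes V)\otimes_{\mathcal H_\Xi}\mathcal H,\qquad \mathcal H_\Xi=\mathcal H^{\mathrm{aff}}C[\Omega(1)_\Xi]$$ (a simple $\mathcal H$-module). An $\mathcal H$-module $\pi$ is called supersingular if there is $n>0$ such that $\pi z_{\mathcal O}^n=0$ for every $W(1)$-conjugacy class $\mathcal O\subset\Lambda(1)=(\mathbb Z\times\kappa^\times)^2$ of positive length, where $z_{\mathcal O}=\sum_{\lambda\in\mathcal O}E_o(\lambda)$ and $E_o$ denotes the alcove walk (Bernstein) basis of $\mathcal H$ for a spherical orientation $o$. Let $\pi_{\chi,J,V}$ and $\pi_{\chi',J',V'}$ be two such modules that are supersingular. Then, with $\mathrm{Ext}^1$ taken in the category of all $\mathcal H$-modules (no central character is fixed), $$\dim_C\mathrm{Ext}^1_{\mathcal H}(\pi_{\chi,J,V},\pi_{\chi',J',V'})=\begin{cases}0&\text{if }\pi_{\chi,J,V}\not\simeq\pi_{\chi',J',V'},\\2&\text{if }\pi_{\chi,J,V}\simeq\pi_{\chi',J',V'}\text{ and }\chi_1=\chi_2,\\3&\text{if }\pi_{\chi,J,V}\simeq\pi_{\chi',J',V'}\text{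 and }\chi_1\neq\chi_2.\end{cases}$$ -/

import Mathlib

open scoped TensorProduct
open MulOpposite (op)

universe u v t

noncomputable section

namespace GL2Hecke

section WeylGroup

variable (k : Type u) [Field k]

/-- The group `Z_κ = (κˣ)²` (here `k = κ` is the residue field). -/
abbrev Zk : Type u := Fin 2 → kˣ

/-- The extended pro-`p` affine Weyl group `W(1) = S₂ ⋉ (ℤ × κˣ)²` of `GL₂`.  The element `⟨x, σ⟩`
corresponds to the monomial matrix `diag(ϖ ^ n₀ [t₀], ϖ ^ n₁ [t₁]) * P_σ`, `x i = (nᵢ, tᵢ)`. -/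
abbrev W1 : Type u :=
  (Fin 2 → Multiplicative ℤ × kˣ) ⋊[mulAutArrow] (Equiv.Perm (Fin 2))

variable {k}

/-- The embedding `Z_κ → W(1)`. -/
def zk : Zk k →* W1 k :=
  SemidirectProduct.inl.comp (MonoidHom.mk' (fun t i => (1, t i)) (by
    intro a b; funext i; simp))

/-- The permutation matrix `s₁`. -/
def s1 : W1 k := ⟨1, Equiv.swap 0 1⟩

/-- The element `ω = (1 2)·(0, 1)`, that is the matrix `(0 ϖ; 1 0)`, generating `Ω`. -/
def omg : W1 k :=
  ⟨1, Equiv.swap 0 1⟩ * ⟨Pi.mulSingle 1 (Multiplicative.ofAdd 1, 1), 1⟩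

/-- The simple affine reflections `s₁` and `s₀ = ω s₁ ω⁻¹`, lifted to `W(1)`. -/
def sLift (i : Fin 2) : W1 k := if i = 1 then s1 else omg * s1 * omg⁻¹

variable (k) in
/-- `S_aff(1)`: all the lifts `t sᵢ` to `W(1)` of the simple affine reflections. -/
def Saff1 : Set (W1 k) := {w | ∃ (t : Zk k) (i : Fin 2), w = zk t * sLift i}

variable (k) in
/-- `Ω(1) = ⟨ω⟩ (κˣ)²`. -/
def Omega1 : Subgroup (W1 k) := Subgroup.zpowers omg ⊔ (zk (k := k)).range

theorem arr_zero {A : Type*} [Group A] (y : Fin 2 → A) :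
    mulAutArrow (Equiv.swap 0 1 : Equiv.Perm (Fin 2)) y 0 = y 1 := by
  change y ((Equiv.swap 0 1 : Equiv.Perm (Fin 2))⁻¹ • 0) = y 1
  simp

theorem arr_one {A : Type*} [Group A] (y : Fin 2 → A) :
    mulAutArrow (Equiv.swap 0 1 : Equiv.Perm (Fin 2)) y 1 = y 0 := by
  change y ((Equiv.swap 0 1 : Equiv.Perm (Fin 2))⁻¹ • 1) = y 0
  simp

/-- The sum of the two valuations (the valuation of the determinant). -/
def deg : W1 k →* Multiplicative ℤ :=
  MonoidHom.mk' (fun w => (w.left 0).1 * (w.left 1).1) (by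
    rintro ⟨x, σ⟩ ⟨y, τ⟩
    have h : σ = 1 ∨ σ = Equiv.swap 0 1 := by revert σ; decide
    rcases h with rfl | rfl
    · simp [mul_mul_mul_comm]
    · simp only [SemidirectProduct.mul_def, Pi.mul_apply, Prod.fst_mul, arr_zero, arr_one]
      rw [mul_mul_mul_comm, mul_comm (y 1).1])

variable (k) in
/-- `W^aff(1)`: the inverse image in `W(1)` of `W_aff = S₂ ⋉ {(x₀, x₁) ∈ ℤ² | x₀ + x₁ = 0}`. -/
def Waff1 : Subgroup (W1 k) := (deg (k := k)).ker

variable (k) in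
/-- `Λ(1) = (ℤ × κˣ)²`, the kernel of `W(1) → W₀ = S₂`. -/
def Lam1 : Subgroup (W1 k) := SemidirectProduct.rightHom.ker

/-- `w = s̃₁ ⋯ s̃ₗ u` with `s̃ᵢ ∈ S_aff(1)` and `u ∈ Ω(1)`. -/
def IsDecomp (w : W1 k) (L : List (W1 k)) (v : W1 k) : Prop :=
  (∀ s ∈ L, s ∈ Saff1 k) ∧ v ∈ Omega1 k ∧ w = L.prod * v

/-- The length on `W(1)`: the inflation of the Coxeter length of `W_aff` along
`W(1) → W = W_aff ⋊ Ω → W_aff`. -/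
def len (w : W1 k) : ℕ := sInf {n | ∃ L v, IsDecomp w L v ∧ L.length = n}

/-- For `w ∈ S_aff(1)`, the element `c_w ∈ C[Z_κ]` is the sum of the group elements `cElt w u`,
`u ∈ κˣ`. Explicitly, if `w = t sᵢ` then
`c_w = t · ν₁(-1) · ∑_u ν₁(u) ν₂(u)⁻¹` (so that `c` of the lift `ν₁(-1) sᵢ`, which for `i = 1`
is the lift of `s₁` coming from `SL₂`, is `∑_u ν₁(u) ν₂(u)⁻¹`). -/
def cElt (w : W1 k) (v : kˣ) : Zk k := fun i => (w.left i).2 * ![-v, v⁻¹] i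

end WeylGroup

section Algebra

variable (C : Type v) (k : Type u) [Field C] [Field k]

/-- The defining relations between the generators `T_w`, `w ∈ W(1)`. -/
inductive HRel : FreeAlgebra C (W1 k) → FreeAlgebra C (W1 k) → Prop
  | one : HRel (FreeAlgebra.ι C 1) 1
  | braid (v w : W1 k) (h : len (v * w) = len v + len w) :
      HRel (FreeAlgebra.ι C v * FreeAlgebra.ι C w) (FreeAlgebra.ι C (v * w))
  | quad (s : W1 k) (h : s ∈ Saff1 k) :
      HRel (FreeAlgebra.ι C s * FreeAlgebra.ι C s)
        ((Nat.card k : C) • FreeAlgebra.ι C (s * s)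
          + (∑ᶠ v : kˣ, FreeAlgebra.ι C (zk (cElt s v))) * FreeAlgebra.ι C s)

/-- The pro-`p`-Iwahori Hecke algebra of `GL₂` over `C`: the `C`-algebra on the `T_w`, `w ∈ W(1)`,
with the braid and quadratic relations, where `q_s = #κ`. -/
def H : Type (max u v) := RingQuot (HRel C k)

instance : Ring (H C k) := inferInstanceAs (Ring (RingQuot (HRel C k)))
instance : Algebra C (H C k) := inferInstanceAs (Algebra C (RingQuot (HRel C k)))

variable {k}

/-- The elements `T_w`. -/
def T (w : W1 k) : H C k := RingQuot.mkAlgHom C (HRel C k) (FreeAlgebra.ι C w)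

/-- `c_w`, as an element of the Hecke algebra. -/
def cH (w : W1 k) : H C k := ∑ᶠ v : kˣ, T C (zk (cElt w v))

variable (k) in
/-- The subalgebra `𝓗^aff` spanned by the `T_w`, `w ∈ W^aff(1)`. -/
def Haff : Subalgebra C (H C k) := Algebra.adjoin C (T C '' (Waff1 k : Set (W1 k)))

variable {C}

theorem T_mem_Haff {w : W1 k} (hw : w ∈ Waff1 k) : T C w ∈ Haff C k :=
  Algebra.subset_adjoin ⟨w, hw, rfl⟩

theorem zk_mem (t : Zk k) : zk t ∈ Waff1 k := by
  simp [Waff1, MonoidHom.mem_ker, deg, zk]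

theorem sLift_mem (i : Fin 2) : (sLift i : W1 k) ∈ Waff1 k := by
  have h : (s1 : W1 k) ∈ Waff1 k := by simp [Waff1, MonoidHom.mem_ker, deg, s1]
  unfold sLift
  split_ifs
  · exact h
  · rw [Waff1, MonoidHom.mem_ker] at *
    simp [h]

theorem lift_mem (t : Zk k) (i : Fin 2) : zk t * sLift i ∈ Waff1 k :=
  mul_mem (zk_mem t) (sLift_mem i)

end Algebra

section Length

variable {k : Type u} [Field k]

/-- The difference of the two valuations. -/
def dd (w : W1 k) : ℤ := Multiplicative.toAdd (w.left 0).1 - Multiplicative.toAdd (w.left 1).1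

/-- The integer `n` such that `w` maps the base alcove `(0, 1)` of the line to `(n, n + 1)`. -/
def alc (w : W1 k) : ℤ := if w.right = 1 then dd w else dd w - 1

theorem perm_cases (σ : Equiv.Perm (Fin 2)) : σ = 1 ∨ σ = Equiv.swap 0 1 := by
  revert σ; decide

theorem swap_ne : (Equiv.swap 0 1 : Equiv.Perm (Fin 2)) ≠ 1 := by decide

theorem dd_mul_one {v : W1 k} (h : v.right = 1) (w : W1 k) : dd (v * w) = dd v + dd w := by
  simp [dd, h]; ring

theorem dd_mul_swap {v : W1 k} (h : v.right = Equiv.swap 0 1) (w : W1 k) :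
    dd (v * w) = dd v - dd w := by
  simp [dd, h, arr_zero, arr_one, -mulAutArrow_apply_apply]; ring

theorem alc_mul_one {v : W1 k} (h : v.right = 1) (w : W1 k) : alc (v * w) = dd v + alc w := by
  rcases perm_cases w.right with h' | h' <;>
    simp [alc, dd_mul_one h, h, h']; try ring

theorem alc_mul_swap {v : W1 k} (h : v.right = Equiv.swap 0 1) (w : W1 k) :
    alc (v * w) = dd v - 1 - alc w := by
  rcases perm_cases w.right with h' | h' <;>
    simp [alc, dd_mul_swap h, h, h'] <;> ring

theorem zk_right (t : Zk k) : (zk t).right = 1 := by simp [zk]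
theorem dd_zk (t : Zk k) : dd (zk t) = 0 := by simp [zk, dd]
theorem sLift_right (i : Fin 2) : (sLift i : W1 k).right = Equiv.swap 0 1 := by
  unfold sLift
  split_ifs <;> simp [s1, omg]

theorem dd_sLift (i : Fin 2) : dd (sLift i : W1 k) = if i = 1 then 0 else 2 := by
  unfold sLift
  split_ifs
  · simp [s1, dd]
  · simp [s1, omg, dd, arr_zero, arr_one, -mulAutArrow_apply_apply]

theorem alc_lift (t : Zk k) (i : Fin 2) (w : W1 k) :
    alc (zk t * sLift i * w) = (if i = 1 then -1 else 1) - alc w := by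
  rw [mul_assoc, alc_mul_one (zk_right t), dd_zk, alc_mul_swap (sLift_right i), dd_sLift]
  split_ifs <;> ring

theorem alc_zk (t : Zk k) : alc (zk t) = 0 := by simp [alc, zk_right, dd_zk]

theorem alc_omg : alc (omg : W1 k) = 0 := by simp [alc, omg, dd, arr_zero, arr_one, -mulAutArrow_apply_apply]

theorem alc_of_mem {v : W1 k} (hv : v ∈ Omega1 k) : alc v = 0 := by
  have key : ∀ w : W1 k, alc w = 0 → ∀ w', alc (w * w') = 0 ↔ alc w' = 0 := by
    intro w hw w'
    rcases perm_cases w.right with h | h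
    · rw [alc_mul_one h]; simp [alc, h] at hw; omega
    · rw [alc_mul_swap h]; simp [alc, h] at hw; omega
  let S : Subgroup (W1 k) :=
    { carrier := {w | alc w = 0}
      mul_mem' := fun {a b} ha hb => (key a ha b).2 hb
      one_mem' := by simp [alc, dd]
      inv_mem' := fun {a} ha => (key a ha a⁻¹).1 (by simp [alc, dd]) }
  have : Omega1 k ≤ S := by
    refine sup_le ?_ ?_
    · rw [Subgroup.zpowers_le]; exact alc_omg
    · rintro _ ⟨t, rfl⟩; exact alc_zk t
  exact this hv

theorem mem_of_alc {v : W1 k} (hv : alc v = 0) : v ∈ Omega1 k := by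
  have hω : (omg : W1 k) ∈ Omega1 k :=
    Subgroup.mem_sup_left (Subgroup.mem_zpowers _)
  have hz : ∀ t : Zk k, zk t ∈ Omega1 k := fun t => Subgroup.mem_sup_right ⟨t, rfl⟩
  have h2 : ∀ n : ℤ, ((omg : W1 k) * omg) ^ n
      = SemidirectProduct.inl (fun _ => (Multiplicative.ofAdd n, 1)) := by
    have h1 : ((omg : W1 k) * omg)
        = SemidirectProduct.inl (fun _ => (Multiplicative.ofAdd 1, 1)) := by
      ext i
      · fin_cases i <;> simp [omg, arr_zero, arr_one, -mulAutArrow_apply_apply]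
      · fin_cases i <;> simp [omg, arr_zero, arr_one, -mulAutArrow_apply_apply]
      · simp [omg]
    intro n
    rw [h1, ← map_zpow]
    congr 1
    funext i
    ext
    · simp [← ofAdd_zsmul]
    · simp
  have hone : ∀ v : W1 k, v.right = 1 → alc v = 0 → v ∈ Omega1 k := by
    intro v hr hv
    have : v = (omg * omg) ^ (Multiplicative.toAdd (v.left 0).1) * zk (fun i => (v.left i).2) := by
      rw [h2]
      simp only [alc, hr, if_true, dd] at hv
      refine SemidirectProduct.ext ?_ ?_
      · funext i
        fin_cases i
        · ext <;> simp [zk]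
        · have : (v.left 1).1 = (v.left 0).1 := by
            apply Multiplicative.toAdd.injective; omega
          ext <;> simp [zk, this]
      · simp [hr, zk]
    rw [this]
    exact mul_mem (zpow_mem (mul_mem hω hω) _) (hz _)
  rcases perm_cases v.right with h | h
  · exact hone v h hv
  · have hr : (omg : W1 k).right = Equiv.swap 0 1 := by simp [omg]
    have : omg * v ∈ Omega1 k := by
      refine hone _ (by simp [hr, h]) ?_
      rw [alc_mul_swap hr, hv]
      simp [omg, dd, arr_zero, arr_one, -mulAutArrow_apply_apply]
    have h3 := mul_mem (inv_mem hω) this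
    simpa using h3

theorem alc_le (L : List (W1 k)) (hL : ∀ s ∈ L, s ∈ Saff1 k) (v : W1 k) (hv : v ∈ Omega1 k) :
    (alc (L.prod * v)).natAbs ≤ L.length := by
  induction L with
  | nil => simp [alc_of_mem hv]
  | cons s L ih =>
    obtain ⟨t, i, rfl⟩ := hL s (by simp)
    have := ih (fun s hs => hL s (by simp [hs]))
    rw [List.prod_cons, mul_assoc, alc_lift, List.length_cons]
    split_ifs <;> omega

theorem exists_decomp (n : ℕ) (w : W1 k) (hw : (alc w).natAbs = n) :
    ∃ L v, IsDecomp w L v ∧ L.length = n := by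
  induction n generalizing w with
  | zero => exact ⟨[], w, ⟨by simp, mem_of_alc (by omega), by simp⟩, rfl⟩
  | succ n ih =>
    obtain ⟨i, hi⟩ : ∃ i : Fin 2, (alc ((sLift i)⁻¹ * w)).natAbs = n := by
      have key : ∀ i, alc w = (if i = 1 then -1 else 1) - alc ((sLift i)⁻¹ * w) := by
        intro i
        have := alc_lift 1 i ((sLift i)⁻¹ * w)
        simpa using this
      by_cases h : 0 < alc w
      · refine ⟨0, ?_⟩
        have := key 0
        simp at this; omega
      · refine ⟨1, ?_⟩
        have := key 1
        simp at this; omega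
    obtain ⟨L, v, ⟨h1, h2, h3⟩, h4⟩ := ih _ hi
    refine ⟨sLift i :: L, v, ⟨?_, h2, ?_⟩, by simp [h4]⟩
    · intro s hs
      rcases List.mem_cons.1 hs with rfl | hs
      · exact ⟨1, i, by simp⟩
      · exact h1 s hs
    · rw [List.prod_cons, mul_assoc, ← h3]; simp

/-- The length is the number of walls between the base alcove and its image. -/
theorem len_eq (w : W1 k) : len w = (alc w).natAbs := by
  apply le_antisymm
  · obtain ⟨L, v, h, h'⟩ := exists_decomp _ w rfl
    exact Nat.sInf_le ⟨L, v, h, h'⟩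
  · refine le_csInf ?_ ?_
    · obtain ⟨L, v, h, h'⟩ := exists_decomp _ w rfl
      exact ⟨_, L, v, h, h'⟩
    · rintro n ⟨L, v, ⟨h1, h2, rfl⟩, rfl⟩
      exact alc_le L h1 v h2

theorem exists_reduced (w : W1 k) :
    ∃ P : List (W1 k) × W1 k, IsDecomp w P.1 P.2 ∧ P.1.length = len w := by
  obtain ⟨L, v, h, h'⟩ := exists_decomp _ w rfl
  exact ⟨(L, v), h, by rw [len_eq]; exact h'⟩

end Length


section Characters

variable {C : Type v} {k : Type u} [Field C] [Field k]

/-- The value `χ(c_w)` of the linear extension of `χ` to `C[Z_κ]`. -/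
def chiC (χ : Zk k →* Cˣ) (w : W1 k) : C := ∑ᶠ v : kˣ, (χ (cElt w v) : C)

/-- `S_{aff,χ} = {s ∈ S_aff | χ(c_s̃) ≠ 0}`. -/
def SaffChi (χ : Zk k →* Cˣ) : Set (Fin 2) := {i | chiC χ (sLift i) ≠ 0}

open Classical in
/-- `Ξ` is a character of `𝓗^aff` with `Ξ(T_t) = χ(t)` for `t ∈ Z_κ`, and, for a lift `s̃ = t sᵢ` of
`sᵢ`, `Ξ(T_s̃) = χ(c_s̃)` if `sᵢ ∉ J` and `Ξ(T_s̃) = 0` if `sᵢ ∈ J`. -/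
def IsXi (χ : Zk k →* Cˣ) (J : Set (Fin 2)) (Ξ : Haff C k →ₐ[C] C) : Prop :=
  (∀ t : Zk k, Ξ ⟨T C (zk t), T_mem_Haff (zk_mem t)⟩ = χ t) ∧
  ∀ (t : Zk k) (i : Fin 2), Ξ ⟨T C (zk t * sLift i), T_mem_Haff (lift_mem t i)⟩
    = if i ∈ J then 0 else chiC χ (zk t * sLift i)

/-- `χ` or `χ` precomposed with the swap, according to the parity of `n`. -/
def chiPar (χ : Zk k →* Cˣ) (n : ℤ) (x : Zk k) : C :=
  if n % 2 = 0 then χ x else χ (mulAutArrow (Equiv.swap 0 1 : Equiv.Perm (Fin 2)) x)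

open Classical in
/-- `∑ᵤ χ(u, u⁻¹)`, or `0` if the simple reflection with the parity of `n` is in `J`. -/
def alPar (χ : Zk k →* Cˣ) (J : Set (Fin 2)) (n : ℤ) : C :=
  if (if n % 2 = 0 then (0 : Fin 2) else 1) ∈ J then 0 else ∑ᶠ v : kˣ, (χ ![v, v⁻¹] : C)

/-- The units components of an element of `W(1)`. -/
def uu (w : W1 k) : Zk k := fun i => (w.left i).2

/-- Matrix coefficients of an auxiliary representation used to construct `Ξ`. -/
def theta (χ : Zk k →* Cˣ) (J : Set (Fin 2)) (p : ℤ) (w : W1 k) : C :=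
  chiPar χ p (uu w) * (if w.right = 1 then 1 else (χ ![-1, 1] : C))
    * (alPar χ J (1 + p) ^ (alc w / 2).natAbs * alPar χ J p ^ ((alc w + 1) / 2).natAbs)

theorem alPar_add (χ : Zk k →* Cˣ) (J : Set (Fin 2)) {n m : ℤ} (h : n % 2 = m % 2) :
    alPar χ J n = alPar χ J m := by unfold alPar; rw [h]

theorem chiPar_congr (χ : Zk k →* Cˣ) {n m : ℤ} (h : n % 2 = m % 2) (x : Zk k) :
    chiPar χ n x = chiPar χ m x := by simp [chiPar, h]

/-- The sum of the two valuations. -/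
def mm (w : W1 k) : ℤ := Multiplicative.toAdd (deg w)

theorem mm_parity (w : W1 k) : (mm w) % 2 = (dd w) % 2 := by
  simp [mm, dd, deg]; omega

theorem chi_split (χ : Zk k →* Cˣ) (x : Zk k) :
    χ x = χ ![x 0, 1] * χ ![1, x 1] := by
  rw [← map_mul]; congr 1; funext i; fin_cases i <;> simp

theorem chi_swap (χ : Zk k →* Cˣ) (h : ∀ v : kˣ, χ ![v, 1] = χ ![1, v]) (x : Zk k) :
    χ (mulAutArrow (Equiv.swap 0 1 : Equiv.Perm (Fin 2)) x) = χ x := by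
  rw [chi_split, chi_split χ x, arr_zero, arr_one, h (x 1), ← h (x 0), mul_comm]

theorem sum_eq_zero [Finite k] (χ : Zk k →* Cˣ) (h : ¬ ∀ v : kˣ, χ ![v, 1] = χ ![1, v]) :
    ∑ᶠ v : kˣ, (χ ![v, v⁻¹] : C) = 0 := by
  classical
  have := Fintype.ofFinite kˣ
  let f : kˣ →* C := (Units.coeHom C).comp (χ.comp (MonoidHom.mk' (fun v => ![v, v⁻¹]) (by
    intro a b; funext i; fin_cases i <;> simp [mul_comm])))
  have hf : f ≠ 1 := by
    intro hf
    apply h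
    intro v
    have h1 : χ ![v, v⁻¹] = 1 := by
      have := DFunLike.congr_fun hf v
      simpa [f] using this
    have h2 : (![v, 1] : Zk k) = ![v, v⁻¹] * ![1, v] := by
      funext i; fin_cases i <;> simp
    rw [h2, map_mul, h1, one_mul]
  rw [finsum_eq_sum_of_fintype]
  have := sum_hom_units f
  rw [if_neg hf] at this
  simpa [f] using this

theorem uu_mul (v w : W1 k) : uu (v * w) = uu v * mulAutArrow v.right (uu w) := by
  rcases perm_cases v.right with h | h
  · funext i
    simp [uu, h]
  · funext i
    fin_cases i <;> simp [uu, h, arr_zero, arr_one, -mulAutArrow_apply_apply]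

theorem chiPar_mul (χ : Zk k →* Cˣ) (p : ℤ) (x y : Zk k) :
    chiPar χ p (x * y) = chiPar χ p x * chiPar χ p y := by
  unfold chiPar; split_ifs <;> simp

theorem swap_swap' (x : Zk k) : mulAutArrow (Equiv.swap 0 1 : Equiv.Perm (Fin 2))
    (mulAutArrow (Equiv.swap 0 1 : Equiv.Perm (Fin 2)) x) = x := by
  funext i; fin_cases i <;> simp [arr_zero, arr_one, -mulAutArrow_apply_apply]

theorem alc_parity (v : W1 k) :
    (v.right = 1 ∧ alc v = dd v) ∨ (v.right = Equiv.swap 0 1 ∧ alc v = dd v - 1) := by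
  rcases perm_cases v.right with h | h <;> simp [alc, h]

theorem theta_mul [Finite k] (χ : Zk k →* Cˣ) (J : Set (Fin 2)) (p : ℤ) (v w : W1 k)
    (h : len (v * w) = len v + len w) :
    theta χ J p (v * w) = theta χ J p v * theta χ J (p - mm v) w := by
  have hm := mm_parity v
  rw [len_eq, len_eq, len_eq] at h
  have hsign : (if (v * w).right = 1 then 1 else (χ ![-1, 1] : C))
      = (if v.right = 1 then 1 else (χ ![-1, 1] : C))
        * (if w.right = 1 then 1 else (χ ![-1, 1] : C)) := by
    have : (χ ![-1, 1] : C) * (χ ![-1, 1] : C) = 1 := by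
      rw [← Units.val_mul, ← map_mul]
      have : (![-1, 1] * ![-1, 1] : Zk k) = 1 := by funext i; fin_cases i <;> simp
      rw [this]; simp
    rcases perm_cases v.right with h1 | h1 <;> rcases perm_cases w.right with h2 | h2 <;>
      simp [h1, h2, this]
  have hexp : (alPar χ J (1 + p) ^ (alc (v * w) / 2).natAbs
        * alPar χ J p ^ ((alc (v * w) + 1) / 2).natAbs)
      = (alPar χ J (1 + p) ^ (alc v / 2).natAbs * alPar χ J p ^ ((alc v + 1) / 2).natAbs)
        * (alPar χ J (1 + (p - mm v)) ^ (alc w / 2).natAbs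
          * alPar χ J (p - mm v) ^ ((alc w + 1) / 2).natAbs) := by
    by_cases hpar : mm v % 2 = 0
    · rw [alPar_add χ J (show (1 + (p - mm v)) % 2 = (1 + p) % 2 by omega),
        alPar_add χ J (show (p - mm v) % 2 = p % 2 by omega)]
      have e1 : (alc (v * w) / 2).natAbs = (alc v / 2).natAbs + (alc w / 2).natAbs := by
        rcases alc_parity v with ⟨h1, h2⟩ | ⟨h1, h2⟩
        · rw [alc_mul_one h1] at *; omega
        · rw [alc_mul_swap h1] at *; omega
      have e2 : ((alc (v * w) + 1) / 2).natAbs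
          = ((alc v + 1) / 2).natAbs + ((alc w + 1) / 2).natAbs := by
        rcases alc_parity v with ⟨h1, h2⟩ | ⟨h1, h2⟩
        · rw [alc_mul_one h1] at *; omega
        · rw [alc_mul_swap h1] at *; omega
      rw [e1, e2, pow_add, pow_add]; ring
    · rw [alPar_add χ J (show (1 + (p - mm v)) % 2 = p % 2 by omega),
        alPar_add χ J (show (p - mm v) % 2 = (1 + p) % 2 by omega)]
      have e1 : (alc (v * w) / 2).natAbs = (alc v / 2).natAbs + ((alc w + 1) / 2).natAbs := by
        rcases alc_parity v with ⟨h1, h2⟩ | ⟨h1, h2⟩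
        · rw [alc_mul_one h1] at *; omega
        · rw [alc_mul_swap h1] at *; omega
      have e2 : ((alc (v * w) + 1) / 2).natAbs
          = ((alc v + 1) / 2).natAbs + (alc w / 2).natAbs := by
        rcases alc_parity v with ⟨h1, h2⟩ | ⟨h1, h2⟩
        · rw [alc_mul_one h1] at *; omega
        · rw [alc_mul_swap h1] at *; omega
      rw [e1, e2, pow_add, pow_add]; ring
  have hchi : (∀ x, chiPar χ p (mulAutArrow v.right x) = chiPar χ (p - mm v) x) →
      theta χ J p (v * w) = theta χ J p v * theta χ J (p - mm v) w := by
    intro hx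
    unfold theta
    rw [hexp, hsign, uu_mul, chiPar_mul, hx]
    ring
  by_cases hχ : ∀ u : kˣ, χ ![u, 1] = χ ![1, u]
  · apply hchi
    intro x
    have : ∀ n y, chiPar χ n y = χ y := by
      intro n y; unfold chiPar; rw [chi_swap χ hχ]; simp
    rw [this, this]
    rcases perm_cases v.right with h1 | h1 <;> rw [h1]
    · simp
    · rw [chi_swap χ hχ]
  · by_cases h0 : alc v = 0
    · apply hchi
      intro x
      rcases alc_parity v with ⟨h1, h2⟩ | ⟨h1, h2⟩
      · rw [h1, map_one, MulAut.one_apply]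
        exact chiPar_congr χ (by omega) x
      · rw [h1]
        unfold chiPar
        rw [swap_swap']
        split_ifs <;> first | rfl | omega
    · have hal : ∀ n, alPar χ J n = 0 := by
        intro n; unfold alPar; rw [sum_eq_zero χ hχ]; simp
      have key : ∀ n (u : W1 k), alc u ≠ 0 → theta χ J n u = 0 := by
        intro n u hu
        unfold theta
        rw [hal, hal, ← pow_add, zero_pow (by omega), mul_zero]
      rw [key _ _ (by omega), key _ _ h0, zero_mul]

/-- An auxiliary representation of `𝓗`, used to construct `Ξ`. -/
def opW (χ : Zk k →* Cˣ) (J : Set (Fin 2)) (w : W1 k) : Module.End C (ℤ → C) where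
  toFun f p := theta χ J p w * f (p - mm w)
  map_add' f g := by funext p; simp [mul_add]
  map_smul' a f := by funext p; simp [mul_left_comm]

theorem mm_mul (v w : W1 k) : mm (v * w) = mm v + mm w := by simp [mm]

theorem mm_zk (t : Zk k) : mm (zk t) = 0 := by
  have := zk_mem t
  rw [Waff1, MonoidHom.mem_ker] at this
  simp [mm, this]

theorem theta_zk (χ : Zk k →* Cˣ) (J : Set (Fin 2)) (p : ℤ) (t : Zk k) :
    theta χ J p (zk t) = chiPar χ p t := by
  have : uu (zk t) = t := by funext i; simp [uu, zk]
  simp [theta, this, zk_right, alc_zk]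

theorem uu_lift (t : Zk k) (i : Fin 2) : uu (zk t * sLift i) = t := by
  have h1 : uu (zk t) = t := by funext i; simp [uu, zk]
  have h2 : uu (sLift i : W1 k) = 1 := by
    unfold sLift
    split_ifs
    · funext j; simp [uu, s1]
    · funext j
      fin_cases j <;> simp [uu, s1, omg, arr_zero, arr_one, -mulAutArrow_apply_apply]
  rw [uu_mul, h1, h2]; simp

theorem alc_lift' (t : Zk k) (i : Fin 2) :
    alc (zk t * sLift i) = if i = 1 then -1 else 1 := by
  have := alc_lift t i 1
  rw [mul_one] at this
  rw [this]
  simp [alc, dd]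

theorem theta_lift (χ : Zk k →* Cˣ) (J : Set (Fin 2)) (p : ℤ) (t : Zk k) (i : Fin 2) :
    theta χ J p (zk t * sLift i)
      = chiPar χ p t * (χ ![-1, 1] : C) * alPar χ J (p + (if i = 1 then 1 else 0)) := by
  unfold theta
  rw [uu_lift, alc_lift']
  have : (zk t * sLift i).right ≠ 1 := by simp [zk_right, sLift_right]
  rw [if_neg this]
  split_ifs <;> simp [add_comm]

theorem cElt_lift (t : Zk k) (i : Fin 2) (v : kˣ) :
    cElt (zk t * sLift i) v = t * ![-1, 1] * ![v, v⁻¹] := by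
  have : cElt (zk t * sLift i) v = uu (zk t * sLift i) * ![-v, v⁻¹] := rfl
  rw [this, uu_lift, mul_assoc]
  congr 1
  funext j; fin_cases j <;> simp

theorem chiC_lift [Finite k] (χ : Zk k →* Cˣ) (t : Zk k) (i : Fin 2) :
    chiC χ (zk t * sLift i) = χ t * (χ ![-1, 1] : C) * ∑ᶠ v : kˣ, (χ ![v, v⁻¹] : C) := by
  unfold chiC
  rw [mul_finsum]
  refine finsum_congr fun v => ?_
  rw [cElt_lift]; simp

theorem chiPar_sum [Finite k] (χ : Zk k →* Cˣ) (p : ℤ) (t : Zk k) (i : Fin 2) :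
    ∑ᶠ v : kˣ, chiPar χ p (cElt (zk t * sLift i) v)
      = chiPar χ p t * (χ ![-1, 1] : C) * ∑ᶠ v : kˣ, (χ ![v, v⁻¹] : C) := by
  by_cases hp : p % 2 = 0
  · have := chiC_lift χ t i
    simpa [chiPar, hp, chiC] using this
  · simp only [chiPar, hp, if_false, cElt_lift]
    rw [mul_finsum]
    rw [← finsum_comp_equiv ((Equiv.neg kˣ).trans (Equiv.inv kˣ))]
    refine finsum_congr fun v => ?_
    rw [← Units.val_mul, ← Units.val_mul, ← map_mul, ← map_mul]
    congr 2
    funext j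
    fin_cases j <;> simp [arr_zero, arr_one, -mulAutArrow_apply_apply]

/-- The auxiliary representation. -/
def rep [Finite k] (χ : Zk k →* Cˣ) (J : Set (Fin 2)) (hq : (Nat.card k : C) = 0) :
    H C k →ₐ[C] Module.End C (ℤ → C) :=
  RingQuot.liftAlgHom C ⟨FreeAlgebra.lift C (opW χ J), by
    intro x y hxy
    induction hxy with
    | one =>
      simp only [FreeAlgebra.lift_ι_apply, map_one]
      refine LinearMap.ext fun f => funext fun p => ?_
      have h1 : (1 : W1 k) = zk 1 := by simp
      have : theta χ J p (1 : W1 k) = 1 := by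
        rw [h1, theta_zk]; simp [chiPar]
      simp [opW, this, mm]
    | braid v w h =>
      simp only [FreeAlgebra.lift_ι_apply, map_mul]
      refine LinearMap.ext fun f => funext fun p => ?_
      simp only [opW, Module.End.mul_apply, LinearMap.coe_mk, AddHom.coe_mk, theta_mul χ J p v w h,
        mm_mul, mul_assoc, sub_sub]
    | quad s h =>
      obtain ⟨t, i, rfl⟩ := h
      have := Fintype.ofFinite kˣ
      rw [hq, zero_smul, zero_add, finsum_eq_sum_of_fintype]
      simp only [FreeAlgebra.lift_ι_apply, map_mul, map_sum]
      refine LinearMap.ext fun f => funext fun p => ?_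
      have hm : mm (zk t * sLift i) = 0 := by
        have := lift_mem t i
        rw [Waff1, MonoidHom.mem_ker] at this
        unfold mm; rw [this]; rfl
      have hs := chiPar_sum χ p t i
      rw [finsum_eq_sum_of_fintype] at hs
      simp only [opW, Module.End.mul_apply, LinearMap.coe_mk, AddHom.coe_mk, LinearMap.sum_apply,
        Finset.sum_apply, hm, mm_zk, theta_zk, sub_zero]
      rw [← Finset.sum_mul, hs, theta_lift]
      have hal : alPar χ J (p + (if i = 1 then 1 else 0)) = 0 ∨
          alPar χ J (p + (if i = 1 then 1 else 0)) = ∑ᶠ v : kˣ, (χ ![v, v⁻¹] : C) := by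
        unfold alPar
        let := Classical.propDecidable
        exact ite_eq_or_eq _ _ _
      rcases hal with hal | hal <;> rw [hal] <;> ring⟩

theorem rep_T [Finite k] (χ : Zk k →* Cˣ) (J : Set (Fin 2)) (hq : (Nat.card k : C) = 0)
    (w : W1 k) : rep χ J hq (T C w) = opW χ J w := by
  have : rep χ J hq (T C w) = FreeAlgebra.lift C (opW χ J) (FreeAlgebra.ι C w) :=
    RingQuot.liftAlgHom_mkAlgHom_apply _ _ _ _
  rw [this, FreeAlgebra.lift_ι_apply]

theorem rep_diag [Finite k] (χ : Zk k →* Cˣ) (J : Set (Fin 2)) (hq : (Nat.card k : C) = 0)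
    {X : H C k} (hX : X ∈ Haff C k) (f : ℤ → C) :
    rep χ J hq X f 0 = rep χ J hq X 1 0 * f 0 := by
  induction hX using Algebra.adjoin_induction generalizing f with
  | mem x hx =>
    obtain ⟨w, hw, rfl⟩ := hx
    have hm : mm w = 0 := by
      have : deg w = 1 := hw
      unfold mm; rw [this]; rfl
    simp [rep_T, opW, hm]
  | algebraMap r => simp [Module.algebraMap_end_apply]
  | add x y _ _ hx hy => simp only [map_add, LinearMap.add_apply, Pi.add_apply, hx f, hy f]; ring
  | mul x y _ _ hx hy =>
    simp only [map_mul, Module.End.mul_apply]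
    rw [hx, hx (rep χ J hq y 1), hy f]; ring

theorem exists_xi [Finite k] (χ : Zk k →* Cˣ) (J : Set (Fin 2)) (hq : (Nat.card k : C) = 0) :
    ∃ Ξ : Haff C k →ₐ[C] C, IsXi χ J Ξ := by
  refine ⟨AlgHom.ofLinearMap
    { toFun := fun X => rep χ J hq X 1 0
      map_add' := fun X Y => by simp
      map_smul' := fun a X => by simp } (by simp) ?_, ?_, ?_⟩
  · intro X Y
    simp only [LinearMap.coe_mk, AddHom.coe_mk, MulMemClass.coe_mul, map_mul, Module.End.mul_apply]
    rw [rep_diag χ J hq X.2]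
  · intro t
    simp [rep_T, opW, theta_zk, chiPar]
  · intro t i
    simp only [AlgHom.ofLinearMap_apply, LinearMap.coe_mk, AddHom.coe_mk, rep_T, opW, theta_lift,
      chiC_lift]
    fin_cases i <;> simp [chiPar, alPar]

theorem T_mul {v w : W1 k} (h : len (v * w) = len v + len w) : T C v * T C w = T C (v * w) := by
  have := RingQuot.mkAlgHom_rel C (HRel.braid (C := C) v w h)
  rwa [map_mul] at this

theorem eq_zk {v : W1 k} (hv : v ∈ Waff1 k) (h : alc v = 0) : ∃ t : Zk k, v = zk t := by
  have hd : deg v = 1 := hv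
  have hm : mm v = 0 := by unfold mm; rw [hd]; rfl
  have hp := mm_parity v
  rcases alc_parity v with ⟨h1, h2⟩ | ⟨h1, h2⟩
  · refine ⟨uu v, ?_⟩
    have hm' : Multiplicative.toAdd (v.left 0).1 + Multiplicative.toAdd (v.left 1).1 = 0 := by
      simpa [mm, deg] using hm
    have h3 : dd v = 0 := by omega
    unfold dd at h3
    have e0 : (v.left 0).1 = 1 := by
      apply Multiplicative.toAdd.injective; rw [toAdd_one]; omega
    have e1 : (v.left 1).1 = 1 := by
      apply Multiplicative.toAdd.injective; rw [toAdd_one]; omega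
    refine SemidirectProduct.ext ?_ ?_
    · funext i
      fin_cases i
      · ext <;> simp [zk, uu, e0]
      · ext <;> simp [zk, uu, e1]
    · simp [h1, zk]
  · omega

theorem isXi_unique (χ : Zk k →* Cˣ) (J : Set (Fin 2)) (Ξ Ξ' : Haff C k →ₐ[C] C)
    (h : IsXi χ J Ξ) (h' : IsXi χ J Ξ') : Ξ = Ξ' := by
  have key : ∀ n : ℕ, ∀ w : W1 k, (alc w).natAbs = n → ∀ hw : w ∈ Waff1 k,
      Ξ ⟨T C w, T_mem_Haff hw⟩ = Ξ' ⟨T C w, T_mem_Haff hw⟩ := by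
    intro n
    induction n with
    | zero =>
      intro w hn hw
      obtain ⟨t, rfl⟩ := eq_zk hw (by omega)
      rw [h.1, h'.1]
    | succ n ih =>
      intro w hn hw
      obtain ⟨L, v, ⟨h1, h2, h3⟩, h4⟩ := exists_decomp _ w hn
      cases L with
      | nil => simp at h4
      | cons s L =>
        obtain ⟨t, i, rfl⟩ := h1 s (by simp)
        rw [List.prod_cons, mul_assoc] at h3
        obtain ⟨x, hx⟩ : ∃ x, x = L.prod * v := ⟨_, rfl⟩
        rw [← hx] at h3
        have hxle : (alc x).natAbs ≤ n := by
          rw [hx]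
          refine (alc_le L (fun s hs => h1 s (by simp [hs])) v h2).trans ?_
          simp at h4; omega
        have ha : alc w = (if i = 1 then -1 else 1) - alc x := by rw [h3]; exact alc_lift t i x
        have hxn : (alc x).natAbs = n := by
          split_ifs at ha <;> omega
        have hxm : x ∈ Waff1 k := by
          have : x = (zk t * sLift i)⁻¹ * w := by rw [h3, inv_mul_cancel_left]
          rw [this]
          exact mul_mem (inv_mem (lift_mem t i)) hw
        have hT : T C (zk t * sLift i) * T C x = T C w := by
          rw [h3]
          apply T_mul
          rw [len_eq, len_eq, len_eq, ← h3, hn, hxn, alc_lift']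
          split_ifs <;> simp [add_comm]
        have hT' : (⟨T C w, T_mem_Haff hw⟩ : Haff C k)
            = ⟨T C (zk t * sLift i), T_mem_Haff (lift_mem t i)⟩ * ⟨T C x, T_mem_Haff hxm⟩ :=
          Subtype.ext hT.symm
        rw [hT', map_mul, map_mul, ih x hxn hxm, h.2, h'.2]
  refine AlgHom.ext fun X => ?_
  obtain ⟨X, hX⟩ := X
  induction hX using Algebra.adjoin_induction with
  | mem x hx => obtain ⟨w, hw, rfl⟩ := hx; exact key _ w rfl hw
  | algebraMap r => exact (Ξ.commutes r).trans (Ξ'.commutes r).symm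
  | add x y hx hy h1 h2 =>
    have := congrArg₂ (· + ·) h1 h2
    simp only [← map_add] at this
    exact this
  | mul x y hx hy h1 h2 =>
    have := congrArg₂ (· * ·) h1 h2
    simp only [← map_mul] at this
    exact this

theorem existsUnique_xi [Finite k] (p : ℕ) [Fact p.Prime] [CharP k p] [CharP C p]
    (χ : Zk k →* Cˣ) (J : Set (Fin 2)) : ∃! Ξ : Haff C k →ₐ[C] C, IsXi χ J Ξ := by
  have hq : (Nat.card k : C) = 0 := by
    have := Fintype.ofFinite k
    obtain ⟨n, -, hn⟩ := FiniteField.card k p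
    rw [Nat.card_eq_fintype_card, hn]
    simp
  obtain ⟨Ξ, h⟩ := exists_xi χ J hq
  exact ⟨Ξ, h, fun Ξ' h' => isXi_unique χ J Ξ' Ξ h' h⟩

/-- The character `Ξ_{J,χ}` of `𝓗^aff`. -/
def Xi [Finite k] (p : ℕ) [Fact p.Prime] [CharP k p] [CharP C p]
    (χ : Zk k →* Cˣ) (J : Set (Fin 2)) : Haff C k →ₐ[C] C :=
  (existsUnique_xi p χ J).choose

theorem Waff1_conj {w : W1 k} (hw : w ∈ Waff1 k) (v : W1 k) : v * w * v⁻¹ ∈ Waff1 k :=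
  (inferInstance : (deg (k := k)).ker.Normal).conj_mem w hw v

/-- `Ω(1)_Ξ`, the stabilizer in `Ω(1)` of a character `Ξ` of `𝓗^aff`. -/
def Omega1Xi (Ξ : Haff C k →ₐ[C] C) : Subgroup (W1 k) where
  carrier := {v | v ∈ Omega1 k ∧ ∀ (w : W1 k) (hw : w ∈ Waff1 k),
    Ξ ⟨T C (v * w * v⁻¹), T_mem_Haff (Waff1_conj hw v)⟩ = Ξ ⟨T C w, T_mem_Haff hw⟩}
  mul_mem' {a b} ha hb := ⟨mul_mem ha.1 hb.1, fun w hw => by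
    rw [← hb.2 w hw, ← ha.2 _ (Waff1_conj hw b)]
    congr 3
    group⟩
  one_mem' := ⟨one_mem _, fun w hw => by simp⟩
  inv_mem' {a} ha := ⟨inv_mem ha.1, fun w hw => by
    rw [← ha.2 _ (Waff1_conj hw a⁻¹)]
    congr 3
    group⟩

variable {V : Type t} [AddCommGroup V] [Module C V]

/-- The relations defining `(Ξ ⊗ V) ⊗_{𝓗_Ξ} 𝓗` as a quotient of `V ⊗_C 𝓗` (written `𝓗 ⊗ V` here):
`X T_ω ∈ 𝓗_Ξ`, with `X ∈ 𝓗^aff` and `ω ∈ Ω(1)_Ξ`, acts on `Ξ ⊗ V = V` (on the right) by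
`y ↦ Ξ(X) • (y ω)`, and such elements span `𝓗_Ξ`. -/
def indRel (Ξ : Haff C k →ₐ[C] C) (ρ : Representation C (Omega1Xi Ξ)ᵐᵒᵖ V) :
    Submodule (H C k)ᵐᵒᵖ (H C k ⊗[C] V) :=
  Submodule.span (H C k)ᵐᵒᵖ {z | ∃ (X : Haff C k) (v : Omega1Xi Ξ) (h : H C k) (y : V),
    z = (((X : H C k) * T C (v : W1 k)) * h) ⊗ₜ[C] y - h ⊗ₜ[C] (Ξ X • ρ (op v) y)}

/-- The right `𝓗`-module `(Ξ ⊗ V) ⊗_{𝓗_Ξ} 𝓗`. Right modules are modules over the opposite ring,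
and a right `C[Ω(1)_Ξ]`-module is a representation of the opposite group. -/
abbrev Ind (Ξ : Haff C k →ₐ[C] C) (ρ : Representation C (Omega1Xi Ξ)ᵐᵒᵖ V) : Type (max u v t) :=
  (H C k ⊗[C] V) ⧸ indRel Ξ ρ

/-- The right `𝓗`-module `π_{χ,J,V} = (Ξ_{J,χ} ⊗ V) ⊗_{𝓗_Ξ} 𝓗`. -/
abbrev piMod [Finite k] (p : ℕ) [Fact p.Prime] [CharP k p] [CharP C p]
    (χ : Zk k →* Cˣ) (J : Set (Fin 2))
    (ρ : Representation C (Omega1Xi (Xi (C := C) p χ J))ᵐᵒᵖ V) : Type (max u v t) :=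
  Ind (Xi p χ J) ρ

/-- The restriction of the right `C[Ω(1)_Ξ]`-module `V` to `Z_κ ⊆ Ω(1)_Ξ` is a direct sum of copies
of `χ`. -/
def RestrictsTo (χ : Zk k →* Cˣ) {S : Subgroup (W1 k)} (ρ : Representation C Sᵐᵒᵖ V) : Prop :=
  ∀ (t : Zk k) (h : zk t ∈ S) (y : V), ρ (op ⟨zk t, h⟩) y = (χ t : C) • y

end Characters

section Supersingular

variable (C : Type v) {k : Type u} [Field C] [Field k]

/-- `T*_w = (T_{s₁} - c_{s₁}) ⋯ (T_{sₗ} - c_{sₗ}) T_u` for a reduced decomposition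
`w = s₁ ⋯ sₗ u` (the result does not depend on the decomposition). -/
def Tstar (w : W1 k) : H C k :=
  ((exists_reduced w).choose.1.map (fun s => T C s - cH C s)).prod
    * T C (exists_reduced w).choose.2

/-- The Bernstein element `E_o(λ)`, `λ ∈ Λ(1)`, for one of the two spherical orientations `o`
(the apartment modulo centre is a line, and a reduced gallery from the base alcove to its translate
by `λ` crosses all its walls in the same direction, so `E_o(λ)` is `T_λ` or `T*_λ` according to this
direction). -/
def Eo (w : W1 k) : H C k := if dd w ≤ 0 then T C w else Tstar C w

/-- `z_𝒪 = ∑_{μ ∈ 𝒪} E_o(μ)` where `𝒪` is the conjugacy class of `w` in `W(1)`. -/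
def zElt (w : W1 k) : H C k := ∑ᶠ μ ∈ conjugatesOf w, Eo C μ

variable (k) in
/-- A right `𝓗`-module is supersingular if some `z_𝒪 ^ n`, `n > 0`, kills it, uniformly for all
conjugacy classes `𝒪 ⊆ Λ(1)` of positive length. -/
def IsSupersingular (M : Type t) [AddCommGroup M] [Module (H C k)ᵐᵒᵖ M] : Prop :=
  ∃ n : ℕ, 0 < n ∧ ∀ w ∈ Lam1 k, 0 < len w → ∀ m : M, op (zElt C w ^ n) • m = 0

end Supersingular

/-- The dimension over `C` of `Ext¹` between two right `𝓗`-modules, computed in the category of all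
right `𝓗`-modules. -/
def dimExt1 (C : Type v) (k : Type u) [Field C] [Field k] (M N : Type (max u v t))
    [AddCommGroup M] [Module (H C k)ᵐᵒᵖ M] [AddCommGroup N] [Module (H C k)ᵐᵒᵖ N] : Cardinal :=
  Module.rank C (CategoryTheory.Abelian.Ext
    (ModuleCat.of (H C k)ᵐᵒᵖ M) (ModuleCat.of (H C k)ᵐᵒᵖ N) 1)

/-- The residue field `κ` of a nonarchimedean local field `F`. -/
abbrev ResField (F : Type u) [Field F] [ValuativeRel F] : Type u :=
  IsLocalRing.ResidueField (ValuativeRel.valuation F).integer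

end GL2Hecke

end

-- Since `q = 0` in `C`, the quadratic relation degenerates to `T_{s₁}² = c T_{s₁}`. The affine Weyl
-- group is infinite dihedral, without braid relation between `s₀` and `s₁ = ω⁻¹ s₀ ω`, so `𝓗` is
-- presented by `Z_κ`, `T_ω^{±1}` and `T_{s₁}` subject to the few relations of `Datum`; `Datum.lift`
-- is the universal property and `eq_top_of_mem` says that these elements generate.
--
-- The scalar `kap χ = χ(c_{s₁})` is nonzero exactly when `χ₁ = χ₂`. If `χ₁ = χ₂` and `Ξ` takes the
-- same value at `T_{s₀}` and `T_{s₁}`, then `V` itself becomes a quotient of the induced module on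
-- which some `z_𝒪` acts invertibly, which excludes supersingularity (`not_isSupersingular`). In all
-- other cases `ω` moves `Ξ`, the stabilizer is `⟨ω²⟩ Z_κ`, the simple module `V` is a line on which
-- `ω²` acts by a scalar `z`, and the induced module is the two-dimensional module `stdHom` on which
-- `T_t` acts as `diag(χ(t), χ(sw t))`, `T_ω` as `(0 1; z 0)` and `T_{s₁}` as `diag(kap χ, 0)`
-- (`exists_equiv_of_isSupersingular`).
--
-- For modules of row vectors, `Ext¹` is cocycles modulo coboundaries (`rank_ext_rowMod`). The order
-- of `Z_κ` is `(q - 1)² = 1` in `C`, so averaging makes a cocycle vanish on `Z_κ`; what is left is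
-- a first order deformation of the matrices of `T_ω` and `T_{s₁}`. For non-isomorphic modules the
-- centre separates the parameters and every cocycle is a coboundary (`exists_coboundary_of_ne`).
-- For self-extensions one counts parameters modulo conjugation. One parameter is always the
-- variation of `z`. If `χ₁ ≠ χ₂`, then `T_{s₁}` acts as `0` and deforms along any antidiagonal
-- matrix, which gives two more. If `χ₁ = χ₂`, then `T_{s₁}` is a nonzero multiple of an idempotent,
-- hence rigid up to conjugation, and the only other parameter is the variation of the trace of
-- `T_{s₁} T_ω`.

universe w a

noncomputable section

namespace GL2Hecke

/-! ### Presentation of the Hecke algebra by `Z_κ`, `T_ω` and `T_{s₁}` -/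

section Presentation

variable {C : Type v} {k : Type u} [Field C] [Field k]

/-- The swap of the two coordinates of `Z_κ`. -/
abbrev sw : Zk k ≃* Zk k := mulAutArrow (Equiv.swap 0 1 : Equiv.Perm (Fin 2))

theorem T_one : T C (1 : W1 k) = 1 := by
  have := RingQuot.mkAlgHom_rel C (HRel.one (C := C) (k := k))
  rwa [map_one] at this

theorem len_of_mem {v : W1 k} (hv : v ∈ Omega1 k) : len v = 0 := by
  rw [len_eq, alc_of_mem hv]; rfl

/-- Elements of `Ω(1)` preserve the base alcove, so they act on the line as the identity or as the
reflection in its midpoint, which sends the alcove with index `n` to the one with index `-n`. -/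
theorem alc_mul_natAbs {v : W1 k} (hv : v ∈ Omega1 k) (w : W1 k) :
    (alc (v * w)).natAbs = (alc w).natAbs := by
  have h0 := alc_of_mem hv
  rcases alc_parity v with ⟨h1, h2⟩ | ⟨h1, h2⟩
  · rw [alc_mul_one h1]; omega
  · rw [alc_mul_swap h1]; omega

theorem alc_mul_of_mem {v : W1 k} (hv : v ∈ Omega1 k) (w : W1 k) : alc (w * v) = alc w := by
  have h0 := alc_of_mem hv
  rcases alc_parity w with ⟨h1, h2⟩ | ⟨h1, h2⟩
  · rw [alc_mul_one h1]; omega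
  · rw [alc_mul_swap h1]; omega

theorem T_mul_left {v : W1 k} (hv : v ∈ Omega1 k) (w : W1 k) : T C v * T C w = T C (v * w) := by
  apply T_mul
  rw [len_of_mem hv, len_eq, len_eq, alc_mul_natAbs hv, zero_add]

theorem T_mul_right {v : W1 k} (hv : v ∈ Omega1 k) (w : W1 k) : T C w * T C v = T C (w * v) := by
  apply T_mul
  rw [len_of_mem hv, len_eq, len_eq, alc_mul_of_mem hv, add_zero]

theorem omg_mem : (omg : W1 k) ∈ Omega1 k :=
  Subgroup.mem_sup_left (Subgroup.mem_zpowers _)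

theorem zk_mem_Omega1 (x : Zk k) : zk x ∈ Omega1 k := Subgroup.mem_sup_right ⟨x, rfl⟩

theorem omg_right : (omg : W1 k).right = Equiv.swap 0 1 := by simp [omg]

theorem uu_omg : uu (omg : W1 k) = 1 := by
  funext j
  fin_cases j <;> simp [uu, omg, arr_zero, arr_one, -mulAutArrow_apply_apply]

theorem mm_omg : mm (omg : W1 k) = 1 := by
  simp [mm, deg, omg, arr_zero, arr_one, -mulAutArrow_apply_apply]

theorem mm_lift (x : Zk k) (i : Fin 2) : mm (zk x * sLift i) = 0 := by
  have := lift_mem x i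
  rw [Waff1, MonoidHom.mem_ker] at this
  unfold mm; rw [this]; rfl

theorem uu_zk (x : Zk k) : uu (zk x) = x := by funext i; simp [uu, zk]

theorem alc_omg_mul (w : W1 k) : alc (omg * w) = -alc w := by
  have h := alc_omg (k := k)
  rcases alc_parity (omg : W1 k) with ⟨h1, h2⟩ | ⟨h1, h2⟩
  · exact absurd (h1.symm.trans omg_right).symm swap_ne
  · rw [alc_mul_swap h1]; omega

theorem sLift_zero : (sLift 0 : W1 k) = omg * s1 * omg⁻¹ := by simp [sLift]

theorem sLift_one : (sLift 1 : W1 k) = s1 := by simp [sLift]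

theorem sLift_mul_zk (i : Fin 2) (x : Zk k) : sLift i * zk x = zk (sw x) * sLift i := by
  refine SemidirectProduct.ext ?_ ?_
  · have h : (sLift i : W1 k).left = fun j => ((sLift i : W1 k).left j) := rfl
    funext j
    fin_cases j <;>
      simp [sLift_right, zk, arr_zero, arr_one, -mulAutArrow_apply_apply, mul_comm]
  · simp [sLift_right, zk]

theorem omg_mul_zk (x : Zk k) : omg * zk x = zk (sw x) * omg := by
  refine SemidirectProduct.ext ?_ ?_
  · funext j
    fin_cases j <;>
      simp [omg_right, zk, arr_zero, arr_one, -mulAutArrow_apply_apply, mul_comm]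
  · simp [omg_right, zk]

theorem omg_sq_comm (w : W1 k) : omg * omg * w = w * (omg * omg) := by
  have h1 : ((omg : W1 k) * omg) = SemidirectProduct.inl (fun _ => (Multiplicative.ofAdd 1, 1)) := by
    ext i
    · fin_cases i <;> simp [omg, arr_zero, arr_one, -mulAutArrow_apply_apply]
    · fin_cases i <;> simp [omg, arr_zero, arr_one, -mulAutArrow_apply_apply]
    · simp [omg]
  rw [h1]
  refine SemidirectProduct.ext ?_ ?_
  · funext j
    rcases perm_cases w.right with h | h <;>
    fin_cases j <;>
      simp [h, arr_zero, arr_one, -mulAutArrow_apply_apply, mul_comm]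
  · simp

/-- A subalgebra containing the `T_t`, `T_{s₁}` and `T_{ω^{±1}}` is everything. -/
theorem eq_top_of_mem (A : Subalgebra C (H C k)) (hz : ∀ x : Zk k, T C (zk x) ∈ A)
    (hs : T C s1 ∈ A) (ho : T C omg ∈ A) (ho' : T C omg⁻¹ ∈ A) : A = ⊤ := by
  have hΩ : ∀ v ∈ Omega1 k, T C v ∈ A := by
    -- Both `T C v` and `T C v⁻¹` are recorded because a subalgebra need not be closed under
    -- inverses.
    let S : Subgroup (W1 k) :=
      { carrier := {v | v ∈ Omega1 k ∧ T C v ∈ A ∧ T C v⁻¹ ∈ A}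
        mul_mem' := fun {a b} ha hb => by
          refine ⟨mul_mem ha.1 hb.1, ?_, ?_⟩
          · rw [← T_mul_left ha.1]; exact mul_mem ha.2.1 hb.2.1
          · rw [mul_inv_rev, ← T_mul_left (inv_mem hb.1)]; exact mul_mem hb.2.2 ha.2.2
        one_mem' := ⟨one_mem _, by rw [T_one]; exact one_mem _,
          by rw [inv_one, T_one]; exact one_mem _⟩
        inv_mem' := fun {a} ha => ⟨inv_mem ha.1, ha.2.2, by rw [inv_inv]; exact ha.2.1⟩ }
    have : Omega1 k ≤ S := by
      refine sup_le ?_ ?_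
      · rw [Subgroup.zpowers_le]; exact ⟨omg_mem, ho, ho'⟩
      · rintro _ ⟨x, rfl⟩
        exact ⟨zk_mem_Omega1 x, hz x, by rw [← map_inv]; exact hz _⟩
    exact fun v hv => (this hv).2.1
  have hsi : ∀ i x, T C (zk x * sLift i) ∈ A := by
    intro i x
    rw [← T_mul_left (zk_mem_Omega1 x)]
    refine mul_mem (hz x) ?_
    fin_cases i
    · change T C (sLift 0) ∈ A
      rw [sLift_zero, ← T_mul_right (inv_mem omg_mem), ← T_mul_left omg_mem]
      exact mul_mem (mul_mem ho hs) ho'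
    · change T C (sLift 1) ∈ A
      rwa [sLift_one]
  -- Induction on the length, splitting off the first simple reflection of a reduced word.
  have hT : ∀ n : ℕ, ∀ w : W1 k, (alc w).natAbs = n → T C w ∈ A := by
    intro n
    induction n with
    | zero => exact fun w hw => hΩ w (mem_of_alc (by omega))
    | succ n ih =>
      intro w hn
      obtain ⟨L, v, ⟨h1, h2, h3⟩, h4⟩ := exists_decomp _ w hn
      cases L with
      | nil => simp at h4
      | cons s L =>
        obtain ⟨x, i, rfl⟩ := h1 s (by simp)
        rw [List.prod_cons, mul_assoc] at h3
        obtain ⟨y, hy⟩ : ∃ y, y = L.prod * v := ⟨_, rfl⟩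
        rw [← hy] at h3
        have hyle : (alc y).natAbs ≤ n := by
          rw [hy]
          refine (alc_le L (fun s hs => h1 s (by simp [hs])) v h2).trans ?_
          simp at h4; omega
        have ha : alc w = (if i = 1 then -1 else 1) - alc y := by rw [h3]; exact alc_lift x i y
        have hyn : (alc y).natAbs = n := by
          split_ifs at ha <;> omega
        rw [h3, ← T_mul]
        · exact mul_mem (hsi i x) (ih y hyn)
        · rw [len_eq, len_eq, len_eq, ← h3, hn, hyn, alc_lift']
          split_ifs <;> simp [add_comm]
  refine eq_top_iff.2 fun X _ => ?_
  obtain ⟨Y, rfl⟩ := RingQuot.mkAlgHom_surjective C (HRel C k) X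
  induction Y using FreeAlgebra.induction with
  | grade0 r => rw [AlgHom.commutes]; exact A.algebraMap_mem r
  | grade1 w => exact hT _ w rfl
  | mul a b ha hb => rw [map_mul]; exact mul_mem (ha trivial) (hb trivial)
  | add a b ha hb => rw [map_add]; exact add_mem (ha trivial) (hb trivial)

variable (C k) in
/-- Elements of an algebra `B` satisfying the relations between the `T_t`, `T_ω` and `T_{s₁}`. -/
structure Datum (B : Type*) [Ring B] [Algebra C B] where
  /-- the image of `T_t` -/
  t : Zk k →* B
  /-- the image of `T_ω` -/
  o : Bˣ
  /-- the image of `T_{s₁}` -/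
  S : B
  o_t : ∀ x, (o : B) * t x = t (sw x) * o
  S_t : ∀ x, S * t x = t (sw x) * S
  S_S : S * S = (∑ᶠ v : kˣ, t ![-v, v⁻¹]) * S
  -- With `T_{s₀}` defined as the conjugate of `T_{s₁}` by `T_ω`, centrality of `ω²` is what makes
  -- conjugation by `T_ω` also send `T_{s₀}` back to `T_{s₁}`.
  o_S : (o : B) * o * S = S * (o * o)

namespace Datum

variable {B : Type*} [Ring B] [Algebra C B] (D : Datum C k B)

/-- The image of `T_{sᵢ}`. -/
def Si (i : Fin 2) : B := if i = 1 then D.S else D.o * D.S * (↑D.o⁻¹ : B)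

/-- The alternating product of `n` factors starting with `Si i`. -/
def alt : ℕ → Fin 2 → B
  | 0, _ => 1
  | n + 1, i => D.Si i * alt n (1 - i)

/-- The image of `T_w`, where `w` is the word in the simple reflections with `alc w = n`. -/
def R (n : ℤ) : B := D.alt n.natAbs (if 0 < n then 0 else 1)

/-- The image of `T_w`. -/
def tau (w : W1 k) : B := D.t (uu w) * D.R (alc w) * ((D.o ^ mm w : Bˣ) : B)

theorem o_Si (i : Fin 2) : (D.o : B) * D.Si i = D.Si (1 - i) * D.o := by
  fin_cases i
  · simp [Si, ← mul_assoc, D.o_S]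
  · simp [Si]

theorem o_alt (n : ℕ) (i : Fin 2) : (D.o : B) * D.alt n i = D.alt n (1 - i) * D.o := by
  induction n generalizing i with
  | zero => simp [alt]
  | succ n ih => rw [alt, alt, ← mul_assoc, o_Si, mul_assoc, ih, mul_assoc]

theorem o_R (n : ℤ) : (D.o : B) * D.R n = D.R (-n) * D.o := by
  rw [R, R, o_alt, Int.natAbs_neg]
  rcases lt_trichotomy n 0 with h | h | h
  · rw [if_neg (by omega), if_pos (by omega)]; rfl
  · subst h; simp [alt]
  · rw [if_pos h, if_neg (by omega)]; rfl

theorem Si_t (i : Fin 2) (x : Zk k) : D.Si i * D.t x = D.t (sw x) * D.Si i := by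
  have ho : ∀ y, (↑D.o⁻¹ : B) * D.t (sw y) = D.t y * (↑D.o⁻¹ : B) := by
    intro y
    rw [Units.inv_mul_eq_iff_eq_mul, ← mul_assoc, D.o_t, mul_assoc, Units.mul_inv, mul_one]
  fin_cases i
  · simp only [Si]
    have h := ho (sw x)
    rw [swap_swap'] at h
    simp only [Fin.zero_eta, zero_ne_one, if_false]
    rw [mul_assoc, h, ← mul_assoc, mul_assoc (D.o : B), D.S_t, swap_swap', ← mul_assoc, D.o_t]
    simp only [mul_assoc]
  · simpa [Si] using D.S_t x

/-- The length condition means `n ≤ 0` for `i = 0` and `n ≥ 0` for `i = 1`: the word of `n` is empty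
or begins with the other reflection, so prepending `i` keeps it alternating. -/
theorem Si_R (i : Fin 2) (n : ℤ)
    (h : ((if i = 1 then -1 else 1) - n : ℤ).natAbs = n.natAbs + 1) :
    D.Si i * D.R n = D.R ((if i = 1 then -1 else 1) - n) := by
  fin_cases i
  · simp only [Fin.zero_eta, zero_ne_one, if_false] at h ⊢
    rw [R, R, h, if_neg (by omega), if_pos (by omega), alt]; rfl
  · simp only [Fin.mk_one, if_true] at h ⊢
    rw [R, R, h, if_neg (show ¬ (0 < -1 - n) by omega), alt]
    rcases eq_or_ne n 0 with rfl | h0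
    · simp [alt]
    · rw [if_pos (by omega)]; rfl

theorem tau_zk_mul (x : Zk k) (w : W1 k) : D.tau (zk x * w) = D.t x * D.tau w := by
  have h1 : alc (zk x * w) = alc w := by rw [alc_mul_one (zk_right x), dd_zk, zero_add]
  rw [tau, tau, uu_mul, uu_zk, zk_right, h1, mm_mul, mm_zk, zero_add]
  simp [mul_assoc]

theorem tau_omg_mul (w : W1 k) : D.tau (omg * w) = D.o * D.tau w := by
  rw [tau, tau, uu_mul, uu_omg, omg_right, alc_omg_mul, mm_mul, mm_omg, one_mul, ← mul_assoc,
    ← mul_assoc, D.o_t, mul_assoc (D.t _) (D.o : B), o_R, zpow_add, zpow_one]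
  simp [mul_assoc]

theorem tau_sLift_mul (i : Fin 2) (w : W1 k)
    (h : (alc (sLift i * w)).natAbs = (alc w).natAbs + 1) :
    D.tau (sLift i * w) = D.Si i * D.tau w := by
  have h0 := alc_lift 1 i w
  have hm := mm_lift (k := k) 1 i
  have hu := uu_lift (k := k) 1 i
  rw [map_one, one_mul] at h0 hm hu
  rw [h0] at h
  rw [tau, tau, uu_mul, hu, sLift_right, h0, mm_mul, hm, one_mul, zero_add, ← mul_assoc,
    ← mul_assoc, Si_t, mul_assoc (D.t _) (D.Si i), Si_R _ _ _ h]

theorem tau_one : D.tau 1 = 1 := by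
  have h1 : uu (1 : W1 k) = 1 := by funext i; simp [uu]
  have h2 : alc (1 : W1 k) = 0 := by simp [alc, dd]
  have h3 : mm (1 : W1 k) = 0 := by simp [mm]
  simp [tau, h1, h2, h3, R, alt]

theorem tau_zk (x : Zk k) : D.tau (zk x) = D.t x := by
  simpa [tau_one] using D.tau_zk_mul x 1

theorem tau_omg : D.tau omg = D.o := by
  simpa [tau_one] using D.tau_omg_mul 1

theorem tau_sLift (i : Fin 2) : D.tau (sLift i) = D.Si i := by
  have := D.tau_sLift_mul i 1 (by
    have := alc_lift' (k := k) 1 i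
    rw [map_one, one_mul] at this
    rw [mul_one, this]
    have : alc (1 : W1 k) = 0 := by simp [alc, dd]
    rw [this]
    split_ifs <;> rfl)
  simpa [tau_one] using this

theorem tau_mul_left {v : W1 k} (hv : v ∈ Omega1 k) (w : W1 k) :
    D.tau (v * w) = D.tau v * D.tau w := by
  -- Asking that `v` act by left multiplication by a unit makes the condition stable under inverses;
  -- the unit is then recovered by taking `w = 1`.
  let S : Subgroup (W1 k) :=
    { carrier := {v | ∃ b : Bˣ, ∀ w, D.tau (v * w) = b * D.tau w}
      mul_mem' := fun {a b} ha hb => by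
        obtain ⟨x, hx⟩ := ha
        obtain ⟨y, hy⟩ := hb
        exact ⟨x * y, fun w => by rw [mul_assoc, hx, hy]; simp [mul_assoc]⟩
      one_mem' := ⟨1, by simp⟩
      inv_mem' := fun {a} ha => by
        obtain ⟨x, hx⟩ := ha
        refine ⟨x⁻¹, fun w => ?_⟩
        rw [Units.eq_inv_mul_iff_mul_eq, ← hx, mul_inv_cancel_left] }
  have : Omega1 k ≤ S := by
    refine sup_le ?_ ?_
    · rw [Subgroup.zpowers_le]; exact ⟨D.o, D.tau_omg_mul⟩
    · rintro _ ⟨x, rfl⟩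
      exact ⟨D.t.toHomUnits x, fun w => by simpa using D.tau_zk_mul x w⟩
  obtain ⟨b, hb⟩ := this hv
  have h1 := hb 1
  rw [mul_one, tau_one, mul_one] at h1
  rw [hb, h1]

theorem tau_mul (v w : W1 k) (h : len (v * w) = len v + len w) :
    D.tau (v * w) = D.tau v * D.tau w := by
  rw [len_eq, len_eq, len_eq] at h
  obtain ⟨n, hn⟩ : ∃ n, (alc v).natAbs = n := ⟨_, rfl⟩
  induction n generalizing v with
  | zero => exact D.tau_mul_left (mem_of_alc (by omega)) w
  | succ n ih =>
    obtain ⟨i, hi⟩ : ∃ i : Fin 2, (alc ((sLift i)⁻¹ * v)).natAbs = n := by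
      have key : ∀ i, alc v = (if i = 1 then -1 else 1) - alc ((sLift i)⁻¹ * v) := by
        intro i
        have := alc_lift 1 i ((sLift i)⁻¹ * v)
        simpa using this
      by_cases h : 0 < alc v
      · refine ⟨0, ?_⟩
        have := key 0
        simp at this; omega
      · refine ⟨1, ?_⟩
        have := key 1
        simp at this; omega
    obtain ⟨y, rfl⟩ : ∃ y, v = sLift i * y := ⟨(sLift i)⁻¹ * v, by simp⟩
    rw [inv_mul_cancel_left] at hi
    have ha : ∀ z : W1 k, alc (sLift i * z) = (if i = 1 then -1 else 1) - alc z := by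
      intro z
      simpa using alc_lift 1 i z
    -- Length is subadditive and a simple reflection raises it by at most one, so additivity for the
    -- pair `(sLift i * y, w)` forces additivity for `(y, w)`.
    have hle : (alc (y * w)).natAbs ≤ (alc y).natAbs + (alc w).natAbs := by
      rcases alc_parity y with ⟨h1, h2⟩ | ⟨h1, h2⟩
      · rw [alc_mul_one h1]; omega
      · rw [alc_mul_swap h1]; omega
    have hge : (alc (sLift i * y * w)).natAbs ≤ (alc (y * w)).natAbs + 1 := by
      rw [mul_assoc, ha]; split_ifs <;> omega
    have hyw : (alc (y * w)).natAbs = (alc y).natAbs + (alc w).natAbs := by omega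
    rw [mul_assoc, D.tau_sLift_mul i (y * w) (by rw [← mul_assoc]; omega), ih y hyw hi,
      D.tau_sLift_mul i y (by omega), mul_assoc]

/-- The sum runs over a coset of the subgroup of the `(v, v⁻¹)`, and `x` differs from `sw x` by an
element of that subgroup. -/
theorem sum_t_mul [Finite k] (x : Zk k) :
    (∑ᶠ v : kˣ, D.t ![-v, v⁻¹]) * D.t x = (∑ᶠ v : kˣ, D.t ![-v, v⁻¹]) * D.t (sw x) := by
  have := Fintype.ofFinite kˣ
  rw [finsum_eq_sum_of_fintype, Finset.sum_mul, Finset.sum_mul]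
  refine Fintype.sum_equiv (Equiv.mulRight (x 0 * (x 1)⁻¹)) _ _ fun v => ?_
  rw [← map_mul, ← map_mul]
  congr 1
  funext j
  fin_cases j
  · simp [arr_zero, -mulAutArrow_apply_apply, mul_assoc]
  · simp [arr_one, -mulAutArrow_apply_apply, mul_assoc, mul_comm]
    rw [mul_left_comm, mul_inv_cancel_left]

/-- The swap permutes the summands through `v ↦ -v⁻¹`. -/
theorem o_sum_t [Finite k] :
    (D.o : B) * (∑ᶠ v : kˣ, D.t ![-v, v⁻¹]) = (∑ᶠ v : kˣ, D.t ![-v, v⁻¹]) * D.o := by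
  have := Fintype.ofFinite kˣ
  rw [finsum_eq_sum_of_fintype, Finset.sum_mul, Finset.mul_sum]
  refine Fintype.sum_equiv ((Equiv.neg kˣ).trans (Equiv.inv kˣ)) _ _ fun v => ?_
  rw [D.o_t]
  congr 2
  funext j
  fin_cases j <;> simp [arr_zero, arr_one, -mulAutArrow_apply_apply]

/-- The relation for `s₀` is the relation for `s₁` conjugated by `o`, which commutes with the sum.
-/
theorem Si_Si [Finite k] (i : Fin 2) :
    D.Si i * D.Si i = (∑ᶠ v : kˣ, D.t ![-v, v⁻¹]) * D.Si i := by
  have h1 : D.Si 1 * D.Si 1 = (∑ᶠ v : kˣ, D.t ![-v, v⁻¹]) * D.Si 1 := by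
    simpa [Si] using D.S_S
  fin_cases i
  · have h := congrArg (fun X => (D.o : B) * X) h1
    simp only [← mul_assoc, o_Si, o_sum_t] at h
    rw [mul_assoc, o_Si, mul_assoc _ (D.o : B), o_Si, ← mul_assoc, ← mul_assoc] at h
    exact D.o.isUnit.mul_left_injective h
  · exact h1

/-- The algebra homomorphism on the Hecke algebra defined by a datum, when `#κ = 0` in `C`. -/
def lift [Finite k] (hq : (Nat.card k : C) = 0) : H C k →ₐ[C] B :=
  RingQuot.liftAlgHom C ⟨FreeAlgebra.lift C D.tau, by
    intro x y hxy
    induction hxy with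
    | one => simp [tau_one]
    | braid v w h => simp [D.tau_mul v w h]
    | quad s h =>
      obtain ⟨x, i, rfl⟩ := h
      have := Fintype.ofFinite kˣ
      rw [hq, zero_smul, zero_add, finsum_eq_sum_of_fintype]
      simp only [map_mul, map_sum, FreeAlgebra.lift_ι_apply, cElt_lift, tau_zk_mul,
        tau_sLift]
      have hc : ∑ v : kˣ, D.tau (zk x * zk ![-1, 1] * zk ![v, v⁻¹])
          = D.t x * ∑ᶠ v : kˣ, D.t ![-v, v⁻¹] := by
        rw [finsum_eq_sum_of_fintype, Finset.mul_sum]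
        refine Finset.sum_congr rfl fun v _ => ?_
        rw [mul_assoc, ← map_mul, tau_zk_mul, tau_zk]
        congr 2
        funext j; fin_cases j <;> simp
      -- For the lift `x sᵢ`, moving `x` past `Si i` turns the left side into `t(x) t(sw x) c · Si
      -- i`, while the right side is `t(x) c t(x) · Si i`; the sum `c` does not distinguish `x` from
      -- `sw x`.
      rw [hc, mul_assoc, ← mul_assoc (D.Si i), D.Si_t, mul_assoc (D.t (sw x)), D.Si_Si,
        ← mul_assoc (D.t (sw x)), mul_assoc (D.t x), ← mul_assoc (finsum _), D.sum_t_mul]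
      congr 2
      rw [finsum_eq_sum_of_fintype, Finset.mul_sum, Finset.sum_mul]
      refine Finset.sum_congr rfl fun v _ => ?_
      rw [← map_mul, ← map_mul, mul_comm]⟩

variable [Finite k] (hq : (Nat.card k : C) = 0)

theorem lift_T (w : W1 k) : D.lift hq (T C w) = D.tau w := by
  have : D.lift hq (T C w) = FreeAlgebra.lift C D.tau (FreeAlgebra.ι C w) :=
    RingQuot.liftAlgHom_mkAlgHom_apply _ _ _ _
  rw [this, FreeAlgebra.lift_ι_apply]

theorem lift_zk (x : Zk k) : D.lift hq (T C (zk x)) = D.t x := by rw [lift_T, tau_zk]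

theorem lift_omg : D.lift hq (T C omg) = D.o := by rw [lift_T, tau_omg]

theorem lift_s1 : D.lift hq (T C s1) = D.S := by
  rw [lift_T, ← sLift_one, tau_sLift]; rfl

end Datum

end Presentation

/-! ### Modules of row vectors, cocycles and the free presentation -/

section RowModule

open CategoryTheory Abelian

variable {C : Type v} [Field C] {A : Type a} [Ring A] [Algebra C A]
  {n : Type} [Fintype n] [DecidableEq n]

/-- The right `A`-module of row vectors on which `A` acts through the matrices `φ a`. -/
def RowMod (_φ : A →ₐ[C] Matrix n n C) : Type (max v w) := ULift.{w} (n → C)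

namespace RowMod

variable (φ ψ : A →ₐ[C] Matrix n n C)

instance : AddCommGroup (RowMod.{v, w} φ) := inferInstanceAs (AddCommGroup (ULift.{w} (n → C)))

/-- The row vector with given entries. -/
def mk : (n → C) ≃+ RowMod.{v, w} φ := AddEquiv.ulift.symm

instance : Module Aᵐᵒᵖ (RowMod.{v, w} φ) where
  smul a x := mk.{v, w, a} φ (Matrix.vecMul ((mk.{v, w, a} φ).symm x) (φ a.unop))
  one_smul x := by
    change mk.{v, w, a} φ (Matrix.vecMul ((mk.{v, w, a} φ).symm x) (φ 1)) = x
    simp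
  mul_smul a b x := by
    change mk.{v, w, a} φ (Matrix.vecMul ((mk.{v, w, a} φ).symm x) (φ (b.unop * a.unop)))
      = mk.{v, w, a} φ (Matrix.vecMul
          ((mk.{v, w, a} φ).symm (mk φ (Matrix.vecMul ((mk.{v, w, a} φ).symm x) (φ b.unop))))
        (φ a.unop))
    simp
  smul_zero a := by
    change mk.{v, w, a} φ (Matrix.vecMul ((mk.{v, w, a} φ).symm 0) (φ a.unop)) = 0
    simp
  smul_add a x y := by
    change mk.{v, w, a} φ (Matrix.vecMul ((mk.{v, w, a} φ).symm (x + y)) (φ a.unop))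
      = mk.{v, w, a} φ (Matrix.vecMul ((mk.{v, w, a} φ).symm x) (φ a.unop))
        + mk.{v, w, a} φ (Matrix.vecMul ((mk.{v, w, a} φ).symm y) (φ a.unop))
    rw [map_add, Matrix.add_vecMul, map_add]
  add_smul a b x := by
    change mk.{v, w, a} φ (Matrix.vecMul ((mk.{v, w, a} φ).symm x) (φ (a.unop + b.unop)))
      = mk.{v, w, a} φ (Matrix.vecMul ((mk.{v, w, a} φ).symm x) (φ a.unop))
        + mk.{v, w, a} φ (Matrix.vecMul ((mk.{v, w, a} φ).symm x) (φ b.unop))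
    rw [map_add, Matrix.vecMul_add, map_add]
  zero_smul x := by
    change mk.{v, w, a} φ (Matrix.vecMul ((mk.{v, w, a} φ).symm x) (φ 0)) = 0
    simp

theorem op_smul (a : A) (x : n → C) :
    op a • mk.{v, w, a} φ x = mk.{v, w, a} φ (Matrix.vecMul x (φ a)) := rfl

theorem smul_mk (a : Aᵐᵒᵖ) (x : n → C) :
    a • mk.{v, w, a} φ x = mk.{v, w, a} φ (Matrix.vecMul x (φ a.unop)) := rfl

end RowMod

variable (φ ψ : A →ₐ[C] Matrix n n C)

/-- The cocycles of `A` with values in the `A`-bimodule `Hom(RowMod φ, RowMod ψ)`. -/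
def cocycles : Submodule C (A →ₗ[C] Matrix n n C) where
  carrier := {δ | ∀ a b, δ (a * b) = δ a * ψ b + φ a * δ b}
  add_mem' {δ ε} hδ hε a b := by
    simp only [LinearMap.add_apply, hδ a b, hε a b, add_mul, mul_add]; abel
  zero_mem' a b := by simp
  smul_mem' c δ hδ a b := by simp [hδ a b]

/-- The coboundary `a ↦ φ a * X - X * ψ a`. -/
def coboundary : Matrix n n C →ₗ[C] (A →ₗ[C] Matrix n n C) where
  toFun X :=
    { toFun := fun a => φ a * X - X * ψ a
      map_add' := fun a b => by simp only [map_add, add_mul, mul_add]; abel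
      map_smul' := fun c a => by simp [smul_sub] }
  map_add' X Y := by ext1 a; simp only [LinearMap.add_apply, LinearMap.coe_mk, AddHom.coe_mk, mul_add, add_mul]; abel
  map_smul' c X := by ext1 a; simp [smul_sub]

theorem coboundary_apply (X : Matrix n n C) (a : A) :
    coboundary φ ψ X a = φ a * X - X * ψ a := rfl

theorem coboundary_mem (X : Matrix n n C) : coboundary φ ψ X ∈ cocycles φ ψ := by
  intro a b
  simp only [coboundary_apply, map_mul, sub_mul, mul_sub, mul_assoc]; abel

/-- The free right module of rank `n`. -/
abbrev RowFree (A : Type a) [Ring A] (n : Type) : Type (max a w) := ULift.{w} n →₀ Aᵐᵒᵖ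

/-- The presentation of `RowMod φ` by the free module of rank `n`. -/
def rowPres : RowFree.{w, a} A n →ₗ[Aᵐᵒᵖ] RowMod.{v, w, a} φ :=
  Finsupp.linearCombination Aᵐᵒᵖ fun i => RowMod.mk.{v, w, a} φ (Pi.single i.down 1)

/-- The linear extension of a cocycle to the free module. -/
def cocycleExt (δ : A →ₗ[C] Matrix n n C) : RowFree.{w, a} A n →+ RowMod.{v, w, a} ψ :=
  Finsupp.liftAddHom fun i =>
    { toFun := fun a => RowMod.mk.{v, w, a} ψ (δ a.unop i.down)
      map_zero' := by simp; rfl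
      map_add' := fun a b => by rw [← map_add, MulOpposite.unop_add, map_add]; rfl }

theorem rowPres_single (i : ULift.{w} n) (a : Aᵐᵒᵖ) :
    rowPres.{v, w, a} φ (Finsupp.single i a) = RowMod.mk.{v, w, a} φ (φ a.unop i.down) := by
  rw [rowPres, Finsupp.linearCombination_single, RowMod.smul_mk, Matrix.single_one_vecMul]; rfl

theorem cocycleExt_single (δ : A →ₗ[C] Matrix n n C) (i : ULift.{w} n) (a : Aᵐᵒᵖ) :
    cocycleExt.{v, w, a} ψ δ (Finsupp.single i a) = RowMod.mk.{v, w, a} ψ (δ a.unop i.down) := by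
  exact Finsupp.liftAddHom_apply_single _ _ _

/-- The cocycle rule says that the defect of linearity of `cocycleExt` depends on `x` only through
its image in `RowMod φ`; on the kernel of the presentation the map is therefore linear. -/
theorem cocycleExt_smul {δ : A →ₗ[C] Matrix n n C} (hδ : δ ∈ cocycles φ ψ) (b : Aᵐᵒᵖ)
    (x : RowFree.{w, a} A n) :
    cocycleExt.{v, w, a} ψ δ (b • x) = b • cocycleExt.{v, w, a} ψ δ x
      + RowMod.mk.{v, w, a} ψ (Matrix.vecMul ((RowMod.mk.{v, w, a} φ).symm (rowPres.{v, w, a} φ x)) (δ b.unop)) := by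
  induction x using Finsupp.induction_linear with
  | zero => simp
  | add x y hx hy =>
    simp only [smul_add, map_add, hx, hy, Matrix.add_vecMul]; abel
  | single i c =>
    rw [Finsupp.smul_single, cocycleExt_single, cocycleExt_single, rowPres_single, RowMod.smul_mk,
      AddEquiv.symm_apply_apply, ← map_add, smul_eq_mul, MulOpposite.unop_mul, hδ]
    rfl

/-- The kernel of the presentation of `RowMod φ`. -/
abbrev rowKer : Submodule Aᵐᵒᵖ (RowFree.{w, a} A n) := LinearMap.ker (rowPres.{v, w, a} φ)

/-- The linear map on the kernel of the presentation defined by a cocycle. -/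
def cocycleHom (δ : cocycles φ ψ) : rowKer.{v, w, a} φ →ₗ[Aᵐᵒᵖ] RowMod.{v, w, a} ψ where
  toFun x := cocycleExt.{v, w, a} ψ δ.1 x
  map_add' x y := by simp
  map_smul' b x := by
    have : rowPres.{v, w, a} φ (x : RowFree.{w, a} A n) = 0 := x.2
    rw [Submodule.coe_smul, cocycleExt_smul φ ψ δ.2, this]
    simp

theorem rowPres_surjective : Function.Surjective (rowPres.{v, w, a} φ) := by
  intro x
  obtain ⟨x, rfl⟩ := (RowMod.mk.{v, w, a} φ).surjective x
  refine ⟨∑ i, Finsupp.single ⟨i⟩ (op (algebraMap C A (x i))), ?_⟩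
  rw [map_sum]
  simp only [rowPres_single, ← map_sum]
  congr 1
  funext j
  simp [Matrix.algebraMap_matrix_apply]

/-- The element of the kernel of the presentation expressing the action of `a` on `eᵢ`. -/
def relElt (a : A) (i : n) : rowKer.{v, w, a} φ :=
  ⟨Finsupp.single ⟨i⟩ (op a) - ∑ j, Finsupp.single ⟨j⟩ (op (algebraMap C A (φ a i j))), by
    rw [LinearMap.mem_ker, map_sub, map_sum]
    simp only [rowPres_single, ← map_sum, ← map_sub]
    rw [EmbeddingLike.map_eq_zero_iff]
    funext j
    simp [Matrix.algebraMap_matrix_apply]⟩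

theorem algebraMap_smul_mk (c : C) (x : n → C) :
    op (algebraMap C A c) • RowMod.mk.{v, w, a} φ x = RowMod.mk.{v, w, a} φ (c • x) := by
  rw [RowMod.op_smul, AlgHom.commutes]
  congr 1
  funext j
  simp [Matrix.vecMul, dotProduct, Matrix.algebraMap_matrix_apply, mul_comm]

theorem relElt_add (x y : A) (i : n) :
    relElt.{v, w, a} φ (x + y) i = relElt φ x i + relElt φ y i := by
  apply Subtype.ext
  simp only [relElt, map_add, Matrix.add_apply, MulOpposite.op_add, Finsupp.single_add,
    Finset.sum_add_distrib, Submodule.coe_add]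
  abel

theorem relElt_smul (c : C) (x : A) (i : n) :
    relElt.{v, w, a} φ (c • x) i = op (algebraMap C A c) • relElt φ x i := by
  apply Subtype.ext
  simp only [relElt, map_smul, Matrix.smul_apply, Submodule.coe_smul, smul_sub,
    Finset.smul_sum, Finsupp.smul_single, smul_eq_mul, ← MulOpposite.op_mul, ← map_mul,
    mul_comm c]
  rw [Algebra.smul_def, Algebra.commutes]

/-- This is the cocycle rule in universal form: applying a linear map to it shows that the matrices
of values on the `relElt` form a cocycle. -/
theorem relElt_mul (x y : A) (i : n) :
    relElt.{v, w, a} φ (x * y) i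
      = op y • relElt φ x i + ∑ j, op (algebraMap C A (φ x i j)) • relElt φ y j := by
  apply Subtype.ext
  have h0 : ∀ j, φ (x * y) i j = ∑ l, φ x i l * φ y l j := fun j => by
    rw [map_mul, Matrix.mul_apply]
  simp only [relElt, h0, Submodule.coe_smul, smul_sub, Submodule.coe_add,
    AddSubmonoidClass.coe_finsetSum, Finset.smul_sum, Finsupp.smul_single, smul_eq_mul,
    ← MulOpposite.op_mul, ← map_mul, Finset.sum_sub_distrib]
  have h1 : ∑ j, Finsupp.single (ULift.up.{w} j) (op (algebraMap C A (φ x i j) * y))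
      = ∑ j, Finsupp.single (ULift.up.{w} j) (op (y * algebraMap C A (φ x i j))) :=
    Finset.sum_congr rfl fun j _ => by rw [Algebra.commutes]
  have h2 : ∑ j, Finsupp.single (ULift.up.{w} j) (op (algebraMap C A (∑ l, φ x i l * φ y l j)))
      = ∑ l, ∑ j, Finsupp.single (ULift.up.{w} j) (op (algebraMap C A (φ y l j * φ x i l))) := by
    rw [Finset.sum_comm]
    refine Finset.sum_congr rfl fun j _ => ?_
    simp only [map_sum, Finset.op_sum, Finsupp.single_finsetSum]
    exact Finset.sum_congr rfl fun l _ => by rw [mul_comm]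
  rw [h1, h2]
  abel

/-- The scalar corrections in the `relElt` add up to the coordinates of the image of `x` in `RowMod
φ`, which is zero. Hence the `relElt` generate the kernel, already additively. -/
theorem sum_relElt (x : rowKer.{v, w, a} φ) :
    ∑ i, relElt.{v, w, a} φ ((x : RowFree.{w, a} A n) ⟨i⟩).unop i = x := by
  have hx : rowPres.{v, w, a} φ (x : RowFree.{w, a} A n) = 0 := x.2
  have hs : (x : RowFree.{w, a} A n)
      = ∑ i : n, Finsupp.single ⟨i⟩ ((x : RowFree.{w, a} A n) ⟨i⟩) := by
    rw [← Equiv.sum_comp (Equiv.ulift.{w} (α := n)), ← Finsupp.univ_sum_single (x : RowFree.{w, a} A n)]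
    simp
  apply Subtype.ext
  simp only [relElt, AddSubmonoidClass.coe_finsetSum, Finset.sum_sub_distrib, MulOpposite.op_unop]
  rw [← hs, Finset.sum_comm, sub_eq_self]
  refine Finset.sum_eq_zero fun j _ => ?_
  rw [← Finsupp.single_finsetSum, ← Finset.op_sum, ← map_sum]
  rw [hs, map_sum] at hx
  simp only [rowPres_single, ← map_sum] at hx
  rw [EmbeddingLike.map_eq_zero_iff] at hx
  have := congrFun hx j
  rw [Finset.sum_apply] at this
  rw [this]
  simp

/-- A cocycle vanishes on scalars, so the correction terms contribute nothing. -/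
theorem cocycleHom_relElt (δ : cocycles φ ψ) (x : A) (i : n) :
    cocycleHom.{v, w, a} φ ψ δ (relElt φ x i) = RowMod.mk.{v, w, a} ψ (δ.1 x i) := by
  have h1 : δ.1 1 = 0 := by
    have := δ.2 1 1
    simpa using this
  have hc : ∀ c, δ.1 (algebraMap C A c) = 0 := by
    intro c
    rw [Algebra.algebraMap_eq_smul_one, map_smul, h1, smul_zero]
  change cocycleExt.{v, w, a} ψ δ.1 _ = _
  rw [relElt]
  simp only [map_sub, map_sum, cocycleExt_single, MulOpposite.unop_op, hc]
  simp
  exact Finset.sum_eq_zero fun _ _ => map_zero _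

theorem cocycleHom_ext (f g : rowKer.{v, w, a} φ →ₗ[Aᵐᵒᵖ] RowMod.{v, w, a} ψ)
    (h : ∀ x i, f (relElt φ x i) = g (relElt φ x i)) : f = g := by
  ext1 x
  rw [← sum_relElt φ x, map_sum, map_sum]
  exact Finset.sum_congr rfl fun i _ => h _ _

theorem exists_cocycle (f : rowKer.{v, w, a} φ →ₗ[Aᵐᵒᵖ] RowMod.{v, w, a} ψ) :
    ∃ δ, cocycleHom.{v, w, a} φ ψ δ = f := by
  let δ : A →ₗ[C] Matrix n n C :=
    { toFun := fun x => Matrix.of fun i => (RowMod.mk.{v, w, a} ψ).symm (f (relElt φ x i))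
      map_add' := fun x y => by
        funext i
        simp only [relElt_add, map_add]; rfl
      map_smul' := fun c x => by
        funext i
        obtain ⟨r, hr⟩ := (RowMod.mk.{v, w, a} ψ).surjective (f (relElt φ x i))
        change (RowMod.mk.{v, w, a} ψ).symm (f (relElt φ (c • x) i))
          = c • (RowMod.mk.{v, w, a} ψ).symm (f (relElt φ x i))
        rw [relElt_smul, map_smul, ← hr, algebraMap_smul_mk]
        simp }
  have hδ : ∀ x i, RowMod.mk.{v, w, a} ψ (δ x i) = f (relElt φ x i) := fun x i =>
    (RowMod.mk.{v, w, a} ψ).apply_symm_apply _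
  have hmem : δ ∈ cocycles φ ψ := by
    intro x y
    funext i
    apply (RowMod.mk.{v, w, a} ψ).injective
    have h1 : (δ x * ψ y + φ x * δ y) i
        = Matrix.vecMul (δ x i) (ψ y) + ∑ j, φ x i j • δ y j := by
      funext l
      simp [Matrix.mul_apply, Matrix.vecMul, dotProduct]
    rw [h1, map_add, map_sum, ← RowMod.op_smul]
    simp only [← algebraMap_smul_mk, hδ]
    rw [relElt_mul, map_add, map_sum, map_smul]
    simp only [map_smul]
  refine ⟨⟨δ, hmem⟩, cocycleHom_ext φ ψ _ _ fun x i => ?_⟩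
  rw [cocycleHom_relElt, hδ]

/-- A linear map on the free module is given by the images of the basis vectors, that is, by the
rows of a matrix `X`; on `relElt φ x i` it takes the value of row `i` of `X * ψ x - φ x * X`, which
is the coboundary of `-X`. -/
theorem cocycleHom_extends_iff (δ : cocycles φ ψ) :
    (∃ g : RowFree.{w, a} A n →ₗ[Aᵐᵒᵖ] RowMod.{v, w, a} ψ,
      g.comp (rowKer.{v, w, a} φ).subtype = cocycleHom.{v, w, a} φ ψ δ)
      ↔ ∃ X, δ.1 = coboundary φ ψ X := by
  have key : ∀ (X : Matrix n n C) x i, Finsupp.linearCombination Aᵐᵒᵖ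
      (fun j : ULift.{w} n => RowMod.mk.{v, w, a} ψ (X j.down))
        (relElt.{v, w, a} φ x i : RowFree.{w, a} A n)
      = RowMod.mk.{v, w, a} ψ (coboundary φ ψ (-X) x i) := by
    intro X x i
    simp only [relElt, map_sub, map_sum, Finsupp.linearCombination_single, algebraMap_smul_mk]
    rw [RowMod.op_smul]
    rw [← map_sum, ← map_sub]
    congr 1
    funext j
    simp [coboundary_apply, Matrix.mul_apply, Matrix.vecMul, dotProduct, sub_eq_neg_add]
  constructor
  · rintro ⟨g, hg⟩
    refine ⟨-Matrix.of fun i => (RowMod.mk.{v, w, a} ψ).symm (g (Finsupp.single ⟨i⟩ 1)), ?_⟩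
    ext1 x
    funext i
    apply (RowMod.mk.{v, w, a} ψ).injective
    rw [← key, ← cocycleHom_relElt, ← hg]
    change g _ = _
    congr 1
    refine Finsupp.lhom_ext' fun j => LinearMap.ext_ring ?_
    simp only [LinearMap.comp_apply, Finsupp.lsingle_apply, Finsupp.linearCombination_single,
      one_smul]
    exact (AddEquiv.apply_symm_apply _ _).symm
  · rintro ⟨X, hX⟩
    refine ⟨Finsupp.linearCombination Aᵐᵒᵖ
      (fun j : ULift.{w} n => RowMod.mk.{v, w, a} ψ ((-X) j.down)), ?_⟩
    refine cocycleHom_ext φ ψ _ _ fun x i => ?_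
    rw [cocycleHom_relElt, hX]
    exact (key (-X) x i).trans (by rw [neg_neg])

end RowModule

/-! ### `Ext¹` as cocycles modulo coboundaries -/

section Ext

open CategoryTheory Abelian

section Abelian

variable {R : Type*} [CommRing R] {D : Type*} [Category* D] [Abelian D] [HasExt.{w} D]
  [Linear R D] {S : ShortComplex D} (hS : S.ShortExact) (Y : D)

variable (R) in
/-- The connecting homomorphism `Hom(S.X₁, Y) → Ext¹(S.X₃, Y)`. -/
def connecting : (S.X₁ ⟶ Y) →ₗ[R] Ext.{w} S.X₃ Y 1 :=
  (Ext.precompOfLinear hS.extClass R Y (add_zero 1)).comp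
    (Ext.linearEquiv₀ (R := R)).symm.toLinearMap

theorem connecting_apply (f : S.X₁ ⟶ Y) :
    connecting R hS Y f = hS.extClass.comp (Ext.mk₀ f) (add_zero 1) := rfl

theorem connecting_surjective [Projective S.X₂] : Function.Surjective (connecting R hS Y) := by
  intro x
  obtain ⟨y, hy⟩ := Ext.contravariant_sequence_exact₃ hS Y x
    (Ext.eq_zero_of_projective (n := 0) _) (add_zero 1)
  obtain ⟨f, rfl⟩ := Ext.mk₀_bijective _ _ |>.surjective y
  exact ⟨f, hy⟩

/-- Exactness of the long exact sequence at `Hom(S.X₁, Y)`. Together with surjectivity, which comes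
from `Ext¹(S.X₂, Y) = 0`, it presents `Ext¹` as the cokernel of restriction along `S.f`. -/
theorem connecting_eq_zero_iff (f : S.X₁ ⟶ Y) :
    connecting R hS Y f = 0 ↔ ∃ g : S.X₂ ⟶ Y, S.f ≫ g = f := by
  rw [connecting_apply]
  constructor
  · intro h
    obtain ⟨y, hy⟩ := Ext.contravariant_sequence_exact₁ hS Y _ (add_zero 1) h
    obtain ⟨g, rfl⟩ := Ext.mk₀_bijective _ _ |>.surjective y
    rw [Ext.mk₀_comp_mk₀] at hy
    exact ⟨g, (Ext.mk₀_bijective _ _).injective hy⟩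
  · rintro ⟨g, rfl⟩
    rw [← Ext.mk₀_comp_mk₀, ← Ext.comp_assoc (a₁₂ := 1) (a₂₃ := 0) (h := by rfl)]
    · rw [hS.extClass_comp]; simp
    all_goals rfl

variable (R) in
/-- `Ext` is invariant under isomorphisms of both arguments. -/
def extCongr {X X' Y Y' : D} (e : X ≅ X') (f : Y ≅ Y') (m : ℕ) :
    Ext.{w} X Y m ≃ₗ[R] Ext.{w} X' Y' m :=
  LinearEquiv.ofLinearMap
    ((Ext.precompOfLinear (Ext.mk₀ e.inv) R Y' (zero_add m)).comp
      (Ext.postcompOfLinear (Ext.mk₀ f.hom) R X (add_zero m)))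
    ((Ext.precompOfLinear (Ext.mk₀ e.hom) R Y (zero_add m)).comp
      (Ext.postcompOfLinear (Ext.mk₀ f.inv) R X' (add_zero m)))
    (by ext x; simp [Ext.bilinearCompOfLinear])
    (by ext x; simp [Ext.bilinearCompOfLinear])

end Abelian

variable {C : Type v} [Field C] {A : Type a} [Ring A] [Algebra C A]
  {n : Type} [Fintype n] [DecidableEq n] (φ ψ : A →ₐ[C] Matrix n n C)

/-- The presentation of `RowMod φ` as a short exact sequence. -/
abbrev rowShort : ShortComplex (ModuleCat.{max v w a} Aᵐᵒᵖ) :=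
  (rowPres.{v, max v w a, a} φ).shortComplexKer

theorem rowShort_exact : (rowShort.{v, w, a} φ).ShortExact :=
  LinearMap.shortExact_shortComplexKer (rowPres_surjective φ)

instance : Projective (rowShort.{v, w, a} φ).X₂ :=
  ModuleCat.projective_of_free (M := ModuleCat.of Aᵐᵒᵖ (RowFree.{max v w a, a} A n)) Finsupp.basisSingleOne

/-- The morphism on the kernel of the presentation defined by a cocycle. -/
def cocycleMor : cocycles φ ψ →ₗ[C]
    ((rowShort.{v, w, a} φ).X₁ ⟶ ModuleCat.of Aᵐᵒᵖ (RowMod.{v, max v w a, a} ψ)) where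
  toFun δ := ModuleCat.ofHom (cocycleHom.{v, max v w a, a} φ ψ δ)
  map_add' δ ε := by
    refine ModuleCat.hom_ext (cocycleHom_ext φ ψ _ _ fun x i => ?_)
    change cocycleHom φ ψ (δ + ε) _ = cocycleHom φ ψ δ _ + cocycleHom φ ψ ε _
    simp only [cocycleHom_relElt, ← map_add]
    rfl
  map_smul' c δ := by
    refine ModuleCat.hom_ext (cocycleHom_ext φ ψ _ _ fun x i => ?_)
    change cocycleHom φ ψ (c • δ) _ = algebraMap C Aᵐᵒᵖ c • cocycleHom φ ψ δ _
    simp only [cocycleHom_relElt]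
    exact (algebraMap_smul_mk ψ c _).symm

/-- Cocycles map onto the homomorphisms from the kernel of the presentation, hence onto `Ext¹`, and
those that die are the coboundaries. A surjective system of `m` linear invariants with the
coboundaries as kernel thus computes the dimension. -/
theorem rank_ext_rowMod {m : ℕ} (L : cocycles φ ψ →ₗ[C] (Fin m → C))
    (hL : Function.Surjective L)
    (hker : ∀ δ, L δ = 0 ↔ ∃ X, δ.1 = coboundary φ ψ X) :
    Module.rank C (Ext (ModuleCat.of Aᵐᵒᵖ (RowMod.{v, max v w a, a} φ))
      (ModuleCat.of Aᵐᵒᵖ (RowMod.{v, max v w a, a} ψ)) 1) = m := by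
  let Θ := (connecting C (rowShort_exact.{v, w, a} φ)
    (ModuleCat.of Aᵐᵒᵖ (RowMod.{v, max v w a, a} ψ))).comp (cocycleMor.{v, w, a} φ ψ)
  have hΘ : Function.Surjective Θ := by
    refine (connecting_surjective _ _).comp fun f => ?_
    obtain ⟨δ, hδ⟩ := exists_cocycle.{v, max v w a, a} φ ψ f.hom
    exact ⟨δ, ModuleCat.hom_ext hδ⟩
  have hk : LinearMap.ker Θ = LinearMap.ker L := by
    ext δ
    rw [LinearMap.mem_ker, LinearMap.mem_ker, hker, ← cocycleHom_extends_iff.{v, max v w a, a}]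
    refine (connecting_eq_zero_iff _ _ _).trans ⟨?_, ?_⟩
    · rintro ⟨g, hg⟩
      exact ⟨g.hom, congrArg ModuleCat.Hom.hom hg⟩
    · rintro ⟨g, hg⟩
      exact ⟨ModuleCat.ofHom g, ModuleCat.hom_ext hg⟩
  have e' := LinearMap.quotKerEquivOfSurjective (M := cocycles φ ψ) (M₂ := Fin m → C) L hL
  have e := ((Θ.quotKerEquivOfSurjective hΘ).symm.trans (Submodule.quotEquivOfEq _ _ hk)).trans
    e'
  have := e.lift_rank_eq
  rw [rank_fin_fun] at this
  simpa using this

end Ext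

/-! ### Central elements, averaging over `Z_κ`, and first order deformations -/

section Cocycles

open CategoryTheory Abelian
open scoped DualNumber

variable {C : Type v} {k : Type u} [Field C] [Field k]

theorem cocycle_one {A : Type a} [Ring A] [Algebra C A] {n : Type} [Fintype n] [DecidableEq n]
    {φ ψ : A →ₐ[C] Matrix n n C} {δ : A →ₗ[C] Matrix n n C} (hδ : δ ∈ cocycles φ ψ) :
    δ 1 = 0 := by
  have := hδ 1 1
  simpa using this

/-- If a central element acts by distinct scalars, then all cocycles are coboundaries. -/
theorem exists_coboundary_of_central {A : Type a} [Ring A] [Algebra C A] {n : Type} [Fintype n]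
    [DecidableEq n] (φ ψ : A →ₐ[C] Matrix n n C) (c : A) (hc : ∀ x, c * x = x * c) (r s : C)
    (hr : φ c = r • 1) (hs : ψ c = s • 1) (hrs : r ≠ s) (δ : A →ₗ[C] Matrix n n C)
    (hδ : δ ∈ cocycles φ ψ) : ∃ X, δ = coboundary φ ψ X := by
  -- Expanding `δ (c * x) = δ (x * c)` gives `(r - s) • δ x = φ x * δ c - δ c * ψ x`.
  refine ⟨(r - s)⁻¹ • δ c, LinearMap.ext fun x => ?_⟩
  have h1 := hδ c x
  have h2 := hδ x c
  rw [hc, h2, hr, hs] at h1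
  simp only [smul_mul_assoc, mul_smul_comm, one_mul, mul_one] at h1
  rw [coboundary_apply, mul_smul_comm, smul_mul_assoc, ← smul_sub,
    eq_inv_smul_iff₀ (sub_ne_zero.2 hrs), sub_smul, sub_eq_sub_iff_add_eq_add]
  rw [add_comm (φ x * δ c), h1]; abel

theorem T_omg_inv_mul : T C (omg : W1 k) * T C omg⁻¹ = 1 := by
  rw [T_mul_left omg_mem, mul_inv_cancel, T_one]

theorem T_inv_omg_mul : T C (omg⁻¹ : W1 k) * T C omg = 1 := by
  rw [T_mul_right omg_mem, inv_mul_cancel, T_one]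

theorem T_omg_zk (x : Zk k) : T C omg * T C (zk x) = T C (zk (sw x)) * T C omg := by
  rw [T_mul_left omg_mem, T_mul_left (zk_mem_Omega1 _), omg_mul_zk]

theorem T_s1_zk (x : Zk k) : T C s1 * T C (zk x) = T C (zk (sw x)) * T C s1 := by
  rw [T_mul_right (zk_mem_Omega1 _), T_mul_left (zk_mem_Omega1 _), ← sLift_one, sLift_mul_zk]

theorem T_zk_mul (x y : Zk k) : T C (zk x) * T C (zk y) = T C (zk (x * y)) := by
  rw [T_mul_left (zk_mem_Omega1 _), map_mul]

theorem T_zk_comm (x y : Zk k) : T C (zk x) * T C (zk y) = T C (zk y) * T C (zk x) := by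
  rw [T_zk_mul, T_zk_mul, mul_comm]

theorem T_omg_sq_s1 : T C (omg : W1 k) * T C omg * T C s1 = T C s1 * (T C omg * T C omg) := by
  rw [T_mul_left omg_mem, T_mul_left (mul_mem omg_mem omg_mem),
    T_mul_right (mul_mem omg_mem omg_mem), omg_sq_comm]

theorem T_s1_s1 [Finite k] (hq : (Nat.card k : C) = 0) :
    T C (s1 : W1 k) * T C s1 = (∑ᶠ v : kˣ, T C (zk ![-v, v⁻¹])) * T C s1 := by
  have := Fintype.ofFinite kˣ
  have h := RingQuot.mkAlgHom_rel C (HRel.quad (C := C) (s1 : W1 k) ⟨1, 1, by simp [sLift_one]⟩)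
  rw [map_mul, map_add, map_smul, hq, zero_smul, zero_add, map_mul,
    finsum_eq_sum_of_fintype, map_sum] at h
  rw [finsum_eq_sum_of_fintype]
  refine h.trans ?_
  congr 1
  refine Finset.sum_congr rfl fun v _ => ?_
  have hv : cElt s1 v = ![-v, v⁻¹] := by
    funext i
    simp [cElt, s1]
  rw [hv]; rfl

/-- An element commuting with the generators is central. -/
theorem commute_of_generators (c : H C k) (hz : ∀ x : Zk k, c * T C (zk x) = T C (zk x) * c)
    (hs : c * T C s1 = T C s1 * c) (ho : c * T C omg = T C omg * c) (x : H C k) :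
    c * x = x * c := by
  have h : Subalgebra.centralizer C {c} = ⊤ := by
    refine eq_top_of_mem _ ?_ ?_ ?_ ?_ <;> simp only [Subalgebra.mem_centralizer_iff,
      Set.mem_singleton_iff, forall_eq]
    · exact hz
    · exact hs
    · exact ho
    · calc c * T C omg⁻¹ = T C omg⁻¹ * (T C omg * c) * T C omg⁻¹ := by
            rw [← mul_assoc, T_inv_omg_mul, one_mul]
        _ = T C omg⁻¹ * c := by
            rw [← ho, mul_assoc, mul_assoc, T_omg_inv_mul, mul_one]
  have hx : x ∈ Subalgebra.centralizer C {c} := h ▸ Algebra.mem_top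
  rw [Subalgebra.mem_centralizer_iff] at hx
  exact hx c rfl

theorem omg_sq_central (x : H C k) : T C omg * T C omg * x = x * (T C omg * T C omg) := by
  refine commute_of_generators _ (fun x => ?_) T_omg_sq_s1 ?_ x
  · rw [mul_assoc, T_omg_zk, ← mul_assoc, T_omg_zk, swap_swap', mul_assoc]
  · rw [mul_assoc]

/-- Both `T_ω` and `T_{s₁}` carry `T_x` to `T_{sw x}`, so the symmetric functions of the two are
central. This sum and the product in `zk_mul_central` recover the unordered pair of `χ` and its
swap. -/
theorem zk_add_central (x : Zk k) (y : H C k) :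
    (T C (zk x) + T C (zk (sw x))) * y = y * (T C (zk x) + T C (zk (sw x))) := by
  refine commute_of_generators _ (fun z => ?_) ?_ ?_ y
  · rw [add_mul, mul_add, T_zk_comm x, T_zk_comm (sw x)]
  · rw [add_mul, mul_add, T_s1_zk, T_s1_zk, swap_swap', add_comm]
  · rw [add_mul, mul_add, T_omg_zk, T_omg_zk, swap_swap', add_comm]

theorem zk_mul_central (x : Zk k) (y : H C k) :
    T C (zk (x * sw x)) * y = y * T C (zk (x * sw x)) := by
  have h : sw (x * sw x) = x * sw x := by rw [map_mul, swap_swap', mul_comm]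
  refine commute_of_generators _ (fun z => T_zk_comm _ _) ?_ ?_ y
  · rw [T_s1_zk, h]
  · rw [T_omg_zk, h]

variable {n : Type} [Fintype n] [DecidableEq n] {φ ψ : H C k →ₐ[C] Matrix n n C}

/-- A cocycle vanishing on the generators vanishes. -/
theorem cocycle_eq_zero {δ : H C k →ₗ[C] Matrix n n C} (hδ : δ ∈ cocycles φ ψ)
    (hz : ∀ x : Zk k, δ (T C (zk x)) = 0) (hs : δ (T C s1) = 0) (ho : δ (T C omg) = 0) :
    δ = 0 := by
  let A : Subalgebra C (H C k) :=
    { carrier := {x | δ x = 0}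
      mul_mem' := fun {x y} hx hy => by
        simp only [Set.mem_ofPred_eq] at *
        rw [hδ, hx, hy, zero_mul, mul_zero, add_zero]
      add_mem' := fun {x y} hx hy => by
        simp only [Set.mem_ofPred_eq] at *
        rw [map_add, hx, hy, add_zero]
      algebraMap_mem' := fun r => by
        simp only [Set.mem_ofPred_eq]
        rw [Algebra.algebraMap_eq_smul_one, map_smul, cocycle_one hδ, smul_zero] }
  have ho' : δ (T C omg⁻¹) = 0 := by
    have h := hδ (T C omg) (T C omg⁻¹)
    rw [T_omg_inv_mul, cocycle_one hδ, ho, zero_mul, zero_add] at h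
    calc δ (T C omg⁻¹) = φ (T C omg⁻¹ * T C omg) * δ (T C omg⁻¹) := by
          rw [T_inv_omg_mul, map_one, one_mul]
      _ = 0 := by rw [map_mul, mul_assoc, ← h, mul_zero]
  have hA : A = ⊤ := eq_top_of_mem A hz hs ho ho'
  refine LinearMap.ext fun x => ?_
  have : x ∈ A := hA ▸ Algebra.mem_top
  exact this

/-- Two representations agreeing on the generators agree. -/
theorem algHom_ext {B : Type*} [Ring B] [Algebra C B] {φ ψ : H C k →ₐ[C] B}
    (hz : ∀ x : Zk k, φ (T C (zk x)) = ψ (T C (zk x))) (hs : φ (T C s1) = ψ (T C s1))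
    (ho : φ (T C omg) = ψ (T C omg)) : φ = ψ := by
  have ho' : φ (T C omg⁻¹) = ψ (T C omg⁻¹) := by
    calc φ (T C omg⁻¹) = φ (T C omg⁻¹) * (ψ (T C omg) * ψ (T C omg⁻¹)) := by
          rw [← map_mul, T_omg_inv_mul, map_one, mul_one]
      _ = ψ (T C omg⁻¹) := by
          rw [← ho, ← mul_assoc, ← map_mul, T_inv_omg_mul, map_one, one_mul]
  have hA : AlgHom.equalizer φ ψ = ⊤ := eq_top_of_mem _ hz hs ho ho'
  refine AlgHom.ext fun x => ?_
  have : x ∈ AlgHom.equalizer φ ψ := hA ▸ Algebra.mem_top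
  exact this

variable [Finite k] (hq : (Nat.card k : C) = 0)

include hq in
theorem natCast_card_units : (Nat.card kˣ : C) = -1 := by
  have := Fintype.ofFinite k
  classical
  rw [Nat.card_eq_fintype_card, Fintype.card_units, Nat.cast_sub Fintype.card_pos,
    ← Nat.card_eq_fintype_card, hq]
  simp

include hq in
-- The order is `(q - 1)²` with `q = 0` in `C`, so averages over `Z_κ` need no denominator.
theorem natCast_card_Zk [Fintype (Zk k)] : (Fintype.card (Zk k) : C) = 1 := by
  classical
  have := Fintype.ofFinite kˣ
  have h := natCast_card_units hq
  rw [Nat.card_eq_fintype_card] at h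
  have h2 : Fintype.card (Zk k) = Fintype.card kˣ ^ 2 := by
    rw [← Nat.card_eq_fintype_card, Nat.card_fun]; simp
  rw [h2, Nat.cast_pow, h, neg_one_sq]

include hq in
/-- Up to a coboundary, a cocycle vanishes on `Z_κ`. -/
theorem exists_coboundary_zk {δ : H C k →ₗ[C] Matrix n n C} (hδ : δ ∈ cocycles φ ψ) :
    ∃ X, ∀ x : Zk k, (δ - coboundary φ ψ X) (T C (zk x)) = 0 := by
  classical
  have := Fintype.ofFinite k
  -- The averaging argument for the vanishing of `H¹` of a finite group of invertible order, here
  -- equal to `1` in `C`.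
  refine ⟨-∑ y : Zk k, δ (T C (zk y)) * ψ (T C (zk y⁻¹)), fun x => ?_⟩
  have h1 : ∑ y : Zk k, δ (T C (zk (x * y))) * ψ (T C (zk (x * y)⁻¹))
      = ∑ y : Zk k, δ (T C (zk y)) * ψ (T C (zk y⁻¹)) :=
    Fintype.sum_equiv (Equiv.mulLeft x) _ _ fun y => rfl
  have h2 : ∀ y : Zk k, φ (T C (zk x)) * (δ (T C (zk y)) * ψ (T C (zk y⁻¹)))
      = δ (T C (zk (x * y))) * ψ (T C (zk (x * y)⁻¹)) * ψ (T C (zk x)) - δ (T C (zk x)) := by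
    intro y
    have e1 : (x * y)⁻¹ * x = y⁻¹ := by rw [mul_inv_rev, mul_assoc, inv_mul_cancel, mul_one]
    have e2 : T C (zk y) * T C (zk y⁻¹) = 1 := by
      rw [T_zk_mul, mul_inv_cancel, map_one, T_one]
    rw [mul_assoc (δ (T C (zk (x * y)))), ← map_mul, T_zk_mul, e1, ← T_zk_mul, hδ, add_mul,
      mul_assoc (δ (T C (zk x))), ← map_mul, e2, map_one, mul_one, add_sub_cancel_left, mul_assoc]
  have h3 : (Fintype.card (Zk k) : Matrix n n C) = 1 := by
    have := congrArg (algebraMap C (Matrix n n C)) (natCast_card_Zk (k := k) hq)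
    rwa [map_natCast, map_one] at this
  rw [LinearMap.sub_apply, coboundary_apply, mul_neg, neg_mul, Finset.mul_sum,
    Finset.sum_congr rfl fun y _ => h2 y, Finset.sum_sub_distrib, ← Finset.sum_mul, h1,
    Finset.sum_const, nsmul_eq_mul, Finset.card_univ, h3, one_mul]
  abel

/-- A first order deformation of a datum. -/
def Datum.deform (D : Datum C k (Matrix n n C)) (Y Q : Matrix n n C)
    (hY : ∀ x, Y * D.t x = D.t (sw x) * Y) (hQ : ∀ x, Q * D.t x = D.t (sw x) * Q)
    (hQS : Q * D.S + D.S * Q = (∑ᶠ v : kˣ, D.t ![-v, v⁻¹]) * Q)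
    (hYS : (Y * D.o + D.o * Y) * D.S + D.o * D.o * Q
      = Q * (D.o * D.o) + D.S * (Y * D.o + D.o * Y)) :
    Datum C k (DualNumber (Matrix n n C)) where
  t := (TrivSqZeroExt.inlHom (Matrix n n C) (Matrix n n C)).toMonoidHom.comp D.t
  o := ⟨TrivSqZeroExt.inl ↑D.o + TrivSqZeroExt.inr Y,
    TrivSqZeroExt.inl ↑D.o⁻¹ - TrivSqZeroExt.inr (↑D.o⁻¹ * Y * ↑D.o⁻¹), by
      ext <;> simp [← mul_assoc], by
      ext <;> simp [mul_assoc]⟩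
  S := TrivSqZeroExt.inl D.S + TrivSqZeroExt.inr Q
  o_t x := by
    refine TrivSqZeroExt.ext ?_ ?_
    · simp [D.o_t]
    · simp [hY]
  S_t x := by
    refine TrivSqZeroExt.ext ?_ ?_
    · simp [D.S_t]
    · simp [hQ]
  S_S := by
    have := Fintype.ofFinite kˣ
    have hs := D.S_S
    rw [finsum_eq_sum_of_fintype] at hs hQS ⊢
    have he : ∑ v : kˣ, ((TrivSqZeroExt.inlHom (Matrix n n C) (Matrix n n C)).toMonoidHom.comp
        D.t) ![-v, v⁻¹] = TrivSqZeroExt.inl (∑ v : kˣ, D.t ![-v, v⁻¹]) :=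
      (map_sum (TrivSqZeroExt.inlHom (Matrix n n C) (Matrix n n C)) _ _).symm
    rw [he]
    refine TrivSqZeroExt.ext ?_ ?_
    · simp [hs]
    · simp [← hQS]
      abel
  o_S := by
    refine TrivSqZeroExt.ext ?_ ?_
    · simp [D.o_S]
    · simp only [TrivSqZeroExt.snd_mul, TrivSqZeroExt.snd_add,
        TrivSqZeroExt.fst_mul, TrivSqZeroExt.fst_add, TrivSqZeroExt.fst_inl,
        TrivSqZeroExt.snd_inl, TrivSqZeroExt.fst_inr, TrivSqZeroExt.snd_inr, add_zero, zero_add,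
        smul_eq_mul, MulOpposite.smul_eq_mul_unop, MulOpposite.unop_op]
      rw [add_comm (D.o * Y : Matrix n n C), add_comm (D.S * _), ← hYS]
      abel

/-- A first order deformation of a datum gives a cocycle. -/
theorem exists_cocycle_of_deformation (D : Datum C k (Matrix n n C)) (Y Q : Matrix n n C)
    (hY : ∀ x, Y * D.t x = D.t (sw x) * Y) (hQ : ∀ x, Q * D.t x = D.t (sw x) * Q)
    (hQS : Q * D.S + D.S * Q = (∑ᶠ v : kˣ, D.t ![-v, v⁻¹]) * Q)
    (hYS : (Y * D.o + D.o * Y) * D.S + D.o * D.o * Q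
      = Q * (D.o * D.o) + D.S * (Y * D.o + D.o * Y)) :
    ∃ δ ∈ cocycles (D.lift hq) (D.lift hq), (∀ x, δ (T C (zk x)) = 0) ∧
      δ (T C s1) = Q ∧ δ (T C omg) = Y := by
  -- The `ε`-part of a homomorphism to the dual numbers is a derivation along its constant part,
  -- which is `D.lift hq`. A cocycle can thus be prescribed by its values at the generators as soon
  -- as these satisfy the linearized relations.
  let f := (D.deform Y Q hY hQ hQS hYS).lift hq
  have h1 : ∀ x, f (T C (zk x)) = TrivSqZeroExt.inl (D.t x) := fun x => Datum.lift_zk _ hq x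
  have h2 : f (T C s1) = TrivSqZeroExt.inl D.S + TrivSqZeroExt.inr Q := Datum.lift_s1 _ hq
  have h3 : f (T C omg) = TrivSqZeroExt.inl (D.o : Matrix n n C) + TrivSqZeroExt.inr Y := Datum.lift_omg _ hq
  clear_value f
  have hfst : ∀ x, (f x).fst = D.lift hq x := by
    have : (TrivSqZeroExt.fstHom C (Matrix n n C) (Matrix n n C)).comp f = D.lift hq := by
      refine algHom_ext (fun x => ?_) ?_ ?_
      · simp [h1, Datum.lift_zk]
      · simp [h2, Datum.lift_s1]
      · simp [h3, Datum.lift_omg]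
    exact fun x => DFunLike.congr_fun this x
  refine ⟨{ toFun := fun x => (f x).snd, map_add' := by simp, map_smul' := by simp },
    fun x y => ?_, fun x => ?_, ?_, ?_⟩
  · change (f (x * y)).snd = (f x).snd * _ + _ * (f y).snd
    rw [map_mul, TrivSqZeroExt.snd_mul, hfst, hfst, add_comm]
    rfl
  · change (f _).snd = _
    simp [h1]
  · change (f _).snd = _
    simp [h2]
  · change (f _).snd = _
    simp [h3]

end Cocycles

/-! ### The standard two-dimensional modules and their extensions -/

section Standard

variable {C : Type v} {k : Type u} [Field C] [Field k]

/-- The value `χ(c_{s₁})`. -/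
def kap (χ : Zk k →* Cˣ) : C := ∑ᶠ v : kˣ, (χ ![-v, v⁻¹] : C)

theorem chiC_eq_kap [Finite k] (χ : Zk k →* Cˣ) (x : Zk k) (i : Fin 2) :
    chiC χ (zk x * sLift i) = χ x * kap χ := by
  unfold chiC kap
  rw [mul_finsum]
  refine finsum_congr fun v => ?_
  rw [cElt_lift, mul_assoc, map_mul, Units.val_mul]
  congr 3
  funext j; fin_cases j <;> simp

theorem kap_eq_mul (χ : Zk k →* Cˣ) [Finite k] :
    kap χ = (χ ![-1, 1] : C) * ∑ᶠ v : kˣ, (χ ![v, v⁻¹] : C) := by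
  unfold kap
  rw [mul_finsum]
  refine finsum_congr fun v => ?_
  rw [← Units.val_mul, ← map_mul]
  congr 2
  funext j; fin_cases j <;> simp

theorem kap_sw [Finite k] (χ : Zk k →* Cˣ) : kap (χ.comp sw.toMonoidHom) = kap χ := by
  unfold kap
  rw [← finsum_comp_equiv ((Equiv.neg kˣ).trans (Equiv.inv kˣ))]
  refine finsum_congr fun v => ?_
  change ((χ (sw _) : Cˣ) : C) = _
  congr 2
  funext j
  fin_cases j <;> simp [arr_zero, arr_one, -mulAutArrow_apply_apply]

/-- Up to the factor `χ(-1, 1)` this is the sum over `κˣ` of the character `v ↦ χ(v, v⁻¹)`, which is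
nontrivial when `χ` is not symmetric. -/
theorem kap_eq_zero [Finite k] (χ : Zk k →* Cˣ) (h : ¬ ∀ x, χ (sw x) = χ x) : kap χ = 0 := by
  rw [kap_eq_mul, sum_eq_zero, mul_zero]
  exact fun h' => h (chi_swap χ h')

/-- Either `χ` is symmetric or `kap χ = 0`. This is the relation between `T_{s₁}` and `Z_κ` in the
standard module. -/
theorem kap_mul_sw [Finite k] (χ : Zk k →* Cˣ) (x : Zk k) : kap χ * χ (sw x) = χ x * kap χ := by
  by_cases h : ∀ x, χ (sw x) = χ x
  · rw [h, mul_comm]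
  · rw [kap_eq_zero χ h, zero_mul, mul_zero]

/-- For symmetric `χ` every `χ(v, v⁻¹)` is `1`, so the sum equals `χ(-1, 1) (q - 1) = -χ(-1, 1)`. -/
theorem kap_ne_zero [Finite k] (hq : (Nat.card k : C) = 0) (χ : Zk k →* Cˣ)
    (h : ∀ x, χ (sw x) = χ x) : kap χ ≠ 0 := by
  have := Fintype.ofFinite kˣ
  have h1 : ∀ v : kˣ, χ ![v, v⁻¹] = 1 := by
    intro v
    have h2 : (![v, v⁻¹] : Zk k) = ![v, 1] * sw ![v⁻¹, 1] := by
      funext j; fin_cases j <;> simp [arr_zero, arr_one, -mulAutArrow_apply_apply]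
    rw [h2, map_mul, h, ← map_mul]
    have h3 : (![v, 1] * ![v⁻¹, 1] : Zk k) = 1 := by
      funext j; fin_cases j <;> simp
    rw [h3, map_one]
  rw [kap_eq_mul, finsum_eq_sum_of_fintype]
  simp only [h1, Units.val_one, Finset.sum_const, Finset.card_univ, nsmul_eq_mul, mul_one]
  rw [← Nat.card_eq_fintype_card, natCast_card_units hq]
  simp

theorem vec_zero {α : Type*} [Zero α] : (![0, 0] : Fin 2 → α) = 0 := by
  funext i; fin_cases i <;> rfl

theorem finsum_diag [Finite k] (χ : Zk k →* Cˣ) :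
    ∑ᶠ v : kˣ, !![(χ ![-v, v⁻¹] : C), 0; 0, (χ (sw ![-v, v⁻¹]) : C)]
      = !![kap χ, 0; 0, kap χ] := by
  have := Fintype.ofFinite kˣ
  rw [finsum_eq_sum_of_fintype]
  ext i j
  fin_cases i <;> fin_cases j
  · simp [Matrix.sum_apply, kap, finsum_eq_sum_of_fintype]
  · simp [Matrix.sum_apply]
  · simp [Matrix.sum_apply]
  · rw [← kap_sw]
    simp [Matrix.sum_apply, kap, finsum_eq_sum_of_fintype, -mulAutArrow_apply_apply]

/-- The datum of the standard two-dimensional module with parameters `χ` and `z`. -/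
def stdDatum [Finite k] (χ : Zk k →* Cˣ) (z : Cˣ) : Datum C k (Matrix (Fin 2) (Fin 2) C) where
  t :=
    { toFun := fun x => !![(χ x : C), 0; 0, (χ (sw x) : C)]
      map_one' := by rw [map_one, map_one]; simp [Matrix.one_fin_two]
      map_mul' := fun x y => by rw [map_mul, map_mul, map_mul]; simp }
  o := ⟨!![0, 1; (z : C), 0], !![0, ((z⁻¹ : Cˣ) : C); 1, 0], by
    simp [Matrix.one_fin_two], by simp [Matrix.one_fin_two]⟩
  S := !![kap χ, 0; 0, 0]
  o_t x := by simp [swap_swap', -mulAutArrow_apply_apply, mul_comm]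
  S_t x := by simp [vec_zero, kap_mul_sw, swap_swap', -mulAutArrow_apply_apply, mul_comm]
  S_S := by
    refine Eq.trans ?_ (congrArg (· * !![kap χ, 0; 0, 0]) (finsum_diag χ).symm)
    simp [vec_zero]
  o_S := by simp [mul_comm]

theorem stdDatum_sum [Finite k] (χ : Zk k →* Cˣ) (z : Cˣ) :
    ∑ᶠ v : kˣ, (stdDatum χ z).t ![-v, v⁻¹] = !![kap χ, 0; 0, kap χ] := finsum_diag χ

variable [Finite k] (hq : (Nat.card k : C) = 0) (χ : Zk k →* Cˣ) (z : Cˣ)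

/-- The standard two-dimensional representation. -/
def stdHom : H C k →ₐ[C] Matrix (Fin 2) (Fin 2) C := (stdDatum χ z).lift hq

theorem stdHom_zk (x : Zk k) :
    stdHom hq χ z (T C (zk x)) = !![(χ x : C), 0; 0, (χ (sw x) : C)] := Datum.lift_zk _ hq x

theorem stdHom_s1 : stdHom hq χ z (T C s1) = !![kap χ, 0; 0, 0] := Datum.lift_s1 _ hq

theorem stdHom_omg : stdHom hq χ z (T C omg) = !![0, 1; (z : C), 0] := Datum.lift_omg _ hq

theorem stdHom_omg_sq : stdHom hq χ z (T C omg * T C omg) = (z : C) • 1 := by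
  rw [map_mul, stdHom_omg]
  simp [Matrix.one_fin_two]

/-- Representations related by an invertible matrix give isomorphic modules. -/
def rowModEquiv {A : Type a} [Ring A] [Algebra C A] {n : Type} [Fintype n] [DecidableEq n]
    {φ ψ : A →ₐ[C] Matrix n n C} (P : (Matrix n n C)ˣ)
    (h : ∀ x, φ x * (P : Matrix n n C) = P * ψ x) :
    RowMod.{v, w, a} φ ≃ₗ[Aᵐᵒᵖ] RowMod.{v, w, a} ψ where
  toFun x := RowMod.mk.{v, w, a} ψ (Matrix.vecMul ((RowMod.mk φ).symm x) (P : Matrix n n C))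
  invFun x := RowMod.mk.{v, w, a} φ
    (Matrix.vecMul ((RowMod.mk ψ).symm x) ((P⁻¹ : (Matrix n n C)ˣ) : Matrix n n C))
  map_add' x y := by rw [map_add, Matrix.add_vecMul, map_add]
  map_smul' a x := by
    obtain ⟨x, rfl⟩ := (RowMod.mk φ).surjective x
    simp [RowMod.smul_mk, h]
  left_inv x := by simp
  right_inv x := by simp

omit [Finite k] in
theorem intertwine_of_generators {n : Type} [Fintype n] [DecidableEq n]
    {φ ψ : H C k →ₐ[C] Matrix n n C} (P : Matrix n n C)
    (hz : ∀ x : Zk k, φ (T C (zk x)) * P = P * ψ (T C (zk x)))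
    (hs : φ (T C s1) * P = P * ψ (T C s1)) (ho : φ (T C omg) * P = P * ψ (T C omg))
    (x : H C k) : φ x * P = P * ψ x := by
  let A : Subalgebra C (H C k) :=
    { carrier := {x | φ x * P = P * ψ x}
      mul_mem' := fun {x y} hx hy => by
        simp only [Set.mem_ofPred_eq] at *
        rw [map_mul, map_mul, mul_assoc, hy, ← mul_assoc, hx, mul_assoc]
      add_mem' := fun {x y} hx hy => by
        simp only [Set.mem_ofPred_eq] at *
        rw [map_add, map_add, add_mul, mul_add, hx, hy]
      algebraMap_mem' := fun r => by
        simp only [Set.mem_ofPred_eq]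
        rw [AlgHom.commutes, AlgHom.commutes, Algebra.commutes] }
  have ho' : φ (T C omg⁻¹) * P = P * ψ (T C omg⁻¹) := by
    calc φ (T C omg⁻¹) * P = φ (T C omg⁻¹) * (P * ψ (T C omg)) * ψ (T C omg⁻¹) := by
          rw [mul_assoc, mul_assoc, ← map_mul ψ, T_omg_inv_mul, map_one, mul_one]
      _ = P * ψ (T C omg⁻¹) := by
          rw [← ho, ← mul_assoc, ← map_mul, T_inv_omg_mul, map_one, one_mul]
  have hA : A = ⊤ := eq_top_of_mem A hz hs ho ho'
  have : x ∈ A := hA ▸ Algebra.mem_top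
  exact this

/-- Conjugate parameters give isomorphic modules. -/
theorem nonempty_rowModEquiv_sw (h : ¬ ∀ x, χ (sw x) = χ x) (χ' : Zk k →* Cˣ)
    (h' : ∀ x, χ' x = χ (sw x)) :
    Nonempty (RowMod.{v, w} (stdHom hq χ z) ≃ₗ[(H C k)ᵐᵒᵖ] RowMod.{v, w} (stdHom hq χ' z)) := by
  have hχ : χ' = χ.comp sw.toMonoidHom := MonoidHom.ext h'
  have hk := kap_eq_zero χ h
  have hk' : kap χ' = 0 := by rw [hχ, kap_sw, hk]
  -- The matrix of `T_ω` exchanges the two eigenlines of `Z_κ`; it intertwines because `T_{s₁}` acts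
  -- as `0` on both modules.
  refine ⟨rowModEquiv (stdDatum χ z).o (intertwine_of_generators _ (fun x => ?_) ?_ ?_)⟩
  · rw [stdHom_zk, stdHom_zk, h', h', swap_swap']
    simp [stdDatum, -mulAutArrow_apply_apply, mul_comm]
  · rw [stdHom_s1, stdHom_s1, hk, hk']
    simp [stdDatum, vec_zero]
  · rw [stdHom_omg, stdHom_omg]
    simp [stdDatum]

/-- Modules with different parameters have no extensions. -/
theorem exists_coboundary_of_ne (χ' : Zk k →* Cˣ) (z' : Cˣ)
    (h : z = z' → χ' ≠ χ ∧ ¬ ∀ x, χ' x = χ (sw x)) (δ : H C k →ₗ[C] Matrix (Fin 2) (Fin 2) C)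
    (hδ : δ ∈ cocycles (stdHom hq χ z) (stdHom hq χ' z')) :
    ∃ X, δ = coboundary (stdHom hq χ z) (stdHom hq χ' z') X := by
  by_cases hz : z = z'
  swap
  · exact exists_coboundary_of_central _ _ _ omg_sq_central (z : C) z' (stdHom_omg_sq hq χ z)
      (stdHom_omg_sq hq χ' z') (fun h' => hz (Units.ext h')) δ hδ
  by_contra hX
  -- A cocycle that is not a coboundary forces every central element to act by equal scalars on the
  -- two modules.
  have hadd : ∀ x, (χ x : C) + χ (sw x) = χ' x + χ' (sw x) := by
    intro x
    by_contra hne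
    refine hX (exists_coboundary_of_central _ _ _ (zk_add_central x) _ _ ?_ ?_ hne δ hδ)
    · rw [map_add, stdHom_zk, stdHom_zk, swap_swap']
      simp [Matrix.one_fin_two, -mulAutArrow_apply_apply, add_comm]
    · rw [map_add, stdHom_zk, stdHom_zk, swap_swap']
      simp [Matrix.one_fin_two, -mulAutArrow_apply_apply, add_comm]
  have hmul : ∀ x, (χ x : C) * χ (sw x) = χ' x * χ' (sw x) := by
    intro x
    by_contra hne
    refine hX (exists_coboundary_of_central _ _ _ (zk_mul_central x) _ _ ?_ ?_ hne δ hδ)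
    · rw [stdHom_zk, map_mul, map_mul, map_mul, swap_swap']
      simp [Matrix.one_fin_two, -mulAutArrow_apply_apply, mul_comm]
    · rw [stdHom_zk, map_mul, map_mul, map_mul, swap_swap']
      simp [Matrix.one_fin_two, -mulAutArrow_apply_apply, mul_comm]
  have hor : ∀ x, χ' x = χ x ∨ χ' x = χ (sw x) := by
    intro x
    -- `χ' x` is a root of the quadratic polynomial with roots `χ x` and `χ (sw x)`.
    have h0 : ((χ' x : C) - χ x) * (χ' x - χ (sw x)) = 0 := by
      linear_combination (χ' x : C) * (-hadd x) + hmul x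
    rcases mul_eq_zero.1 h0 with h | h
    · exact .inl (Units.ext (sub_eq_zero.1 h))
    · exact .inr (Units.ext (sub_eq_zero.1 h))
  obtain ⟨h1, h2⟩ := h hz
  obtain ⟨x, hx⟩ : ∃ x, χ' x ≠ χ x := by
    by_contra hn
    push Not at hn
    exact h1 (MonoidHom.ext hn)
  push Not at h2
  obtain ⟨y, hy⟩ := h2
  have hx' := (hor x).resolve_left hx
  have hy' := (hor y).resolve_right hy
  -- A group is not the union of two proper subgroups: `χ'` agrees with `χ` on one and with the
  -- swapped character on the other, and `x * y` lies in neither.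
  rcases hor (x * y) with h | h
  · rw [map_mul, map_mul, hy'] at h
    exact hx (mul_right_cancel h)
  · rw [map_mul, map_mul, map_mul, hx'] at h
    exact hy (mul_left_cancel h)

theorem stdHom_zk_of_ne (h : ∀ x, χ (sw x) = χ x) (x : Zk k) :
    stdHom hq χ z (T C (zk x)) = (χ x : C) • 1 := by
  rw [stdHom_zk, h]; simp [Matrix.one_fin_two]

variable {hq χ z} in
-- Since `ω²` acts by `z`, this entry is the first order variation of `z`. Coboundaries vanish at
-- the central element `ω²`, so it is an invariant of the extension class.
theorem cocycle_omg_sq {δ : H C k →ₗ[C] Matrix (Fin 2) (Fin 2) C}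
    (hδ : δ ∈ cocycles (stdHom hq χ z) (stdHom hq χ z)) :
    δ (T C omg * T C omg) 0 0 = δ (T C omg) 0 1 * z + δ (T C omg) 1 0 := by
  rw [hδ, stdHom_omg, Matrix.add_apply, Matrix.mul_apply, Matrix.mul_apply]
  simp [Fin.sum_univ_two]

theorem coboundary_omg_sq (X : Matrix (Fin 2) (Fin 2) C) :
    coboundary (stdHom hq χ z) (stdHom hq χ z) X (T C omg * T C omg) = 0 := by
  rw [coboundary_apply, stdHom_omg_sq]; simp

/-- The coboundary of a diagonal matrix, which adjusts the value at `T_ω`. -/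
theorem exists_coboundary_of_omg {δ : H C k →ₗ[C] Matrix (Fin 2) (Fin 2) C}
    (hδ : δ ∈ cocycles (stdHom hq χ z) (stdHom hq χ z)) (h1 : ∀ x : Zk k, δ (T C (zk x)) = 0)
    (h2 : δ (T C s1) = 0) (h3 : δ (T C omg) 0 0 = 0) (h4 : δ (T C omg) 1 1 = 0)
    (h5 : δ (T C omg) 0 1 * z + δ (T C omg) 1 0 = 0) :
    ∃ X, δ = coboundary (stdHom hq χ z) (stdHom hq χ z) X := by
  -- The matrix `diag(0, d)` commutes with the diagonal matrices of `T_t` and `T_{s₁}`, and its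
  -- coboundary at `T_ω` is `(0 d; -dz 0)`. The entry `0 1` dictates `d`, and `h5` says that the
  -- entry `1 0` then agrees.
  refine ⟨!![0, 0; 0, δ (T C omg) 0 1], ?_⟩
  rw [← sub_eq_zero]
  refine cocycle_eq_zero (sub_mem hδ (coboundary_mem _ _ _)) (fun x => ?_) ?_ ?_
  · rw [LinearMap.sub_apply, h1, coboundary_apply, stdHom_zk]
    simp [mul_comm, vec_zero]
  · rw [LinearMap.sub_apply, h2, coboundary_apply, stdHom_s1]
    simp [vec_zero]
  · rw [LinearMap.sub_apply, coboundary_apply, stdHom_omg]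
    ext i j
    fin_cases i <;> fin_cases j
    · simpa using h3
    · simp
    · simp
      linear_combination h5
    · simpa using h4

/-- Such a `Q` exchanges the eigenlines of `χ` and of its swap, which are distinct characters. -/
theorem cocycle_antidiag (h : ¬ ∀ x, χ (sw x) = χ x) (Q : Matrix (Fin 2) (Fin 2) C)
    (hQ : ∀ x, Q * stdHom hq χ z (T C (zk x)) = stdHom hq χ z (T C (zk (sw x))) * Q) :
    Q 0 0 = 0 ∧ Q 1 1 = 0 := by
  push Not at h
  obtain ⟨x, hx⟩ := h
  have hx' : (χ (sw x) : C) - χ x ≠ 0 := sub_ne_zero.2 fun h => hx (Units.ext h)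
  have h := hQ x
  rw [stdHom_zk, stdHom_zk, swap_swap'] at h
  constructor
  · have h0 := congrFun (congrFun h 0) 0
    simp [Matrix.mul_apply, Fin.sum_univ_two, -mulAutArrow_apply_apply] at h0
    exact (mul_eq_zero.1 (show ((χ (sw x) : C) - χ x) * Q 0 0 = 0 by
      linear_combination -h0)).resolve_left hx'
  · have h0 := congrFun (congrFun h 1) 1
    simp [Matrix.mul_apply, Fin.sum_univ_two, -mulAutArrow_apply_apply] at h0
    exact (mul_eq_zero.1 (show ((χ (sw x) : C) - χ x) * Q 1 1 = 0 by
      linear_combination h0)).resolve_left hx'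

/-- The invariants of a cocycle in the regular case. -/
def invRegular : cocycles (stdHom hq χ z) (stdHom hq χ z) →ₗ[C] (Fin 3 → C) where
  toFun δ := ![δ.1 (T C s1) 0 1, δ.1 (T C s1) 1 0, δ.1 (T C omg * T C omg) 0 0]
  map_add' δ ε := by simp
  map_smul' c δ := by simp

theorem invRegular_apply (δ : cocycles (stdHom hq χ z) (stdHom hq χ z)) :
    invRegular hq χ z δ
      = ![δ.1 (T C s1) 0 1, δ.1 (T C s1) 1 0, δ.1 (T C omg * T C omg) 0 0] := rfl

/-- The invariants of a cocycle in the symmetric case. -/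
def invSymm : cocycles (stdHom hq χ z) (stdHom hq χ z) →ₗ[C] (Fin 2 → C) where
  toFun δ := ![(δ.1 (T C s1 * T C omg)).trace, δ.1 (T C omg * T C omg) 0 0]
  map_add' δ ε := by simp
  map_smul' c δ := by simp

theorem invSymm_apply (δ : cocycles (stdHom hq χ z) (stdHom hq χ z)) :
    invSymm hq χ z δ
      = ![(δ.1 (T C s1 * T C omg)).trace, δ.1 (T C omg * T C omg) 0 0] := rfl

theorem invRegular_sub {δ ε : H C k →ₗ[C] Matrix (Fin 2) (Fin 2) C}
    (hδ : δ ∈ cocycles (stdHom hq χ z) (stdHom hq χ z))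
    (hε : ε ∈ cocycles (stdHom hq χ z) (stdHom hq χ z)) :
    invRegular hq χ z ⟨δ - ε, sub_mem hδ hε⟩ = invRegular hq χ z ⟨δ, hδ⟩ - invRegular hq χ z ⟨ε, hε⟩ := by
  simp only [invRegular_apply]
  funext i
  fin_cases i <;> simp

/-- Here `kap χ = 0`, so `T_{s₁}` acts as `0` and the linearized quadratic relation is empty. As
`ω²` is scalar, any antidiagonal matrix is an admissible variation of `T_{s₁}`, independently of the
variation of `z`. -/
theorem invRegular_surjective (h : ¬ ∀ x, χ (sw x) = χ x) :
    Function.Surjective (invRegular hq χ z) := by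
  intro f
  have hk := kap_eq_zero χ h
  obtain ⟨δ, hδ, h1, h2, h3⟩ := exists_cocycle_of_deformation hq (stdDatum χ z)
    !![0, 0; f 2, 0] !![0, f 0; f 1, 0] (fun x => by
      simp [stdDatum, vec_zero, swap_swap', -mulAutArrow_apply_apply, mul_comm])
    (fun x => by simp [stdDatum, vec_zero, swap_swap', -mulAutArrow_apply_apply, mul_comm])
    (by rw [stdDatum_sum, hk]; simp [stdDatum, hk, vec_zero])
    (by simp [stdDatum, hk, mul_comm, vec_zero])
  refine ⟨⟨δ, hδ⟩, ?_⟩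
  have h4 := cocycle_omg_sq (hq := hq) (χ := χ) (z := z) hδ
  rw [invRegular_apply, h4, h2, h3]
  funext i
  fin_cases i <;> simp

theorem invSymm_sub {δ ε : H C k →ₗ[C] Matrix (Fin 2) (Fin 2) C}
    (hδ : δ ∈ cocycles (stdHom hq χ z) (stdHom hq χ z))
    (hε : ε ∈ cocycles (stdHom hq χ z) (stdHom hq χ z)) :
    invSymm hq χ z ⟨δ - ε, sub_mem hδ hε⟩ = invSymm hq χ z ⟨δ, hδ⟩ - invSymm hq χ z ⟨ε, hε⟩ := by
  simp only [invSymm_apply]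
  funext i
  fin_cases i <;> simp

/-- With `T_{s₁}` kept fixed, the variation `Y` of `T_ω` must make `Y * o + o * Y` commute with
`diag(kap χ, 0)`; for diagonal `Y` this means trace zero. The upper left entry of `Y` is divided by
`kap χ` because the trace of `T_{s₁} T_ω` varies by `kap χ` times that entry. -/
theorem invSymm_surjective (h : ∀ x, χ (sw x) = χ x) :
    Function.Surjective (invSymm hq χ z) := by
  intro f
  have hk := kap_ne_zero hq χ h
  obtain ⟨δ, hδ, h1, h2, h3⟩ := exists_cocycle_of_deformation hq (stdDatum χ z)
    !![f 0 * (kap χ)⁻¹, 0; f 1, - (f 0 * (kap χ)⁻¹)] 0 (fun x => by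
      simp [stdDatum, h, -mulAutArrow_apply_apply, mul_comm])
    (fun x => by simp) (by simp) (by simp [stdDatum, mul_comm])
  refine ⟨⟨δ, hδ⟩, ?_⟩
  have h4 := cocycle_omg_sq (hq := hq) (χ := χ) (z := z) hδ
  have h5 := hδ (T C s1) (T C omg)
  rw [invSymm_apply, h4, h5, h2, h3]
  funext i
  fin_cases i
  · have : stdHom hq χ z (T C s1) = !![kap χ, 0; 0, 0] := stdHom_s1 _ _ _
    change (stdDatum χ z).lift hq (T C s1) = _ at this
    simp [this, Matrix.trace_fin_two]
    rw [mul_left_comm, mul_inv_cancel₀ hk, mul_one]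
  · simp

/-- Coboundaries have zero invariants because `T_{s₁}` acts as `0` and `ω²` as a scalar. Conversely,
a cocycle normalized on `Z_κ` has antidiagonal values at `T_{s₁}` and `T_ω`; once the invariants
vanish, what remains at `T_ω` is the coboundary of a diagonal matrix. -/
theorem invRegular_eq_zero_iff (h : ¬ ∀ x, χ (sw x) = χ x)
    (δ : cocycles (stdHom hq χ z) (stdHom hq χ z)) :
    invRegular hq χ z δ = 0 ↔ ∃ X, δ.1 = coboundary (stdHom hq χ z) (stdHom hq χ z) X := by
  have hk := kap_eq_zero χ h
  obtain ⟨δ, hδ⟩ := δ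
  have hcob : ∀ X, invRegular hq χ z ⟨_, coboundary_mem _ _ X⟩ = 0 := by
    intro X
    have h0 := coboundary_omg_sq hq χ z X
    have h1 : coboundary (stdHom hq χ z) (stdHom hq χ z) X (T C s1) = 0 := by
      rw [coboundary_apply, stdHom_s1, hk]
      have h2 : (!![0, 0; 0, 0] : Matrix (Fin 2) (Fin 2) C) = 0 := by simp [vec_zero]
      rw [h2, zero_mul, mul_zero, sub_zero]
    rw [invRegular_apply, h0, h1]
    funext i
    fin_cases i <;> simp
  constructor
  · intro hL
    obtain ⟨X, hX⟩ := exists_coboundary_zk hq hδ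
    have hε := sub_mem hδ (coboundary_mem (stdHom hq χ z) (stdHom hq χ z) X)
    have hLε : invRegular hq χ z ⟨_, hε⟩ = 0 := by
      rw [invRegular_sub hq χ z hδ (coboundary_mem _ _ X), hL, hcob, sub_zero]
    generalize hεδ : δ - coboundary (stdHom hq χ z) (stdHom hq χ z) X = ε at hX hε hLε
    rw [invRegular_apply] at hLε
    have e0 : ε (T C s1) 0 1 = 0 := congrFun hLε 0
    have e1 : ε (T C s1) 1 0 = 0 := congrFun hLε 1
    have e2 : ε (T C omg * T C omg) 0 0 = 0 := congrFun hLε 2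
    have hs : ∀ x, ε (T C s1) * stdHom hq χ z (T C (zk x))
        = stdHom hq χ z (T C (zk (sw x))) * ε (T C s1) := by
      intro x
      have := congrArg ε (T_s1_zk (C := C) x)
      rwa [hε, hε, hX, hX, mul_zero, zero_mul, add_zero, zero_add] at this
    have ho : ∀ x, ε (T C omg) * stdHom hq χ z (T C (zk x))
        = stdHom hq χ z (T C (zk (sw x))) * ε (T C omg) := by
      intro x
      have := congrArg ε (T_omg_zk (C := C) x)
      rwa [hε, hε, hX, hX, mul_zero, zero_mul, add_zero, zero_add] at this
    obtain ⟨a0, a1⟩ := cocycle_antidiag hq χ z h _ hs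
    obtain ⟨b0, b1⟩ := cocycle_antidiag hq χ z h _ ho
    rw [cocycle_omg_sq hε] at e2
    have hs0 : ε (T C s1) = 0 := by
      ext i j
      fin_cases i <;> fin_cases j
      exacts [a0, e0, e1, a1]
    obtain ⟨W, hW⟩ := exists_coboundary_of_omg hq χ z hε hX hs0 b0 b1 e2
    refine ⟨X + W, ?_⟩
    rw [map_add, ← hW, ← hεδ]
    simp
  · rintro ⟨X, hX⟩
    simp only at hX
    subst hX
    exact hcob X

/-- The trace of a coboundary of a module with itself vanishes by cyclicity. Conversely, `T_t` acts
by scalars, so any matrix may be used to conjugate without disturbing the normalization on `Z_κ`;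
this removes the value at `T_{s₁}`, after which the invariants control the value at `T_ω`. -/
theorem invSymm_eq_zero_iff (h : ∀ x, χ (sw x) = χ x)
    (δ : cocycles (stdHom hq χ z) (stdHom hq χ z)) :
    invSymm hq χ z δ = 0 ↔ ∃ X, δ.1 = coboundary (stdHom hq χ z) (stdHom hq χ z) X := by
  have hk := kap_ne_zero hq χ h
  obtain ⟨δ, hδ⟩ := δ
  have hcob : ∀ X, invSymm hq χ z ⟨_, coboundary_mem _ _ X⟩ = 0 := by
    intro X
    have h0 := coboundary_omg_sq hq χ z X
    have h1 : (coboundary (stdHom hq χ z) (stdHom hq χ z) X (T C s1 * T C omg)).trace = 0 := by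
      rw [coboundary_apply, Matrix.trace_sub, Matrix.trace_mul_comm, sub_self]
    rw [invSymm_apply, h0, h1]
    funext i
    fin_cases i <;> simp
  have hsub : ∀ ε (hε : ε ∈ cocycles (stdHom hq χ z) (stdHom hq χ z)) X,
      invSymm hq χ z ⟨_, sub_mem hε (coboundary_mem (stdHom hq χ z) (stdHom hq χ z) X)⟩
        = invSymm hq χ z ⟨ε, hε⟩ := by
    intro ε hε X
    rw [invSymm_sub hq χ z hε (coboundary_mem _ _ X), hcob, sub_zero]
  constructor
  · intro hL
    obtain ⟨X, hX⟩ := exists_coboundary_zk hq hδ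
    have hε := sub_mem hδ (coboundary_mem (stdHom hq χ z) (stdHom hq χ z) X)
    have hLε : invSymm hq χ z ⟨_, hε⟩ = 0 := (hsub δ hδ X).trans hL
    generalize hεδ : δ - coboundary (stdHom hq χ z) (stdHom hq χ z) X = ε at hX hε hLε
    have hquad : ε (T C s1) * !![kap χ, 0; 0, 0] + !![kap χ, 0; 0, 0] * ε (T C s1)
        = !![kap χ, 0; 0, kap χ] * ε (T C s1) := by
      have h1 := congrArg ε (T_s1_s1 (k := k) hq)
      have := Fintype.ofFinite kˣ
      rw [hε, hε, finsum_eq_sum_of_fintype, map_sum, map_sum, stdHom_s1] at h1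
      simp only [hX, Finset.sum_const_zero, zero_mul, zero_add, stdHom_zk] at h1
      rw [h1, ← finsum_eq_sum_of_fintype, finsum_diag]
    -- The diagonal entries of the linearized quadratic relation read `2 kap χ · a = kap χ · a` and
    -- `0 = kap χ · d`; the off-diagonal ones are vacuous.
    have a0 : ε (T C s1) 0 0 = 0 := by
      have h1 := congrFun (congrFun hquad 0) 0
      rw [Matrix.add_apply, Matrix.mul_apply, Matrix.mul_apply, Matrix.mul_apply] at h1
      simp [Fin.sum_univ_two, hk] at h1
      exact h1
    have a1 : ε (T C s1) 1 1 = 0 := by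
      have h1 := congrFun (congrFun hquad 1) 1
      rw [Matrix.add_apply, Matrix.mul_apply, Matrix.mul_apply, Matrix.mul_apply] at h1
      simp [Fin.sum_univ_two, hk] at h1
      exact h1
    -- The commutator of `diag(kap χ, 0)` with an antidiagonal matrix multiplies its entries by `kap
    -- χ` and `-kap χ`, which dictates `Z`.
    let Z : Matrix (Fin 2) (Fin 2) C :=
      !![0, ε (T C s1) 0 1 / kap χ; -(ε (T C s1) 1 0 / kap χ), 0]
    have hη := sub_mem hε (coboundary_mem (stdHom hq χ z) (stdHom hq χ z) Z)
    have hLη : invSymm hq χ z ⟨_, hη⟩ = 0 := (hsub ε hε Z).trans hLε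
    have hηX : ∀ x, (ε - coboundary (stdHom hq χ z) (stdHom hq χ z) Z) (T C (zk x)) = 0 := by
      intro x
      rw [LinearMap.sub_apply, hX, coboundary_apply, stdHom_zk_of_ne hq χ z h]
      simp
    have hηs : (ε - coboundary (stdHom hq χ z) (stdHom hq χ z) Z) (T C s1) = 0 := by
      rw [LinearMap.sub_apply, coboundary_apply, stdHom_s1]
      ext i j
      fin_cases i <;> fin_cases j
      · simp [Z, a0]
      · simp [Z]; field_simp; simp
      · simp [Z]; field_simp; simp
      · simp [Z, a1]
    generalize hηε : ε - coboundary (stdHom hq χ z) (stdHom hq χ z) Z = η at hη hLη hηX hηs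
    rw [invSymm_apply] at hLη
    have e0 : (η (T C s1 * T C omg)).trace = 0 := congrFun hLη 0
    have e1 : η (T C omg * T C omg) 0 0 = 0 := congrFun hLη 1
    rw [cocycle_omg_sq hη] at e1
    have b0 : η (T C omg) 0 0 = 0 := by
      rw [hη, hηs, stdHom_s1, Matrix.trace_fin_two, zero_mul, zero_add, Matrix.mul_apply,
        Matrix.mul_apply] at e0
      simp [Fin.sum_univ_two, hk] at e0
      exact e0
    -- The entry `0 1` of the linearized commutation of `ω²` with `T_{s₁}` says that `kap χ` times
    -- the trace of `η(T_ω)` is zero.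
    have b1 : η (T C omg) 1 1 = 0 := by
      have h1 := congrArg η (T_omg_sq_s1 (C := C) (k := k))
      rw [hη, hη, hη (T C s1), hη, hηs, mul_zero, zero_mul, add_zero, zero_add, stdHom_s1,
        stdHom_omg] at h1
      have h2 := congrFun (congrFun h1 0) 1
      simp only [Matrix.mul_apply, Fin.sum_univ_two, Matrix.add_apply] at h2
      simp [b0, hk] at h2
      exact h2
    obtain ⟨W, hW⟩ := exists_coboundary_of_omg hq χ z hη hηX hηs b0 b1 e1
    refine ⟨X + (Z + W), ?_⟩
    rw [map_add, map_add, ← hW, ← hηε, ← hεδ]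
    simp
  · rintro ⟨X, hX⟩
    simp only at hX
    subst hX
    exact hcob X

end Standard

/-! ### Irreducible representations generated, up to scalars, by one operator -/

section Scalar

variable {C : Type v} [Field C] [IsAlgClosed C] {V : Type t} [AddCommGroup V] [Module C V]
  {G : Type*} [Group G] (ρ : Representation C G V)

theorem exists_ne_zero_of_isIrreducible {C : Type v} [Field C] {V : Type t} [AddCommGroup V]
    [Module C V] {G : Type*} [Monoid G] {ρ : Representation C G V} (hρ : ρ.IsIrreducible) :
    ∃ y : V, y ≠ 0 := by
  by_contra hn
  push Not at hn
  refine hρ.toNontrivial.exists_pair_ne.elim fun A ⟨B, hAB⟩ => hAB ?_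
  refine Subrepresentation.toSubmodule_injective (Submodule.ext fun y => ?_)
  rw [hn y]
  simp only [zero_mem]

/-- An irreducible representation that is, up to scalars, generated by one operator is
one-dimensional. -/
theorem exists_generator_of_isIrreducible (hρ : ρ.IsIrreducible) (g : G)
    (hg : ∀ x, ∃ (c : C) (n : ℤ), ρ x = c • ρ (g ^ n)) :
    (∃ z : Cˣ, ∀ y, ρ g y = (z : C) • y) ∧ ∃ y₀ : V, y₀ ≠ 0 ∧ ∀ y, ∃ c : C, y = c • y₀ := by
  have hsub : ∀ U : Submodule C V, (∀ x, ∀ y ∈ U, ρ x y ∈ U) → U = ⊥ ∨ U = ⊤ := by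
    intro U hU
    have := hρ.eq_bot_or_eq_top (⟨U, fun x y hy => hU x y hy⟩ : Subrepresentation ρ)
    refine this.imp (fun h => ?_) (fun h => ?_)
    · exact congrArg Subrepresentation.toSubmodule h
    · exact congrArg Subrepresentation.toSubmodule h
  obtain ⟨y, hy⟩ := exists_ne_zero_of_isIrreducible hρ
  have hinv : ∀ y, ρ g (ρ g⁻¹ y) = y := fun y => by
    rw [← Module.End.mul_apply, ← map_mul, mul_inv_cancel, map_one]; rfl
  have hstab : ∀ U : Submodule C V, (∀ y ∈ U, ρ g y ∈ U) → (∀ y ∈ U, ρ g⁻¹ y ∈ U) →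
      U = ⊥ ∨ U = ⊤ := by
    intro U h1 h2
    refine hsub U fun x => ?_
    obtain ⟨c, n, hx⟩ := hg x
    intro y hy
    rw [hx, LinearMap.smul_apply]
    refine U.smul_mem c ?_
    clear hx
    induction n using Int.induction_on generalizing y with
    | zero => simpa using hy
    | succ n ih =>
      rw [zpow_add, zpow_one, map_mul, Module.End.mul_apply]
      exact ih _ (h1 y hy)
    | pred n ih =>
      rw [zpow_sub, zpow_one, map_mul, Module.End.mul_apply]
      exact ih _ (h2 y hy)
  have hann : ∃ r : Polynomial C, r ≠ 0 ∧ ∃ y : V, y ≠ 0 ∧ Polynomial.aeval (ρ g) r y = 0 := by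
    -- No finiteness of `V` is available, so an annihilating polynomial has to be produced. `U` is
    -- the subrepresentation generated by `(g - 1) y`, with the powers of `g⁻¹` cleared; it is zero
    -- or contains `y`.
    let U : Submodule C V :=
      { carrier := {x | ∃ (n : ℕ) (q : Polynomial C),
          (ρ g ^ n) x = Polynomial.aeval (ρ g) (q * (Polynomial.X - 1)) y}
        add_mem' := by
          rintro a b ⟨n, q, hq⟩ ⟨m, r, hr⟩
          refine ⟨n + m, Polynomial.X ^ m * q + Polynomial.X ^ n * r, ?_⟩
          rw [map_add, add_mul, map_add, LinearMap.add_apply, mul_assoc, mul_assoc,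
            map_mul _ (_ ^ m), map_mul _ (_ ^ n), Module.End.mul_apply, Module.End.mul_apply,
            ← hq, ← hr, map_pow, map_pow, Polynomial.aeval_X]
          rw [← Module.End.mul_apply, ← Module.End.mul_apply, ← pow_add, ← pow_add, add_comm m]
        zero_mem' := ⟨0, 0, by simp⟩
        smul_mem' := by
          rintro c a ⟨n, q, hq⟩
          exact ⟨n, c • q, by rw [map_smul, hq, smul_mul_assoc, map_smul]; rfl⟩ }
    have hU1 : ∀ y ∈ U, ρ g y ∈ U := by
      rintro x ⟨n, q, hq⟩
      refine ⟨n, Polynomial.X * q, ?_⟩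
      rw [mul_assoc, map_mul, Module.End.mul_apply, ← hq, Polynomial.aeval_X,
        ← Module.End.mul_apply, ← Module.End.mul_apply, ← pow_succ, ← pow_succ']
    have hU2 : ∀ y ∈ U, ρ g⁻¹ y ∈ U := by
      rintro x ⟨n, q, hq⟩
      refine ⟨n + 1, q, ?_⟩
      rw [pow_succ, Module.End.mul_apply, hinv, hq]
    rcases hstab U hU1 hU2 with h | h
    · refine ⟨Polynomial.X - 1, Polynomial.X_sub_C_ne_zero 1, y, hy, ?_⟩
      have : Polynomial.aeval (ρ g) (Polynomial.X - 1 : Polynomial C) y ∈ U := ⟨0, 1, by simp⟩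
      rw [h] at this
      simpa using this
    · obtain ⟨n, q, hq⟩ : y ∈ U := h ▸ Submodule.mem_top
      refine ⟨Polynomial.X ^ n - q * (Polynomial.X - 1), ?_, y, hy, ?_⟩
      -- At `X = 1` the polynomial takes the value `1`.
      · intro h0
        have := congrArg (Polynomial.eval 1) h0
        simp at this
      · rw [map_sub, LinearMap.sub_apply, ← hq]; simp
  have hz : ∃ z : C, ∀ y, ρ g y = z • y := by
    obtain ⟨r, hr, y, hy, hry⟩ := hann
    -- Over an algebraically closed field the annihilating polynomial splits, so some factor `g - z`
    -- is not invertible. Kernel and image of `z - g` are stable, and irreducibility then leaves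
    -- only `z - g = 0`.
    have hu : ¬ IsUnit (Polynomial.aeval (ρ g)
        (Multiset.map (fun x : C => Polynomial.X - Polynomial.C x) r.roots).prod) := by
      intro hu
      have hspl := (IsAlgClosed.splits r).eq_prod_roots
      rw [hspl, map_mul, Polynomial.aeval_C, Module.End.mul_apply] at hry
      rw [Module.algebraMap_end_apply, smul_eq_zero] at hry
      rcases hry with h | h
      · exact hr (Polynomial.leadingCoeff_eq_zero.1 h)
      · rw [Module.End.isUnit_iff] at hu
        exact hy (hu.1 (h.trans (map_zero _).symm))
    obtain ⟨z, hz, -⟩ := spectrum.exists_mem_of_not_isUnit_aeval_prod hu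
    refine ⟨z, ?_⟩
    rw [spectrum.mem_iff] at hz
    let E : Module.End C V := algebraMap C (Module.End C V) z - ρ g
    have hE : ∀ y, E y = z • y - ρ g y := fun y => rfl
    have hEg : ∀ y, E (ρ g y) = ρ g (E y) := fun y => by rw [hE, hE, map_sub, map_smul]
    have hEg' : ∀ y, E (ρ g⁻¹ y) = ρ g⁻¹ (E y) := fun y => by
      have : ρ g⁻¹ (ρ g y) = y := by
        rw [← Module.End.mul_apply, ← map_mul, inv_mul_cancel, map_one]; rfl
      rw [hE, hE, map_sub, map_smul, hinv, this]
    suffices hE0 : ∀ y, E y = 0 from fun y => (sub_eq_zero.1 ((hE y).symm.trans (hE0 y))).symm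
    rcases hstab (LinearMap.ker E) (fun y hy => by
      rw [LinearMap.mem_ker] at *; rw [hEg, hy, map_zero]) (fun y hy => by
      rw [LinearMap.mem_ker] at *; rw [hEg', hy, map_zero]) with h | h
    · rcases hstab (LinearMap.range E) (by rintro _ ⟨y, rfl⟩; exact ⟨_, hEg y⟩)
        (by rintro _ ⟨y, rfl⟩; exact ⟨_, hEg' y⟩) with h' | h'
      · intro y
        have : E y ∈ LinearMap.range E := ⟨y, rfl⟩
        rw [h'] at this
        simpa using this
      · exact absurd ((Module.End.isUnit_iff E).2
          ⟨LinearMap.ker_eq_bot.1 h, LinearMap.range_eq_top.1 h'⟩) hz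
    · intro y
      have : y ∈ LinearMap.ker E := h ▸ Submodule.mem_top
      exact this
  obtain ⟨z, hz⟩ := hz
  have hz0 : z ≠ 0 := by
    rintro rfl
    apply hy
    rw [← hinv y, hz, zero_smul]
  refine ⟨⟨Units.mk0 z hz0, hz⟩, y, hy, ?_⟩
  have hspan : Submodule.span C {y} = ⊥ ∨ Submodule.span C {y} = ⊤ := by
    refine hstab _ (fun x hx => ?_) (fun x hx => ?_)
    · rw [hz]; exact Submodule.smul_mem _ _ hx
    · have : ρ g⁻¹ x = z⁻¹ • x := by
        rw [eq_inv_smul_iff₀ hz0, ← hz, hinv]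
      rw [this]; exact Submodule.smul_mem _ _ hx
  rcases hspan with h | h
  · exact absurd (Submodule.span_singleton_eq_bot.1 h) hy
  · intro x
    have : x ∈ Submodule.span C {y} := h ▸ Submodule.mem_top
    obtain ⟨c, hc⟩ := Submodule.mem_span_singleton.1 this
    exact ⟨c, hc.symm⟩

end Scalar

/-! ### The stabilizer of `Ξ` and the universal property of the induced module -/

section Induced

variable {C : Type v} {k : Type u} [Field C] [Field k]

/-- A subalgebra containing the `T_t` and the `T_{sᵢ}` contains `𝓗^aff`. -/
theorem Haff_le (A : Subalgebra C (H C k)) (hz : ∀ x : Zk k, T C (zk x) ∈ A)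
    (hs : ∀ i, T C (sLift i) ∈ A) : Haff C k ≤ A := by
  have hT : ∀ n : ℕ, ∀ w : W1 k, (alc w).natAbs = n → w ∈ Waff1 k → T C w ∈ A := by
    intro n
    induction n with
    | zero =>
      intro w hw hw'
      obtain ⟨x, rfl⟩ := eq_zk hw' (by omega)
      exact hz x
    | succ n ih =>
      intro w hn hw
      obtain ⟨L, v, ⟨h1, h2, h3⟩, h4⟩ := exists_decomp _ w hn
      cases L with
      | nil => simp at h4
      | cons s L =>
        obtain ⟨x, i, rfl⟩ := h1 s (by simp)
        rw [List.prod_cons, mul_assoc] at h3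
        obtain ⟨y, hy⟩ : ∃ y, y = L.prod * v := ⟨_, rfl⟩
        rw [← hy] at h3
        have hyle : (alc y).natAbs ≤ n := by
          rw [hy]
          refine (alc_le L (fun s hs => h1 s (by simp [hs])) v h2).trans ?_
          simp at h4; omega
        have ha : alc w = (if i = 1 then -1 else 1) - alc y := by rw [h3]; exact alc_lift x i y
        have hyn : (alc y).natAbs = n := by
          split_ifs at ha <;> omega
        have hym : y ∈ Waff1 k := by
          have : y = (zk x * sLift i)⁻¹ * w := by rw [h3, inv_mul_cancel_left]
          rw [this]
          exact mul_mem (inv_mem (lift_mem x i)) hw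
        rw [h3, ← T_mul]
        · refine mul_mem ?_ (ih y hyn hym)
          rw [← T_mul_left (zk_mem_Omega1 x)]
          exact mul_mem (hz x) (hs i)
        · rw [len_eq, len_eq, len_eq, ← h3, hn, hyn, alc_lift']
          split_ifs <;> simp [add_comm]
  refine Algebra.adjoin_le ?_
  rintro _ ⟨w, hw, rfl⟩
  exact hT _ w rfl hw

theorem zk_conj (w : W1 k) (x : Zk k) : w * zk x * w⁻¹ = zk (mulAutArrow w.right x) := by
  rw [mul_inv_eq_iff_eq_mul]
  refine SemidirectProduct.ext ?_ ?_
  · funext j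
    rcases perm_cases w.right with h | h <;> fin_cases j <;>
      simp [h, zk, arr_zero, arr_one, -mulAutArrow_apply_apply, mul_comm]
  · simp [zk]

theorem exists_of_mem_Omega1 {v : W1 k} (hv : v ∈ Omega1 k) :
    ∃ (n : ℤ) (x : Zk k), v = omg ^ n * zk x := by
  have : (zk (k := k)).range.Normal := ⟨by
    rintro _ ⟨x, rfl⟩ g
    exact ⟨_, (zk_conj g x).symm⟩⟩
  obtain ⟨a, ha, b, hb, rfl⟩ := Subgroup.mem_sup_of_normal_right.1 hv
  obtain ⟨n, rfl⟩ := Subgroup.mem_zpowers_iff.1 ha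
  obtain ⟨x, rfl⟩ := hb
  exact ⟨n, x, rfl⟩

variable (Ξ : Haff C k →ₐ[C] C)

/-- Conjugation by `zk x` is conjugation by an invertible element of `𝓗^aff`, which a character with
values in a field does not see. -/
theorem zk_mem_Omega1Xi (x : Zk k) : zk x ∈ Omega1Xi Ξ := by
  refine ⟨zk_mem_Omega1 x, fun w hw => ?_⟩
  have h1 : (⟨T C (zk x * w * (zk x)⁻¹), T_mem_Haff (Waff1_conj hw _)⟩ : Haff C k)
      = ⟨T C (zk x), T_mem_Haff (zk_mem x)⟩ * ⟨T C w, T_mem_Haff hw⟩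
        * ⟨T C (zk x⁻¹), T_mem_Haff (zk_mem _)⟩ := by
    apply Subtype.ext
    change _ = T C _ * T C _ * T C _
    rw [T_mul_left (zk_mem_Omega1 x), T_mul_right (zk_mem_Omega1 _), map_inv]
  have h2 : (⟨T C (zk x⁻¹), T_mem_Haff (zk_mem _)⟩ : Haff C k)
      * ⟨T C (zk x), T_mem_Haff (zk_mem x)⟩ = 1 := by
    apply Subtype.ext
    change T C _ * T C _ = 1
    rw [T_zk_mul, inv_mul_cancel, map_one, T_one]
  rw [h1, map_mul, map_mul, mul_comm, ← mul_assoc, ← map_mul, h2, map_one, one_mul]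

theorem omg_sq_mem_Omega1Xi : omg * omg ∈ Omega1Xi Ξ := by
  refine ⟨mul_mem omg_mem omg_mem, fun w hw => ?_⟩
  congr 3
  rw [omg_sq_comm, mul_inv_cancel_right]

variable {Ξ}

/-- `ω²` and `Z_κ` always stabilize `Ξ`, so an odd power of `ω` in the stabilizer would bring `ω`
itself into it. -/
theorem exists_of_mem_Omega1Xi (hΞ : omg ∉ Omega1Xi Ξ) {v : W1 k} (hv : v ∈ Omega1Xi Ξ) :
    ∃ (n : ℤ) (x : Zk k), v = (omg * omg) ^ n * zk x := by
  obtain ⟨n, x, rfl⟩ := exists_of_mem_Omega1 hv.1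
  rcases Int.even_or_odd' n with ⟨m, rfl | rfl⟩
  · exact ⟨m, x, by rw [zpow_mul, zpow_two]⟩
  · refine absurd ?_ hΞ
    have h1 := mul_mem (zpow_mem (omg_sq_mem_Omega1Xi Ξ) (-m))
      (mul_mem hv (inv_mem (zk_mem_Omega1Xi Ξ x)))
    rw [mul_inv_cancel_right, zpow_add, zpow_mul, zpow_one, zpow_neg] at h1
    have h2 : (omg : W1 k) ^ (2 : ℤ) = omg * omg := zpow_two _
    rwa [h2, inv_mul_cancel_left] at h1

variable {V : Type t} [AddCommGroup V] [Module C V]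
  (ρ : Representation C (Omega1Xi Ξ)ᵐᵒᵖ V)

/-- The image of `h ⊗ y` in the induced module. -/
def indMk (h : H C k) (y : V) : Ind Ξ ρ := Submodule.Quotient.mk (h ⊗ₜ[C] y)

theorem op_smul_indMk (a h : H C k) (y : V) :
    op a • indMk ρ h y = indMk ρ (h * a) y := rfl

theorem indMk_mul (X : Haff C k) (v : Omega1Xi Ξ) (h : H C k) (y : V) :
    indMk ρ (((X : H C k) * T C (v : W1 k)) * h) y = indMk ρ h (Ξ X • ρ (op v) y) :=
  (Submodule.Quotient.eq _).2 (Submodule.subset_span ⟨X, v, h, y, rfl⟩)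

theorem indMk_smul (h : H C k) (c : C) (y : V) :
    indMk ρ h (c • y) = op (algebraMap C (H C k) c) • indMk ρ h y := by
  rw [op_smul_indMk, ← Algebra.commutes, ← Algebra.smul_def]
  exact congrArg _ (TensorProduct.tmul_smul c h y)

theorem ind_induction {P : Ind Ξ ρ → Prop} (h1 : ∀ h y, P (indMk ρ h y))
    (h2 : ∀ x y, P x → P y → P (x + y)) (x : Ind Ξ ρ) : P x := by
  obtain ⟨x, rfl⟩ := Submodule.Quotient.mk_surjective _ x
  induction x using TensorProduct.induction_on with
  | zero => simpa [indMk] using h1 0 0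
  | tmul h y => exact h1 h y
  | add x y hx hy => exact h2 _ _ hx hy

/-- The universal property of the induced module. -/
theorem exists_ind_hom {X : Type*} [AddCommGroup X] [Module (H C k)ᵐᵒᵖ X] [Module C X]
    [IsScalarTower C (H C k)ᵐᵒᵖ X] (g : V →ₗ[C] X)
    (hz : ∀ x y, op (T C (zk x) : H C k) • g y = Ξ ⟨T C (zk x), T_mem_Haff (zk_mem x)⟩ • g y)
    (hs : ∀ i y, op (T C (sLift i) : H C k) • g y = Ξ ⟨T C (sLift i), T_mem_Haff (sLift_mem i)⟩ • g y)
    (hv : ∀ (v : Omega1Xi Ξ) y, op (T C (v : W1 k) : H C k) • g y = g (ρ (op v) y)) :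
    ∃ G : Ind Ξ ρ →ₗ[(H C k)ᵐᵒᵖ] X, ∀ h y, G (indMk ρ h y) = op h • g y := by
  have hX : ∀ (X : Haff C k) y, op (X : H C k) • g y = Ξ X • g y := by
    -- `Ξ` is defined only on `𝓗^aff`, so membership there is part of the condition. Commutativity
    -- of `C` absorbs the reversal of products.
    let A : Subalgebra C (H C k) :=
      { carrier := {X | ∃ h : X ∈ Haff C k, ∀ y, op X • g y = Ξ ⟨X, h⟩ • g y}
        mul_mem' := by
          rintro a b ⟨ha, ha'⟩ ⟨hb, hb'⟩
          refine ⟨mul_mem ha hb, fun y => ?_⟩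
          have : (⟨a * b, mul_mem ha hb⟩ : Haff C k) = ⟨a, ha⟩ * ⟨b, hb⟩ := rfl
          rw [this, map_mul, MulOpposite.op_mul, mul_smul, ha', ← map_smul, hb', map_smul,
            smul_smul, mul_comm]
        add_mem' := by
          rintro a b ⟨ha, ha'⟩ ⟨hb, hb'⟩
          refine ⟨add_mem ha hb, fun y => ?_⟩
          have : (⟨a + b, add_mem ha hb⟩ : Haff C k) = ⟨a, ha⟩ + ⟨b, hb⟩ := rfl
          rw [this, map_add, MulOpposite.op_add, add_smul, ha', hb', add_smul]
        algebraMap_mem' := fun r => by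
          refine ⟨(Haff C k).algebraMap_mem r, fun y => ?_⟩
          have : (⟨algebraMap C (H C k) r, (Haff C k).algebraMap_mem r⟩ : Haff C k)
            = algebraMap C (Haff C k) r := rfl
          rw [this, AlgHom.commutes]
          exact algebraMap_smul (H C k)ᵐᵒᵖ r (g y) }
    have hA : Haff C k ≤ A := Haff_le A (fun x => ⟨_, hz x⟩) (fun i => ⟨_, hs i⟩)
    exact fun X => (hA X.2).2
  have : SMulCommClass C (H C k)ᵐᵒᵖ X := IsScalarTower.to_smulCommClass
  let F : H C k ⊗[C] V →ₗ[(H C k)ᵐᵒᵖ] X := TensorProduct.AlgebraTensorModule.lift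
    { toFun := fun h =>
        { toFun := fun y => op h • g y
          map_add' := by simp
          map_smul' := fun c y => by rw [map_smul, smul_comm]; rfl }
      map_add' := fun a b => by ext y; simp [add_smul]
      map_smul' := fun a b => by ext y; simp [mul_smul] }
  refine ⟨(indRel Ξ ρ).liftQ F ?_, fun h y => rfl⟩
  rw [indRel, Submodule.span_le]
  rintro _ ⟨X, v, h, y, rfl⟩
  rw [SetLike.mem_coe, LinearMap.mem_ker, map_sub, sub_eq_zero]
  change op ((X : H C k) * T C (v : W1 k) * h) • g y = op h • g (Ξ X • ρ (op v) y)
  rw [map_smul, ← hv, MulOpposite.op_mul, MulOpposite.op_mul, mul_smul, mul_smul, hX,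
    smul_comm (Ξ X)]

end Induced

section RowScalar

variable {C : Type v} [Field C] {A : Type a} [Ring A] [Algebra C A]
  {n : Type} [Fintype n] [DecidableEq n] (φ : A →ₐ[C] Matrix n n C)

instance : Module C (RowMod.{v, w, a} φ) := inferInstanceAs (Module C (ULift.{w} (n → C)))

theorem RowMod.smul_mk' (c : C) (x : n → C) :
    c • RowMod.mk.{v, w, a} φ x = RowMod.mk φ (c • x) := rfl

instance : IsScalarTower C Aᵐᵒᵖ (RowMod.{v, w, a} φ) where
  smul_assoc c x y := by
    obtain ⟨y, rfl⟩ := (RowMod.mk φ).surjective y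
    rw [RowMod.smul_mk, RowMod.smul_mk, RowMod.smul_mk', MulOpposite.unop_smul, map_smul,
      Matrix.vecMul_smul]

end RowScalar

/-! ### The induced module is standard when `ω` moves `Ξ` -/

section Structure

variable {C : Type v} {k : Type u} [Field C] [Field k] {Ξ : Haff C k →ₐ[C] C}
  {V : Type t} [AddCommGroup V] [Module C V] (ρ : Representation C (Omega1Xi Ξ)ᵐᵒᵖ V)
  {χ : Zk k →* Cˣ} {J : Set (Fin 2)}

open Classical in
theorem xi_sLift [Finite k] (h : IsXi χ J Ξ) (i : Fin 2) :
    Ξ ⟨T C (sLift i), T_mem_Haff (sLift_mem i)⟩ = if i ∈ J then 0 else kap χ := by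
  have h1 := h.2 1 i
  rw [chiC_eq_kap, map_one χ, Units.val_one, one_mul] at h1
  rw [← h1]
  exact congrArg Ξ (Subtype.ext (congrArg (T C) (by rw [map_one, one_mul])))

theorem indMk_haff (X : Haff C k) (h : H C k) (y : V) :
    indMk ρ ((X : H C k) * h) y = indMk ρ h (Ξ X • y) := by
  have := indMk_mul ρ X 1 h y
  rwa [Subgroup.coe_one, T_one, mul_one, MulOpposite.op_one, map_one, Module.End.one_apply] at this

theorem indMk_T (v : Omega1Xi Ξ) (h : H C k) (y : V) :
    indMk ρ (T C (v : W1 k) * h) y = indMk ρ h (ρ (op v) y) := by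
  have := indMk_mul ρ 1 v h y
  rwa [OneMemClass.coe_one, one_mul, map_one, one_smul] at this

theorem indMk_smul' (h : H C k) (c : C) (y : V) :
    indMk ρ h (c • y) = c • indMk ρ h y := by
  rw [indMk_smul, ← MulOpposite.algebraMap_apply, algebraMap_smul]

theorem indMk_zk (hΞ : IsXi χ J Ξ) (x : Zk k) (h : H C k) (y : V) :
    indMk ρ (T C (zk x) * h) y = (χ x : C) • indMk ρ h y := by
  rw [indMk_haff ρ ⟨T C (zk x), T_mem_Haff (zk_mem x)⟩ h y, hΞ.1, indMk_smul']

theorem indMk_sLift (i : Fin 2) (h : H C k) (y : V) :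
    indMk ρ (T C (sLift i) * h) y
      = Ξ ⟨T C (sLift i), T_mem_Haff (sLift_mem i)⟩ • indMk ρ h y := by
  rw [indMk_haff ρ ⟨T C (sLift i), T_mem_Haff (sLift_mem i)⟩ h y, indMk_smul']

theorem T_omg_s1 : T C (omg : W1 k) * T C s1 = T C (sLift 0) * T C omg := by
  rw [T_mul_left omg_mem, T_mul_right omg_mem, sLift_zero, inv_mul_cancel_right]

/-- When `V` is a line, the induced module is spanned by two vectors. -/
theorem mem_span_ind (hΞ : IsXi χ J Ξ) {z : Cˣ}
    (hz : ∀ y, ρ (op ⟨omg * omg, omg_sq_mem_Omega1Xi Ξ⟩) y = (z : C) • y) {y₀ : V}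
    (hy : ∀ y, ∃ c : C, y = c • y₀) (m : Ind Ξ ρ) :
    m ∈ Submodule.span C {indMk ρ 1 y₀, indMk ρ (T C omg) y₀} := by
  set N : Submodule C (Ind Ξ ρ) := Submodule.span C {indMk ρ 1 y₀, indMk ρ (T C omg) y₀}
  have h0 : indMk ρ 1 y₀ ∈ N := Submodule.subset_span (by simp)
  have h1 : indMk ρ (T C omg) y₀ ∈ N := Submodule.subset_span (by simp)
  -- Stability of `N` under `h` need only be tested on the two spanning vectors.
  have hgen : ∀ h, indMk ρ h y₀ ∈ N → indMk ρ (T C omg * h) y₀ ∈ N → ∀ m ∈ N, op h • m ∈ N := by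
    intro h e0 e1 m hm
    have : SMulCommClass (H C k)ᵐᵒᵖ C (Ind Ξ ρ) := IsScalarTower.to_smulCommClass'
    induction hm using Submodule.span_induction with
    | mem x hx =>
      rcases hx with rfl | rfl
      · rwa [op_smul_indMk, one_mul]
      · rwa [op_smul_indMk]
    | zero => rw [smul_zero]; exact zero_mem _
    | add x y _ _ hx hy => rw [smul_add]; exact add_mem hx hy
    | smul c x _ hx => rw [smul_comm]; exact N.smul_mem c hx
  let A : Subalgebra C (H C k) :=
    { carrier := {h | ∀ m ∈ N, op h • m ∈ N}
      mul_mem' := fun {a b} ha hb m hm => by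
        rw [MulOpposite.op_mul, mul_smul]; exact hb _ (ha _ hm)
      add_mem' := fun {a b} ha hb m hm => by
        rw [MulOpposite.op_add, add_smul]; exact add_mem (ha _ hm) (hb _ hm)
      algebraMap_mem' := fun r m hm => by
        rw [← MulOpposite.algebraMap_apply, algebraMap_smul]; exact N.smul_mem r hm }
  -- `T_{ω²}` passes through the tensor sign and acts on `V` by `z`, so no third vector is needed.
  have hωω : ∀ h, indMk ρ (T C omg * (T C omg * h)) y₀ = (z : C) • indMk ρ h y₀ := by
    intro h
    have := indMk_T ρ ⟨omg * omg, omg_sq_mem_Omega1Xi Ξ⟩ h y₀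
    rw [hz, indMk_smul', ← T_mul_left omg_mem, mul_assoc] at this
    exact this
  have hA : A = ⊤ := by
    refine eq_top_of_mem A (fun x => ?_) ?_ ?_ ?_
    · refine hgen _ ?_ ?_
      · rw [← mul_one (T C (zk x)), indMk_zk ρ hΞ]; exact N.smul_mem _ h0
      · rw [T_omg_zk, indMk_zk ρ hΞ]; exact N.smul_mem _ h1
    · refine hgen _ ?_ ?_
      · rw [← mul_one (T C s1), ← sLift_one, indMk_sLift]; exact N.smul_mem _ h0
      · rw [T_omg_s1, indMk_sLift]; exact N.smul_mem _ h1
    · refine hgen _ h1 ?_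
      have := hωω 1
      rw [mul_one] at this
      rw [this]; exact N.smul_mem _ h0
    · refine hgen _ ?_ ?_
      · have := hωω (T C omg⁻¹)
        rw [T_omg_inv_mul, mul_one] at this
        have h2 : indMk ρ (T C omg⁻¹) y₀ = ((z⁻¹ : Cˣ) : C) • indMk ρ (T C omg) y₀ := by
          rw [this, smul_smul, Units.inv_mul, one_smul]
        rw [h2]; exact N.smul_mem _ h1
      · rw [T_omg_inv_mul]; exact h0
  induction m using ind_induction with
  | h1 h y =>
    obtain ⟨c, rfl⟩ := hy y
    have : h ∈ A := hA ▸ Algebra.mem_top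
    have := this _ h0
    rw [op_smul_indMk, one_mul] at this
    rw [indMk_smul']; exact N.smul_mem c this
  | h2 x y hx hy => exact add_mem hx hy

/-- The elements of `Ω(1)_Ξ` with which a linear map is compatible. -/
def compatSubgroup {X : Type*} [AddCommGroup X] [Module (H C k)ᵐᵒᵖ X] (g : V →+ X) :
    Subgroup (Omega1Xi Ξ) where
  carrier := {v | ∀ y, op (T C (v : W1 k) : H C k) • g y = g (ρ (op v) y)}
  mul_mem' {a b} ha hb y := by
    rw [Subgroup.coe_mul, ← T_mul_left a.2.1, MulOpposite.op_mul, mul_smul, ha, hb,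
      MulOpposite.op_mul, map_mul]
    rfl
  one_mem' y := by
    rw [Subgroup.coe_one, T_one, MulOpposite.op_one, one_smul, MulOpposite.op_one, map_one]
    rfl
  inv_mem' {a} ha y := by
    obtain ⟨y, rfl⟩ : ∃ y', y = ρ (op a) y' := ⟨ρ (op a⁻¹) y, by
      rw [← Module.End.mul_apply, ← map_mul, ← MulOpposite.op_mul, inv_mul_cancel,
        MulOpposite.op_one, map_one]; rfl⟩
    rw [← ha, ← mul_smul, ← MulOpposite.op_mul, Subgroup.coe_inv, T_mul_left a.2.1,
      mul_inv_cancel, T_one, MulOpposite.op_one, one_smul, ← Module.End.mul_apply, ← map_mul,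
      ← MulOpposite.op_mul, mul_inv_cancel, MulOpposite.op_one, map_one]
    rfl

variable [Finite k] (hq : (Nat.card k : C) = 0)

/-- If `ω` does not fix `Ξ`, the induced module is two-dimensional; it is identified with a standard
module once the latter contains a suitable eigenvector. -/
theorem exists_ind_equiv [IsAlgClosed C] (hΞ : IsXi χ J Ξ) (hω : omg ∉ Omega1Xi Ξ)
    (hρ : ρ.IsIrreducible) (hV : RestrictsTo χ ρ) (r : Fin 2 → C)
    (hr : ∀ z : Cˣ, Function.Bijective fun q : C × C =>
      q.1 • r + q.2 • Matrix.vecMul r !![0, 1; (z : C), 0])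
    (hrz : ∀ z x, Matrix.vecMul r (stdHom hq χ z (T C (zk x))) = (χ x : C) • r)
    (hrs : ∀ z i, Matrix.vecMul r (stdHom hq χ z (T C (sLift i)))
      = Ξ ⟨T C (sLift i), T_mem_Haff (sLift_mem i)⟩ • r) :
    ∃ z : Cˣ, Nonempty (Ind Ξ ρ ≃ₗ[(H C k)ᵐᵒᵖ] RowMod.{v, w} (stdHom hq χ z)) := by
  -- The stabilizer is `⟨ω²⟩ Z_κ` with `Z_κ` acting by scalars, so `V` is a line on which `ω²` acts
  -- by some `z`.
  obtain ⟨⟨z, hz⟩, y₀, hy₀, hy⟩ := exists_generator_of_isIrreducible ρ hρ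
    (op ⟨omg * omg, omg_sq_mem_Omega1Xi Ξ⟩) (fun x => by
      obtain ⟨n, y, hxy⟩ := exists_of_mem_Omega1Xi hω x.unop.2
      refine ⟨χ y, n, ?_⟩
      have hx : x = op ⟨zk y, zk_mem_Omega1Xi Ξ y⟩
          * (op ⟨omg * omg, omg_sq_mem_Omega1Xi Ξ⟩) ^ n := by
        rw [← MulOpposite.op_zpow, ← MulOpposite.op_mul, ← MulOpposite.op_unop x]
        congr 1
        exact Subtype.ext hxy
      rw [hx, map_mul]
      refine LinearMap.ext fun y' => ?_
      exact hV y (zk_mem_Omega1Xi Ξ y) _)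
  refine ⟨z, ?_⟩
  let e : C ≃ₗ[C] V := LinearEquiv.ofBijective (LinearMap.toSpanSingleton C V y₀)
    ⟨fun a b h => smul_left_injective C hy₀ h, fun y => by
      obtain ⟨c, hc⟩ := hy y
      exact ⟨c, hc.symm⟩⟩
  let X := RowMod.{v, w} (stdHom hq χ z)
  let g : V →ₗ[C] X := (LinearMap.toSpanSingleton C X (RowMod.mk _ r)).comp e.symm.toLinearMap
  have hg0 : g y₀ = RowMod.mk _ r := by
    have : e.symm y₀ = 1 := by
      rw [LinearEquiv.symm_apply_eq]
      exact (one_smul C y₀).symm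
    change e.symm y₀ • RowMod.mk _ r = _
    rw [this, one_smul]
  have hg : ∀ (h : H C k) (c : C) y, Matrix.vecMul r (stdHom hq χ z h) = c • r →
      op h • g y = c • g y := by
    intro h c y hc
    have : SMulCommClass (H C k)ᵐᵒᵖ C X := IsScalarTower.to_smulCommClass'
    change op h • (e.symm y • RowMod.mk _ r) = c • (e.symm y • RowMod.mk _ r)
    rw [smul_comm, smul_comm c, RowMod.op_smul, hc]
    rfl
  have hcompat : compatSubgroup ρ g.toAddMonoidHom = ⊤ := by
    refine eq_top_iff.2 fun v _ => ?_
    obtain ⟨n, x, hv⟩ := exists_of_mem_Omega1Xi hω v.2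
    have hv' : v = (⟨omg * omg, omg_sq_mem_Omega1Xi Ξ⟩ : Omega1Xi Ξ) ^ n
        * ⟨zk x, zk_mem_Omega1Xi Ξ x⟩ := Subtype.ext hv
    rw [hv']
    refine mul_mem (zpow_mem (fun y => ?_) n) (fun y => ?_)
    · change op (T C (omg * omg) : H C k) • g y = g _
      rw [hz, map_smul, ← T_mul_left omg_mem]
      refine hg _ _ y ?_
      rw [stdHom_omg_sq]
      simp [Matrix.vecMul_smul]
    · change op (T C (zk x) : H C k) • g y = g _
      rw [hV, map_smul]
      exact hg _ _ y (hrz z x)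
  -- Frobenius reciprocity for the map sending `y₀` to the eigenvector `r`. The two vectors that
  -- span the induced module go to `r` and its image under `T_ω`, a basis by `hr`; this gives
  -- injectivity and surjectivity at once.
  obtain ⟨G, hG⟩ := exists_ind_hom ρ g (fun x y => hg _ _ y ((hrz z x).trans (by rw [hΞ.1])))
    (fun i y => hg _ _ y (hrs z i)) (fun v y => by
      have : v ∈ compatSubgroup ρ g.toAddMonoidHom := hcompat ▸ Subgroup.mem_top v
      exact this y)
  have hGs : ∀ (c : C) m, G (c • m) = c • G m := fun c m => by
    rw [← algebraMap_smul (H C k)ᵐᵒᵖ c m, map_smul, algebraMap_smul]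
  have hG2 : ∀ c d : C, G (c • indMk ρ 1 y₀ + d • indMk ρ (T C omg) y₀)
      = RowMod.mk _ (c • r + d • Matrix.vecMul r !![0, 1; (z : C), 0]) := by
    intro c d
    rw [map_add, hGs, hGs, hG, hG, hg0, MulOpposite.op_one, one_smul, RowMod.op_smul, stdHom_omg]
    rfl
  refine ⟨LinearEquiv.ofBijective G ⟨?_, ?_⟩⟩
  · rw [injective_iff_map_eq_zero]
    intro m hm
    obtain ⟨c, d, rfl⟩ := Submodule.mem_span_pair.1 (mem_span_ind ρ hΞ hz hy m)
    rw [hG2, EmbeddingLike.map_eq_zero_iff] at hm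
    have := (hr z).1 (a₁ := (c, d)) (a₂ := (0, 0)) (by simpa using hm)
    rw [Prod.mk.injEq] at this
    rw [this.1, this.2, zero_smul, zero_smul, add_zero]
  · intro x
    obtain ⟨x, rfl⟩ := (RowMod.mk _).surjective x
    obtain ⟨⟨c, d⟩, hcd⟩ := (hr z).2 x
    exact ⟨_, (hG2 c d).trans (congrArg _ hcd)⟩

end Structure

/-! ### Excluding the characters fixed by `ω` when `χ₁ = χ₂` -/

section Supersingular

variable {C : Type v} {k : Type u} [Field C] [Field k] {Ξ : Haff C k →ₐ[C] C}
  {V : Type t} [AddCommGroup V] [Module C V] (ρ : Representation C (Omega1Xi Ξ)ᵐᵒᵖ V)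
  {χ : Zk k →* Cˣ} {J : Set (Fin 2)}

theorem inl_conj (g : W1 k) (x : Fin 2 → Multiplicative ℤ × kˣ) :
    g * SemidirectProduct.inl x * g⁻¹ = SemidirectProduct.inl (mulAutArrow g.right x) := by
  rw [mul_inv_eq_iff_eq_mul]
  refine SemidirectProduct.ext ?_ ?_
  · funext j
    rcases perm_cases g.right with h | h <;> fin_cases j <;>
      simp [h, arr_zero, arr_one, -mulAutArrow_apply_apply, mul_comm]
  · simp

theorem omg_sLift (i : Fin 2) : omg * sLift i * omg⁻¹ = (sLift (1 - i) : W1 k) := by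
  fin_cases i
  · change omg * sLift 0 * omg⁻¹ = sLift 1
    rw [sLift_zero, sLift_one, ← mul_assoc, ← mul_assoc, omg_sq_comm, ← mul_assoc,
      mul_inv_cancel_right, mul_inv_cancel_right]
  · change omg * sLift 1 * omg⁻¹ = sLift 0
    rw [sLift_zero, sLift_one]

theorem T_conj_omg (w : W1 k) : T C omg * T C w * T C omg⁻¹ = T C (omg * w * omg⁻¹) := by
  rw [T_mul_left omg_mem, T_mul_right (inv_mem omg_mem)]

/-- Conjugation by `ω` exchanges `s₀` with `s₁` and swaps the coordinates of `Z_κ`, so it fixes the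
values of `Ξ` at generators of `𝓗^aff`; elements where both characters agree form a subalgebra. -/
theorem omg_mem_Omega1Xi (hΞ : IsXi χ J Ξ) (hχ : ∀ x, χ (sw x) = χ x) {c : C}
    (hc : ∀ i, Ξ ⟨T C (sLift i), T_mem_Haff (sLift_mem i)⟩ = c) : omg ∈ Omega1Xi Ξ := by
  refine ⟨omg_mem, fun w hw => ?_⟩
  have hmul : ∀ a b : H C k, T C omg * (a * b) * T C omg⁻¹
      = (T C omg * a * T C omg⁻¹) * (T C omg * b * T C omg⁻¹) := by
    intro a b
    have : ∀ x : H C k, T C omg⁻¹ * (T C omg * x) = x := fun x => by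
      rw [← mul_assoc, T_inv_omg_mul, one_mul]
    simp only [mul_assoc, this]
  let A : Subalgebra C (H C k) :=
    { carrier := {X | ∃ (h : X ∈ Haff C k) (h' : T C omg * X * T C omg⁻¹ ∈ Haff C k),
        Ξ ⟨_, h'⟩ = Ξ ⟨X, h⟩}
      mul_mem' := by
        rintro a b ⟨ha, ha', ea⟩ ⟨hb, hb', eb⟩
        refine ⟨mul_mem ha hb, hmul a b ▸ mul_mem ha' hb', ?_⟩
        have h1 : (⟨a * b, mul_mem ha hb⟩ : Haff C k) = ⟨a, ha⟩ * ⟨b, hb⟩ := rfl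
        have h2 : (⟨T C omg * (a * b) * T C omg⁻¹, hmul a b ▸ mul_mem ha' hb'⟩ : Haff C k)
          = ⟨_, ha'⟩ * ⟨_, hb'⟩ := Subtype.ext (hmul a b)
        rw [h1, h2, map_mul, map_mul, ea, eb]
      add_mem' := by
        rintro a b ⟨ha, ha', ea⟩ ⟨hb, hb', eb⟩
        have hadd : T C omg * (a + b) * T C omg⁻¹
          = T C omg * a * T C omg⁻¹ + T C omg * b * T C omg⁻¹ := by rw [mul_add, add_mul]
        refine ⟨add_mem ha hb, hadd ▸ add_mem ha' hb', ?_⟩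
        have h1 : (⟨a + b, add_mem ha hb⟩ : Haff C k) = ⟨a, ha⟩ + ⟨b, hb⟩ := rfl
        have h2 : (⟨T C omg * (a + b) * T C omg⁻¹, hadd ▸ add_mem ha' hb'⟩ : Haff C k)
          = ⟨_, ha'⟩ + ⟨_, hb'⟩ := Subtype.ext hadd
        rw [h1, h2, map_add, map_add, ea, eb]
      algebraMap_mem' := fun r => by
        have hr : T C omg * algebraMap C (H C k) r * T C omg⁻¹ = algebraMap C (H C k) r := by
          rw [← Algebra.commutes, mul_assoc, T_omg_inv_mul, mul_one]
        have h := (Haff C k).algebraMap_mem r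
        exact ⟨h, hr.symm ▸ h, congrArg Ξ (Subtype.ext hr)⟩ }
  have hA : Haff C k ≤ A := by
    refine Haff_le A (fun x => ?_) (fun i => ?_)
    · have h1 : T C omg * T C (zk x) * T C omg⁻¹ = T C (zk (sw x)) := by
        rw [T_conj_omg, zk_conj, omg_right]
      refine ⟨T_mem_Haff (zk_mem x), h1 ▸ T_mem_Haff (zk_mem _), ?_⟩
      exact (congrArg Ξ (Subtype.ext h1)).trans (by rw [hΞ.1 (sw x), hΞ.1, hχ])
    · have h1 : T C omg * T C (sLift i : W1 k) * T C omg⁻¹ = T C (sLift (1 - i)) := by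
        rw [T_conj_omg, omg_sLift]
      refine ⟨T_mem_Haff (sLift_mem i), h1 ▸ T_mem_Haff (sLift_mem _), ?_⟩
      exact (congrArg Ξ (Subtype.ext h1)).trans ((hc _).trans (hc i).symm)
  obtain ⟨_, _, h⟩ := hA (T_mem_Haff hw)
  exact (congrArg Ξ (Subtype.ext (T_conj_omg w).symm)).trans h

theorem omg_notMem_of_zk (hΞ : IsXi χ J Ξ) (hχ : ¬ ∀ x, χ (sw x) = χ x) :
    omg ∉ Omega1Xi Ξ := by
  refine fun h => hχ fun x => Units.ext ?_
  rw [← hΞ.1, ← hΞ.1, ← h.2 _ (zk_mem x)]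
  exact congrArg Ξ (Subtype.ext (congrArg (T C) (by rw [zk_conj, omg_right])))

theorem omg_notMem_of_sLift (h : Ξ ⟨T C (sLift 0), T_mem_Haff (sLift_mem 0)⟩
      ≠ Ξ ⟨T C (sLift 1), T_mem_Haff (sLift_mem 1)⟩) : omg ∉ Omega1Xi Ξ := by
  refine fun h' => h ?_
  rw [← h'.2 _ (sLift_mem 1)]
  exact congrArg Ξ (Subtype.ext (congrArg (T C) (omg_sLift 1).symm))

/-- The translation by `(0, 1)`. -/
def transVec : Fin 2 → Multiplicative ℤ × kˣ := Pi.mulSingle 1 (Multiplicative.ofAdd 1, 1)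

theorem inl_transVec : SemidirectProduct.inl transVec = (s1 * omg : W1 k) := by
  refine SemidirectProduct.ext ?_ ?_
  · funext j
    fin_cases j <;> simp [transVec, s1, omg, arr_zero, arr_one, -mulAutArrow_apply_apply]
  · simp [s1, omg]

theorem s1_mul_self : (s1 * s1 : W1 k) = 1 := by
  refine SemidirectProduct.ext ?_ ?_ <;> simp [s1]

theorem inl_swap_transVec :
    SemidirectProduct.inl (mulAutArrow (Equiv.swap 0 1 : Equiv.Perm (Fin 2)) transVec)
      = (omg * s1 : W1 k) := by
  have h := inl_conj (s1 : W1 k) transVec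
  rw [inl_transVec, ← mul_assoc, s1_mul_self, one_mul] at h
  refine h.symm.trans ?_
  rw [inv_eq_of_mul_eq_one_left s1_mul_self]

theorem conjugatesOf_s1_omg : conjugatesOf (s1 * omg : W1 k) = {s1 * omg, omg * s1} := by
  ext μ
  change IsConj _ _ ↔ _
  rw [isConj_iff, Set.mem_insert_iff, Set.mem_singleton_iff,
    ← inl_swap_transVec, ← inl_transVec]
  constructor
  · rintro ⟨g, rfl⟩
    rw [inl_conj]
    rcases perm_cases g.right with h | h
    · left; rw [h, map_one, MulAut.one_apply]
    · right; rw [h]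
  · rintro (rfl | rfl)
    · exact ⟨1, by simp⟩
    · exact ⟨s1, inl_conj s1 transVec⟩

theorem dd_s1_omg : dd (s1 * omg : W1 k) = -1 := by
  rw [← inl_transVec]; simp [dd, transVec]

theorem dd_omg_s1 : dd (omg * s1 : W1 k) = 1 := by
  rw [← inl_swap_transVec]
  simp [dd, transVec, arr_zero, arr_one, -mulAutArrow_apply_apply]

/-- The class of the translation `s₁ω` by `(0, 1)` has one other member, `ωs₁`. The two have
valuation differences `-1` and `1`, so one contributes `T` and the other `T*`. -/
theorem zElt_s1_omg : zElt C (s1 * omg : W1 k) = T C s1 * T C omg + Tstar C (omg * s1) := by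
  rw [zElt, conjugatesOf_s1_omg, finsum_mem_pair, Eo, Eo, dd_s1_omg, dd_omg_s1,
    if_pos (by norm_num), if_neg (by norm_num), T_mul_right omg_mem]
  intro h
  have := congrArg dd h
  rw [dd_s1_omg, dd_omg_s1] at this
  norm_num at this

theorem s1_omg_mem : (s1 * omg : W1 k) ∈ Lam1 k := by
  rw [← inl_transVec]; simp [Lam1]

theorem len_s1_omg : len (s1 * omg : W1 k) = 1 := by
  have h : (s1 * omg : W1 k).right = 1 := by rw [← inl_transVec]; simp
  rw [len_eq, alc, if_pos h, dd_s1_omg]; rfl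

theorem len_omg_s1 : len (omg * s1 : W1 k) = 1 := by
  have h : (omg * s1 : W1 k).right = 1 := by rw [← inl_swap_transVec]; simp
  rw [len_eq, alc, if_pos h, dd_omg_s1]; rfl

/-- In length one `Tstar` is a single factor times `T_u`. The form suffices whatever decomposition
was chosen, so independence of the choice is not needed. -/
theorem exists_Tstar_of_len_eq_one {w : W1 k} (hw : len w = 1) :
    ∃ (x : Zk k) (i : Fin 2) (u : W1 k), u ∈ Omega1 k ∧ w = zk x * sLift i * u ∧
      Tstar C w = (T C (zk x * sLift i) - cH C (zk x * sLift i)) * T C u := by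
  obtain ⟨⟨h1, h2, h3⟩, h4⟩ := (exists_reduced w).choose_spec
  obtain ⟨s, hs⟩ := List.length_eq_one_iff.1 (h4.trans hw)
  obtain ⟨x, i, rfl⟩ := h1 s (by rw [hs]; simp)
  refine ⟨x, i, _, h2, by simpa [hs] using h3, ?_⟩
  rw [Tstar, hs]
  simp

variable [Finite k] (hq : (Nat.card k : C) = 0)

/-- The datum of a module on which `T_{s₀}` and `T_{s₁}` act through the same scalar `c`. -/
def scalarDatum (χ : Zk k →* Cˣ) (hχ : ∀ x, χ (sw x) = χ x) (c : C) (hc : c * c = kap χ * c)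
    {B : Type*} [Ring B] [Algebra C B] (o : Bˣ) : Datum C k B where
  t := (algebraMap C B : C →* B).comp ((Units.coeHom C).comp χ)
  o := o
  S := algebraMap C B c
  o_t x := by
    simp only [MonoidHom.comp_apply, hχ]
    exact (Algebra.commutes _ _).symm
  S_t x := by
    simp only [MonoidHom.comp_apply, hχ]
    exact (Algebra.commutes _ _).symm
  S_S := by
    have := Fintype.ofFinite kˣ
    rw [← map_mul, hc, map_mul, kap, finsum_eq_sum_of_fintype, finsum_eq_sum_of_fintype, map_sum]
    rfl
  o_S := (Algebra.commutes _ _).symm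

section Scalar

variable (χ : Zk k →* Cˣ) (hχ : ∀ x, χ (sw x) = χ x) (c : C) (hc : c * c = kap χ * c)
  {B : Type*} [Ring B] [Algebra C B] (o : Bˣ)

/-- The homomorphism to which `scalarDatum` gives rise. -/
def scalarHom : H C k →ₐ[C] B := (scalarDatum χ hχ c hc o).lift hq

theorem scalarHom_zk (x : Zk k) :
    scalarHom hq χ hχ c hc o (T C (zk x)) = algebraMap C B (χ x) := Datum.lift_zk _ hq x

theorem scalarHom_sLift (i : Fin 2) :
    scalarHom hq χ hχ c hc o (T C (sLift i)) = algebraMap C B c := by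
  refine (Datum.lift_T _ hq _).trans ?_
  rw [Datum.tau_sLift, Datum.Si]
  split_ifs
  · rfl
  · change (o : B) * algebraMap C B c * (↑o⁻¹ : B) = algebraMap C B c
    rw [← Algebra.commutes, mul_assoc, Units.mul_inv, mul_one]

theorem scalarHom_omg : scalarHom hq χ hχ c hc o (T C omg) = o := Datum.lift_omg _ hq

theorem isUnit_scalarHom {v : W1 k} (hv : v ∈ Omega1 k) :
    IsUnit (scalarHom hq χ hχ c hc o (T C v)) := by
  refine IsUnit.map _ ⟨⟨T C v, T C v⁻¹, ?_, ?_⟩, rfl⟩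
  · rw [T_mul_left hv, mul_inv_cancel, T_one]
  · rw [T_mul_right hv, inv_mul_cancel, T_one]

/-- One of the two terms of `z_𝒪` vanishes and the other is a unit: for `c = 0` what remains is
`-χ(x) kap χ` times the image of `T_u`, for `c = kap χ` it is `kap χ` times the image of `T_ω`. -/
theorem isUnit_scalarHom_zElt (hc' : c = 0 ∨ c = kap χ) :
    IsUnit (scalarHom hq χ hχ c hc o (zElt C (s1 * omg))) := by
  have hk := kap_ne_zero hq χ hχ
  obtain ⟨x, i, u, hu, -, h⟩ := exists_Tstar_of_len_eq_one (C := C) (len_omg_s1 (k := k))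
  have h1 : scalarHom hq χ hχ c hc o (T C (zk x * sLift i)) = algebraMap C B (χ x * c) := by
    rw [← T_mul_left (zk_mem_Omega1 x), map_mul, scalarHom_zk, scalarHom_sLift, map_mul]
  have h2 : scalarHom hq χ hχ c hc o (cH C (zk x * sLift i)) = algebraMap C B (χ x * kap χ) := by
    have := Fintype.ofFinite kˣ
    rw [← chiC_eq_kap χ x i, cH, chiC, finsum_eq_sum_of_fintype, finsum_eq_sum_of_fintype,
      map_sum, map_sum]
    exact Finset.sum_congr rfl fun v _ => scalarHom_zk ..
  rw [zElt_s1_omg, h, map_add, map_mul, map_mul, map_sub, h1, h2, ← sLift_one, scalarHom_sLift,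
    scalarHom_omg]
  rcases hc' with rfl | rfl
  · rw [mul_zero, map_zero, zero_mul, zero_add, zero_sub]
    refine IsUnit.mul ?_ (isUnit_scalarHom hq χ hχ _ hc o hu)
    exact ((IsUnit.mk0 _ (mul_ne_zero (χ x).ne_zero hk)).map (algebraMap C B)).neg
  · rw [sub_self, zero_mul, add_zero]
    exact ((IsUnit.mk0 _ hk).map (algebraMap C B)).mul o.isUnit

end Scalar

include hq in
/-- If `Ξ` takes the same value at `T_{s₀}` and `T_{s₁}`, and `χ` is symmetric, then the induced
module is not supersingular. -/
theorem not_isSupersingular (hΞ : IsXi χ J Ξ) (hρ : ρ.IsIrreducible) (hV : RestrictsTo χ ρ)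
    (hχ : ∀ x, χ (sw x) = χ x) {c : C} (hc : c = 0 ∨ c = kap χ)
    (hs : ∀ i, Ξ ⟨T C (sLift i), T_mem_Haff (sLift_mem i)⟩ = c) :
    ¬ IsSupersingular C k (Ind Ξ ρ) := by
  rintro ⟨n, -, hn⟩
  have hω := omg_mem_Omega1Xi hΞ hχ hs
  have hcc : c * c = kap χ * c := by rcases hc with rfl | rfl <;> simp
  have hinv : ∀ a : Omega1Xi Ξ, ρ (op a) * ρ (op a⁻¹) = 1 := fun a => by
    rw [← map_mul, ← MulOpposite.op_mul, inv_mul_cancel, MulOpposite.op_one, map_one]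
  -- As `ω` stabilizes `Ξ`, the space `V` itself becomes an `𝓗`-module: `T_ω` acts through `ρ` and
  -- both `T_{sᵢ}` by `c`. The opposite of `End V` accounts for right modules.
  let o : ((Module.End C V)ᵐᵒᵖ)ˣ := ⟨op (ρ (op ⟨omg, hω⟩)), op (ρ (op ⟨omg, hω⟩⁻¹)),
    by
      have := hinv (⟨omg, hω⟩⁻¹)
      rw [inv_inv] at this
      rw [← MulOpposite.op_mul, this, MulOpposite.op_one],
    by rw [← MulOpposite.op_mul, hinv, MulOpposite.op_one]⟩
  let Φ := scalarHom hq χ hχ c hcc o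
  let _ : Module (H C k)ᵐᵒᵖ V :=
    { smul := fun h y => (Φ h.unop).unop y
      one_smul := fun y => by change (Φ 1).unop y = y; rw [map_one]; rfl
      mul_smul := fun a b y => by
        change (Φ (b.unop * a.unop)).unop y = (Φ a.unop).unop ((Φ b.unop).unop y)
        rw [map_mul]; rfl
      smul_zero := fun a => map_zero (Φ a.unop).unop
      smul_add := fun a => map_add (Φ a.unop).unop
      add_smul := fun a b y => by
        change (Φ (a.unop + b.unop)).unop y = (Φ a.unop).unop y + (Φ b.unop).unop y
        rw [map_add]; rfl
      zero_smul := fun y => by change (Φ 0).unop y = 0; rw [map_zero]; rfl }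
  have hact : ∀ (h : H C k) (y : V), op h • y = (Φ h).unop y := fun _ _ => rfl
  have hscal : ∀ (h : H C k) (b : C) (y : V), Φ h = algebraMap C _ b → op h • y = b • y := by
    intro h b y hb
    rw [hact, hb]; rfl
  have : IsScalarTower C (H C k)ᵐᵒᵖ V := ⟨fun b h y => by
    change (Φ (b • h.unop)).unop y = b • (Φ h.unop).unop y
    rw [map_smul]; rfl⟩
  have hcompat : ∀ v : Omega1Xi Ξ, v ∈ compatSubgroup ρ (AddMonoidHom.id V) := by
    intro v
    obtain ⟨m, x, hv⟩ := exists_of_mem_Omega1 v.2.1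
    have hv' : v = (⟨omg, hω⟩ : Omega1Xi Ξ) ^ m * ⟨zk x, zk_mem_Omega1Xi Ξ x⟩ := Subtype.ext hv
    rw [hv']
    refine mul_mem (zpow_mem (fun y => ?_) m) (fun y => ?_)
    · exact congrArg (fun f : (Module.End C V)ᵐᵒᵖ => f.unop y) (scalarHom_omg hq χ hχ c hcc o)
    · exact (hscal _ _ y (scalarHom_zk ..)).trans (hV x _ y).symm
  -- The identity of `V` extends to a map from the induced module onto `V`. A power of `z_𝒪` that
  -- kills the source kills `V`, although it acts invertibly there and `V ≠ 0`.
  obtain ⟨G, hG⟩ := exists_ind_hom ρ (LinearMap.id : V →ₗ[C] V)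
    (fun x y => hscal _ _ y ((scalarHom_zk ..).trans (by rw [hΞ.1])))
    (fun i y => hscal _ _ y ((scalarHom_sLift ..).trans (by rw [hs])))
    (fun v y => hcompat v y)
  obtain ⟨y, hy⟩ := exists_ne_zero_of_isIrreducible hρ
  have h0 := congrArg G (hn _ s1_omg_mem (by rw [len_s1_omg]; exact one_pos) (indMk ρ 1 y))
  rw [map_smul, hG, MulOpposite.op_one, one_smul, map_zero, hact, map_pow] at h0
  have hu := (isUnit_scalarHom_zElt hq χ hχ c hcc o hc).pow n
  have hu' : IsUnit (Φ (zElt C (s1 * omg)) ^ n).unop := hu.unop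
  exact hy (((Module.End.isUnit_iff _).1 hu').1 (h0.trans (map_zero _).symm))

end Supersingular

/-! ### Identification of the supersingular modules -/

section Classification

variable {C : Type v} {k : Type u} [Field C] [Field k] [IsAlgClosed C] [Finite k]
  (hq : (Nat.card k : C) = 0) {Ξ : Haff C k →ₐ[C] C}
  {V : Type t} [AddCommGroup V] [Module C V] (ρ : Representation C (Omega1Xi Ξ)ᵐᵒᵖ V)
  {χ : Zk k →* Cˣ} {J : Set (Fin 2)}

omit [IsAlgClosed C] in
theorem stdHom_sLift_zero (χ : Zk k →* Cˣ) (z : Cˣ) :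
    stdHom hq χ z (T C (sLift 0)) = !![0, 0; 0, kap χ] := by
  refine (Datum.lift_T _ hq _).trans ?_
  rw [Datum.tau_sLift]
  simp [Datum.Si, stdDatum, vec_zero, mul_comm (z : C)]

/-- The first basis vector of the standard module is the required eigenvector: `Z_κ` acts on it by
`χ`, `T_{s₀}` by `0` and `T_{s₁}` by `kap χ`. No symmetry of `χ` enters, so this also serves the
case `kap χ = 0`. -/
theorem exists_ind_equiv_left (hΞ : IsXi χ J Ξ) (hω : omg ∉ Omega1Xi Ξ) (hρ : ρ.IsIrreducible)
    (hV : RestrictsTo χ ρ) (h0 : Ξ ⟨T C (sLift 0), T_mem_Haff (sLift_mem 0)⟩ = 0)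
    (h1 : Ξ ⟨T C (sLift 1), T_mem_Haff (sLift_mem 1)⟩ = kap χ) :
    ∃ z : Cˣ, Nonempty (Ind Ξ ρ ≃ₗ[(H C k)ᵐᵒᵖ] RowMod.{v, w} (stdHom hq χ z)) := by
  refine exists_ind_equiv ρ hq hΞ hω hρ hV ![1, 0] (fun z => ?_) (fun z x => ?_) (fun z i => ?_)
  · constructor
    · rintro ⟨a, b⟩ ⟨c, d⟩ h
      have e0 := congrFun h 0
      have e1 := congrFun h 1
      simp at e0 e1
      rw [e0, e1]
    · intro y
      refine ⟨(y 0, y 1), ?_⟩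
      funext j
      fin_cases j <;> simp
  · rw [stdHom_zk]
    funext j
    fin_cases j <;> simp [Matrix.vecMul, dotProduct]
  · fin_cases i
    · change Matrix.vecMul _ (stdHom hq χ z (T C (sLift 0))) = _
      rw [stdHom_sLift_zero]
      refine Eq.trans ?_ (congrArg (· • ![(1 : C), 0]) h0.symm)
      funext j
      fin_cases j <;> simp [Matrix.vecMul, dotProduct]
    · change Matrix.vecMul _ (stdHom hq χ z (T C (sLift 1))) = _
      rw [sLift_one, stdHom_s1]
      refine Eq.trans ?_ (congrArg (· • ![(1 : C), 0]) h1.symm)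
      funext j
      fin_cases j <;> simp [Matrix.vecMul, dotProduct]

/-- Here the eigenvector is the second basis vector. `Z_κ` acts on it by the swap of `χ`, whence the
symmetry condition. -/
theorem exists_ind_equiv_right (hΞ : IsXi χ J Ξ) (hω : omg ∉ Omega1Xi Ξ) (hρ : ρ.IsIrreducible)
    (hV : RestrictsTo χ ρ) (hχ : ∀ x, χ (sw x) = χ x)
    (h0 : Ξ ⟨T C (sLift 0), T_mem_Haff (sLift_mem 0)⟩ = kap χ)
    (h1 : Ξ ⟨T C (sLift 1), T_mem_Haff (sLift_mem 1)⟩ = 0) :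
    ∃ z : Cˣ, Nonempty (Ind Ξ ρ ≃ₗ[(H C k)ᵐᵒᵖ] RowMod.{v, w} (stdHom hq χ z)) := by
  refine exists_ind_equiv ρ hq hΞ hω hρ hV ![0, 1] (fun z => ?_) (fun z x => ?_) (fun z i => ?_)
  · constructor
    · rintro ⟨a, b⟩ ⟨c, d⟩ h
      have e0 := congrFun h 0
      have e1 := congrFun h 1
      simp at e0 e1
      rw [e0, e1]
    · intro y
      refine ⟨(y 1, y 0 * (z⁻¹ : Cˣ)), ?_⟩
      funext j
      fin_cases j <;> simp
  · rw [stdHom_zk, hχ]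
    funext j
    fin_cases j <;> simp [Matrix.vecMul, dotProduct]
  · fin_cases i
    · change Matrix.vecMul _ (stdHom hq χ z (T C (sLift 0))) = _
      rw [stdHom_sLift_zero]
      refine Eq.trans ?_ (congrArg (· • ![(0 : C), 1]) h0.symm)
      funext j
      fin_cases j <;> simp [Matrix.vecMul, dotProduct]
    · change Matrix.vecMul _ (stdHom hq χ z (T C (sLift 1))) = _
      rw [sLift_one, stdHom_s1]
      refine Eq.trans ?_ (congrArg (· • ![(0 : C), 1]) h1.symm)
      funext j
      fin_cases j <;> simp [Matrix.vecMul, dotProduct]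

/-- Supersingular induced modules are standard modules. -/
theorem exists_equiv_of_isSupersingular (hΞ : IsXi χ J Ξ) (hρ : ρ.IsIrreducible)
    (hV : RestrictsTo χ ρ) (hss : IsSupersingular C k (Ind Ξ ρ)) :
    ∃ z : Cˣ, Nonempty (Ind Ξ ρ ≃ₗ[(H C k)ᵐᵒᵖ] RowMod.{v, w} (stdHom hq χ z)) := by
  classical
  have hi := xi_sLift hΞ
  by_cases hχ : ∀ x, χ (sw x) = χ x
  · have hk := kap_ne_zero hq χ hχ
    -- If `J` is empty or everything, `Ξ` takes equal values at the two reflections and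
    -- supersingularity fails; a one-element `J` gives the values `0` and `kap χ ≠ 0`, so `ω` moves
    -- `Ξ`.
    by_cases h0 : (0 : Fin 2) ∈ J <;> by_cases h1 : (1 : Fin 2) ∈ J
    · refine absurd hss (not_isSupersingular ρ hq hΞ hρ hV hχ (.inl rfl) fun i => ?_)
      rw [hi]
      fin_cases i
      exacts [if_pos h0, if_pos h1]
    · have e0 := (hi 0).trans (if_pos h0)
      have e1 := (hi 1).trans (if_neg h1)
      exact exists_ind_equiv_left hq ρ hΞ (omg_notMem_of_sLift (by rw [e0, e1]; exact hk.symm))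
        hρ hV e0 e1
    · have e0 := (hi 0).trans (if_neg h0)
      have e1 := (hi 1).trans (if_pos h1)
      exact exists_ind_equiv_right hq ρ hΞ (omg_notMem_of_sLift (by rw [e0, e1]; exact hk))
        hρ hV hχ e0 e1
    · refine absurd hss (not_isSupersingular ρ hq hΞ hρ hV hχ (.inr rfl) fun i => ?_)
      rw [hi]
      fin_cases i
      exacts [if_neg h0, if_neg h1]
  · have hk := kap_eq_zero χ hχ
    have e : ∀ i, Ξ ⟨T C (sLift i), T_mem_Haff (sLift_mem i)⟩ = 0 := fun i => by
      rw [hi, hk, ite_self]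
    exact exists_ind_equiv_left hq ρ hΞ (omg_notMem_of_zk hΞ hχ) hρ hV (e 0)
      ((e 1).trans hk.symm)

end Classification

/-! ### Dimensions of `Ext¹` between standard modules -/

section Main

variable {C : Type v} {k : Type u} [Field C] [Field k]

theorem forall_mulSingle_iff (χ : Zk k →* Cˣ) :
    (∀ x, χ (Pi.mulSingle 0 x) = χ (Pi.mulSingle 1 x)) ↔ ∀ x, χ (sw x) = χ x := by
  have h0 : ∀ x : kˣ, (Pi.mulSingle 0 x : Zk k) = ![x, 1] := fun x => by
    funext j; fin_cases j <;> simp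
  have h1 : ∀ x : kˣ, (Pi.mulSingle 1 x : Zk k) = ![1, x] := fun x => by
    funext j; fin_cases j <;> simp
  simp only [h0, h1]
  refine ⟨fun h => chi_swap χ h, fun h x => ?_⟩
  rw [← h]
  congr 1
  funext j
  fin_cases j <;> simp [arr_zero, arr_one, -mulAutArrow_apply_apply]

theorem natCast_card_eq_zero [Finite k] (p : ℕ) [Fact p.Prime] [CharP k p] [CharP C p] :
    (Nat.card k : C) = 0 := by
  have := Fintype.ofFinite k
  obtain ⟨n, -, hn⟩ := FiniteField.card k p
  rw [Nat.card_eq_fintype_card, hn]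
  simp

variable {M M' N N' : Type (max u v t)} [AddCommGroup M] [Module (H C k)ᵐᵒᵖ M] [AddCommGroup N]
  [Module (H C k)ᵐᵒᵖ N] [AddCommGroup M'] [Module (H C k)ᵐᵒᵖ M'] [AddCommGroup N']
  [Module (H C k)ᵐᵒᵖ N']

theorem dimExt1_congr (e : M ≃ₗ[(H C k)ᵐᵒᵖ] M') (f : N ≃ₗ[(H C k)ᵐᵒᵖ] N') :
    dimExt1.{u, v, t} C k M N = dimExt1.{u, v, t} C k M' N' :=
  (extCongr C e.toModuleIso f.toModuleIso 1).rank_eq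

variable [Finite k] (hq : (Nat.card k : C) = 0) (χ : Zk k →* Cˣ) (z : Cˣ)

/-- The standard two-dimensional module. -/
abbrev Std : Type (max u v t) := RowMod.{v, max v t (max u v), max u v} (stdHom hq χ z)

theorem dimExt1_std_of_ne (χ' : Zk k →* Cˣ) (z' : Cˣ)
    (h : IsEmpty (Std.{u, v, t} hq χ z ≃ₗ[(H C k)ᵐᵒᵖ] Std.{u, v, t} hq χ' z')) :
    dimExt1.{u, v, t} C k (Std.{u, v, t} hq χ z) (Std.{u, v, t} hq χ' z') = 0 := by
  -- Standard modules with the same `z` and with characters equal up to the swap are isomorphic.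
  have hne : z = z' → χ' ≠ χ ∧ ¬ ∀ x, χ' x = χ (sw x) := by
    rintro rfl
    have h1 : χ' ≠ χ := by
      rintro rfl
      exact h.false (LinearEquiv.refl _ _)
    refine ⟨h1, fun h2 => ?_⟩
    by_cases hχ : ∀ x, χ (sw x) = χ x
    · exact h1 (MonoidHom.ext fun x => (h2 x).trans (hχ x))
    · exact (nonempty_rowModEquiv_sw hq χ z hχ χ' h2).elim h.false
  have := rank_ext_rowMod.{v, t, max u v} (stdHom hq χ z) (stdHom hq χ' z') (m := 0) 0
    (fun y => ⟨0, Subsingleton.elim _ _⟩)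
    (fun δ => ⟨fun _ => exists_coboundary_of_ne hq χ z χ' z' hne δ.1 δ.2, fun _ => rfl⟩)
  exact this.trans (by simp)

theorem dimExt1_std_self_of_symm (hχ : ∀ x, χ (sw x) = χ x) :
    dimExt1.{u, v, t} C k (Std.{u, v, t} hq χ z) (Std.{u, v, t} hq χ z) = 2 := by
  have := rank_ext_rowMod.{v, t, max u v} (stdHom hq χ z) (stdHom hq χ z) (invSymm hq χ z)
    (invSymm_surjective hq χ z hχ) (invSymm_eq_zero_iff hq χ z hχ)
  exact this.trans (by simp)

theorem dimExt1_std_self_of_regular (hχ : ¬ ∀ x, χ (sw x) = χ x) :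
    dimExt1.{u, v, t} C k (Std.{u, v, t} hq χ z) (Std.{u, v, t} hq χ z) = 3 := by
  have := rank_ext_rowMod.{v, t, max u v} (stdHom hq χ z) (stdHom hq χ z) (invRegular hq χ z)
    (invRegular_surjective hq χ z hχ) (invRegular_eq_zero_iff hq χ z hχ)
  exact this.trans (by simp)

end Main

end GL2Hecke

end

theorem mainTheorem9
    {F : Type u} [Field F] [ValuativeRel F] [TopologicalSpace F] [IsNonarchimedeanLocalField F]
    (p : ℕ) [Fact p.Prime] [CharP (GL2Hecke.ResField F) p]
    {C : Type v} [Field C] [IsAlgClosed C] [CharP C p]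
    (χ χ' : GL2Hecke.Zk (GL2Hecke.ResField F) →* Cˣ) (J J' : Set (Fin 2))
    (hJ : J ⊆ GL2Hecke.SaffChi χ) (hJ' : J' ⊆ GL2Hecke.SaffChi χ')
    {V V' : Type t} [AddCommGroup V] [Module C V] [AddCommGroup V'] [Module C V']
    (ρ : Representation C (GL2Hecke.Omega1Xi (GL2Hecke.Xi (C := C) p χ J))ᵐᵒᵖ V)
    (ρ' : Representation C (GL2Hecke.Omega1Xi (GL2Hecke.Xi (C := C) p χ' J'))ᵐᵒᵖ V')
    (hρ : ρ.IsIrreducible) (hρ' : ρ'.IsIrreducible)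
    (hV : GL2Hecke.RestrictsTo χ ρ) (hV' : GL2Hecke.RestrictsTo χ' ρ')
    (hss : GL2Hecke.IsSupersingular C (GL2Hecke.ResField F) (GL2Hecke.piMod p χ J ρ))
    (hss' : GL2Hecke.IsSupersingular C (GL2Hecke.ResField F) (GL2Hecke.piMod p χ' J' ρ')) :
    (IsEmpty (GL2Hecke.piMod p χ J ρ ≃ₗ[(GL2Hecke.H C (GL2Hecke.ResField F))ᵐᵒᵖ]
        GL2Hecke.piMod p χ' J' ρ') →
      GL2Hecke.dimExt1.{u, v, t} C (GL2Hecke.ResField F)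
        (GL2Hecke.piMod p χ J ρ) (GL2Hecke.piMod p χ' J' ρ') = 0) ∧
    (Nonempty (GL2Hecke.piMod p χ J ρ ≃ₗ[(GL2Hecke.H C (GL2Hecke.ResField F))ᵐᵒᵖ]
        GL2Hecke.piMod p χ' J' ρ') →
      (∀ x, χ (Pi.mulSingle 0 x) = χ (Pi.mulSingle 1 x)) →
      GL2Hecke.dimExt1.{u, v, t} C (GL2Hecke.ResField F)
        (GL2Hecke.piMod p χ J ρ) (GL2Hecke.piMod p χ' J' ρ') = 2) ∧
    (Nonempty (GL2Hecke.piMod p χ J ρ ≃ₗ[(GL2Hecke.H C (GL2Hecke.ResField F))ᵐᵒᵖ]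
        GL2Hecke.piMod p χ' J' ρ') →
      (¬ ∀ x, χ (Pi.mulSingle 0 x) = χ (Pi.mulSingle 1 x)) →
      GL2Hecke.dimExt1.{u, v, t} C (GL2Hecke.ResField F)
        (GL2Hecke.piMod p χ J ρ) (GL2Hecke.piMod p χ' J' ρ') = 3) := by
  have hq := GL2Hecke.natCast_card_eq_zero (C := C) (k := GL2Hecke.ResField F) p
  obtain ⟨z, ⟨e⟩⟩ := GL2Hecke.exists_equiv_of_isSupersingular.{u, v, t, max u v t} hq ρ
    (GL2Hecke.existsUnique_xi p χ J).choose_spec.1 hρ hV hss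
  obtain ⟨z', ⟨e'⟩⟩ := GL2Hecke.exists_equiv_of_isSupersingular.{u, v, t, max u v t} hq ρ'
    (GL2Hecke.existsUnique_xi p χ' J').choose_spec.1 hρ' hV' hss'
  rw [GL2Hecke.forall_mulSingle_iff]
  refine ⟨fun h => ?_, fun ⟨f⟩ hχ => ?_, fun ⟨f⟩ hχ => ?_⟩
  · exact (GL2Hecke.dimExt1_congr.{u, v, t} e e').trans
      (GL2Hecke.dimExt1_std_of_ne.{u, v, t} hq χ z χ' z'
        ⟨fun g => h.false (e.trans (g.trans e'.symm))⟩)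
  -- Both arguments are carried to the same standard module, the second one through `f`, so that the
  -- parameters `χ'` and `z'` play no role.
  · exact (GL2Hecke.dimExt1_congr.{u, v, t} e (f.symm.trans e)).trans
      (GL2Hecke.dimExt1_std_self_of_symm.{u, v, t} hq χ z hχ)
  · exact (GL2Hecke.dimExt1_congr.{u, v, t} e (f.symm.trans e)).trans
      (GL2Hecke.dimExt1_std_self_of_regular.{u, v, t} hq χ z hχ)
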